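/- **Setting.** Let $\mathbb T$ be the unit circle. For matrix functions on $\mathbb T$ put $\|X\|_2^2=\frac1{2\pi}\int_{-\pi}^{\pi}\|X(e^{i\omega})\|_F^2\,d\omega$ and $\|X\|_1=\frac1{2\pi}\int_{-\pi}^{\pi}\operatorname{tr}\sqrt{X(e^{i\omega})^*X(e^{i\omega})}\,d\omega$; equalities on $\mathbb T$ hold almost everywhere. $\mathcal R$ is the set of proper rational functions with real coefficients, $\mathcal{RH}_\infty\subset\mathcal R$ the subset of those with all poles in $|z|<1$, and $\mathcal{RL}_1\subset\mathcal R$ the subset of those without poles on $\mathbb T$. $\mathcal H_2$ is the Hardy space of functions that are analytic in $|z|>1$, including $\infty$, with $\sup_{r>1}\|X(r\,\cdot)\|_2<\infty$, evaluated on $\mathbb T$ by radial limits. $X\in\mathcal H_2$ is outer if $\log|X|\in L_1(\mathbb T)$ and $X(z)=c\exp\big(\frac1{2\pi}\int_{-\pi}^{\pi}\frac{z+e^{it}}{z-e^{it}}\log|X(e^{it})|\,dt\big)$ for $|z|>1$, with $|c|=1$. Let $G=\begin{bmatrix}G_{zv}&G_{zu}\\G_{yv}&G_{yu}\end{bmatrix}$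 have a real state space realization with state matrix $A_0$, input matrix $[B_1\ B_2]$, output matrix $\begin{bmatrix}C_1\\C_2\end{bmatrix}$ and feedthrough $\begin{bmatrix}D_{11}&D_{12}\\D_{21}&0\end{bmatrix}$, where $(A_0,B_2)$ is stabilizable, $(C_2,A_0)$ is detectable, $G_{zv}$ is $n_z\times n_v$, $G_{zu}$ is $n_z\times1$, $G_{yv}$ is $1\times n_v$, and $G_{yu}$ is scalar and not identically zero. Let $\sigma^2>0$. Suppose that $G_{yu}=NM^{-1}$ with $M,N\in\mathcal{RH}_\infty$ and $VM+UN=1$ with $U,V\in\mathcal{RH}_\infty$. Suppose that $H\in\mathcal{RH}_\infty$ has no zeros on $\mathbb T$, and that $G_{zu}^*G_{zu}$ and $G_{yv}G_{yv}^*$ have neither zeros nor poles on $\mathbb T$. For functions $C,D$ on $\mathbb T$ and $K=DC$ let $$J(C,D)=\Big\|G_{zv}+\frac{KG_{zu}G_{yv}}{1-KG_{yu}}\Big\|_2^2+\Big\|\frac{DHG_{zu}}{1-KG_{yu}}\Big\|_2^2 .$$ Let $\Theta_{C,D}$ be the set of all $(C,D)$ such that $DC\in\mathcal R$, the SNR constraint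 $\big\|\frac{CG_{yv}}{1-KG_{yu}}\big\|_2^2+\big\|\frac{KHG_{yu}}{1-KG_{yu}}\big\|_2^2\le\sigma^2$ holds, and the loop is internally stable, that is, the functions obtained by dividing $KG_{yu},\,G_{yu},\,DG_{yu},\,C,\,CG_{yu},\,K,\,D$ by $1-KG_{yu}$ all belong to $\mathcal H_2$. Put $$A=M^2G_{zu}G_{yv},\quad B=M^2N^{-1}VG_{zu}G_{yv},\quad E=MNH,\quad F=(MV-1)H,\quad L=G_{zv}-MN^{-1}G_{zu}G_{yv},$$ $$\Theta_Q=\{Q\in\mathcal{RH}_\infty:\|EQ+F\|_2^2<\sigma^2\},\qquad \varphi(Q)=\|L+AQ+B\|_2^2+\frac{\|(AQ+B)(EQ+F)\|_1^2}{\sigma^2-\|EQ+F\|_2^2}.$$ **Theorem.** One has $$\inf_{(C,D)\in\Theta_{C,D}}J(C,D)=\inf_{Q\in\Theta_Q}\varphi(Q)$$ (an infimum over the empty set being $+\infty$). Furthermore, let $Q\in\Theta_Q$ and $\varepsilon>0$. Then there exists $\hat Q\in\Theta_Q$ with $K=\frac{M\hat Q-U}{N\hat Q+V}\in\mathcal{RL}_1$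 and $\varphi(\hat Q)<\varphi(Q)+\varepsilon$, and for every such $\hat Q$ there exists a pair $(C,D)$ satisfying the following conditions: * if $M\hat Q-U$ is not identically zero: $C\in\mathcal H_2$ is outer, $D\in L_2(\mathbb T)$, and with $K$ as above $$|C|^2=\frac{\sigma^2-\Big\|\dfrac{KHG_{yu}}{1-KG_{yu}}\Big\|_2^2}{\Big\|\dfrac{KHG_{zu}G_{yv}}{(1-KG_{yu})^2}\Big\|_1}\sqrt{\frac{G_{zu}^*G_{zu}}{G_{yv}G_{yv}^*}}\;|KH|\ \text{ on }\mathbb T,\qquad D=KC^{-1};$$ * if $M\hat Q-U=0$: $C=D=0$. Every pair $(C,D)$ satisfying these conditions belongs to $\Theta_{C,D}$ and has $J(C,D)<\varphi(Q)+\varepsilon$. -/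

import Mathlib

open MeasureTheory Filter Topology
open scoped ENNReal

namespace SNRControl

noncomputable section

/-! ### Rational transfer functions -/

/-- Value of a real rational transfer function at a complex point (after cancellation of common
factors; at a pole the value is the junk value `0`). -/
def evalAt (p : RatFunc ℝ) (z : ℂ) : ℂ := p.eval (algebraMap ℝ ℂ) z

/-- Proper: analytic at infinity, that is, the numerator degree is at most the denominator
degree (in lowest terms). This is membership in the space `𝓡` of real rational proper transfer
functions. -/
def IsProper (p : RatFunc ℝ) : Prop := p.num.natDegree ≤ p.denom.natDegree

/-- Stable: all poles lie in the open unit disc. -/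
def IsStable (p : RatFunc ℝ) : Prop := ∀ z : ℂ, 1 ≤ ‖z‖ → Polynomial.aeval z p.denom ≠ 0

/-- No poles on the unit circle. -/
def NoPolesOnCircle (p : RatFunc ℝ) : Prop :=
  ∀ z : ℂ, ‖z‖ = 1 → Polynomial.aeval z p.denom ≠ 0

/-- No zeros on the unit circle. -/
def NoZerosOnCircle (p : RatFunc ℝ) : Prop :=
  ∀ z : ℂ, ‖z‖ = 1 → Polynomial.aeval z p.num ≠ 0

/-- `𝓡H_∞`: real, rational, stable and proper. -/
def MemRH (p : RatFunc ℝ) : Prop := IsProper p ∧ IsStable p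

/-- `𝓡L_1`: real, rational, proper, without poles on the unit circle. -/
def MemRL (p : RatFunc ℝ) : Prop := IsProper p ∧ NoPolesOnCircle p

/-- The rational function `z ↦ p (1 / z)`. As `p` has real coefficients, its value at a point of
the unit circle is the complex conjugate of the value of `p`. -/
def paraConj (p : RatFunc ℝ) : RatFunc ℝ := p.eval RatFunc.C (RatFunc.X)⁻¹

/-- `X ↦ X^*` on rational transfer matrices: `X^*(z) = X(1/z)ᵀ`, which on the unit circle is the
conjugate transpose. -/
def starTransfer {m k : ℕ} (X : Matrix (Fin m) (Fin k) (RatFunc ℝ)) :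
    Matrix (Fin k) (Fin m) (RatFunc ℝ) := (X.map paraConj).transpose

/-! ### Functions on the unit circle

A function on the unit circle is represented by the function `ω ↦ X(e^{iω})` of the angle
`ω ∈ (-π, π]`; only its class modulo null sets for `circMeasure` matters. -/

/-- The normalized arc length `dω / 2π` on `(-π, π]`. -/
def circMeasure : Measure ℝ :=
  ENNReal.ofReal (2 * Real.pi)⁻¹ • volume.restrict (Set.Ioc (-Real.pi) Real.pi)

/-- The point `e^{iω}`. -/
def pt (ω : ℝ) : ℂ := Complex.exp (ω * Complex.I)

/-- A rational function restricted to the unit circle. -/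
def onCirc (p : RatFunc ℝ) (ω : ℝ) : ℂ := evalAt p (pt ω)

/-- A rational matrix restricted to the unit circle. -/
def matOnCirc {m k : ℕ} (X : Matrix (Fin m) (Fin k) (RatFunc ℝ)) (ω : ℝ) :
    Matrix (Fin m) (Fin k) ℂ := X.map fun p => onCirc p ω

/-- A scalar function seen as a `1 × 1` matrix-valued one. -/
def scal (f : ℝ → ℂ) (ω : ℝ) : Matrix (Fin 1) (Fin 1) ℂ := Matrix.of fun _ _ => f ω

/-- `‖X‖₂²`, the mean over the circle of the squared Frobenius norm (possibly `∞`). -/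
def normTwoSq {m k : ℕ} (X : ℝ → Matrix (Fin m) (Fin k) ℂ) : ℝ≥0∞ :=
  ∫⁻ ω, ∑ i, ∑ j, ‖X ω i j‖ₑ ^ 2 ∂circMeasure

/-- `tr √(X^* X)`: the sum of the square roots of the eigenvalues of `X^* X`. -/
def nuclearNorm {m k : ℕ} (X : Matrix (Fin m) (Fin k) ℂ) : ℝ :=
  ∑ i, Real.sqrt ((Matrix.isHermitian_conjTranspose_mul_self X).eigenvalues i)

/-- `‖X‖₁`, the mean over the circle of `tr √(X^* X)` (possibly `∞`). -/
def normOne {m k : ℕ} (X : ℝ → Matrix (Fin m) (Fin k) ℂ) : ℝ≥0∞ :=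
  ∫⁻ ω, ENNReal.ofReal (nuclearNorm (X ω)) ∂circMeasure

/-- `X` belongs to the Hardy space `H²` of the exterior of the unit disc: `w ↦ X (1 / w)` is
analytic on the open unit disc (including `w = 0`) and the `L²` norms over the circles of radius
`r > 1` are bounded. Only the values `X z` with `1 < ‖z‖` matter. -/
def IsHardyTwo (X : ℂ → ℂ) : Prop :=
  (∃ Y : ℂ → ℂ, DifferentiableOn ℂ Y (Metric.ball 0 1) ∧ ∀ z : ℂ, 1 < ‖z‖ → X z = Y z⁻¹) ∧
  ∃ b : ℝ≥0∞, b < ∞ ∧ ∀ r : ℝ, 1 < r → ∫⁻ ω, ‖X (r * pt ω)‖ₑ ^ 2 ∂circMeasure ≤ b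

/-- The function `f` on the circle is the radial limit of `X` from outside, almost everywhere. -/
def IsBoundaryValue (X : ℂ → ℂ) (f : ℝ → ℂ) : Prop :=
  ∀ᵐ ω ∂circMeasure, Tendsto (fun r : ℝ => X (r * pt ω)) (𝓝[>] 1) (𝓝 (f ω))

/-- The function `f` on the circle is (the boundary function of) an element of `H²`. -/
def MemHardyTwo (f : ℝ → ℂ) : Prop := ∃ X : ℂ → ℂ, IsHardyTwo X ∧ IsBoundaryValue X f

/-- The function `f` on the circle is (the boundary function of) an outer element of `H²`: its
analytic extension `X` satisfies, for a unimodular constant `c`,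
`X(z) = c exp ((1/2π) ∫ (z + e^{it}) / (z - e^{it}) log |f(e^{it})| dt)` for `|z| > 1`. -/
def IsOuterHardyTwo (f : ℝ → ℂ) : Prop :=
  ∃ X : ℂ → ℂ, IsHardyTwo X ∧ IsBoundaryValue X f ∧
    (∀ᵐ ω ∂circMeasure, f ω ≠ 0) ∧ Integrable (fun ω => Real.log ‖f ω‖) circMeasure ∧
    ∃ c : ℂ, ‖c‖ = 1 ∧ ∀ z : ℂ, 1 < ‖z‖ →
      X z = c * Complex.exp
        (∫ t, (z + pt t) / (z - pt t) * (Real.log ‖f t‖ : ℂ) ∂circMeasure)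

/-! ### The plant -/

/-- A discrete-time plant in state space form, with exogenous input `v` (`nv` components), scalar
control input `u`, performance output `z` (`nz` components) and scalar measurement `y`. There is
no direct feedthrough from `u` to `y`. -/
structure Plant (n nv nz : ℕ) where
  A : Matrix (Fin n) (Fin n) ℝ
  B₁ : Matrix (Fin n) (Fin nv) ℝ
  B₂ : Matrix (Fin n) (Fin 1) ℝ
  C₁ : Matrix (Fin nz) (Fin n) ℝ
  C₂ : Matrix (Fin 1) (Fin n) ℝ
  D₁₁ : Matrix (Fin nz) (Fin nv) ℝ
  D₁₂ : Matrix (Fin nz) (Fin 1) ℝ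
  D₂₁ : Matrix (Fin 1) (Fin nv) ℝ

/-- All eigenvalues lie in the open unit disc. -/
def IsSchur {n : ℕ} (A : Matrix (Fin n) (Fin n) ℝ) : Prop :=
  ∀ z : ℂ, Polynomial.aeval z A.charpoly = 0 → ‖z‖ < 1

/-- The transfer matrix `C (zI - A)⁻¹ B + D`. -/
def transfer {n m k : ℕ} (A : Matrix (Fin n) (Fin n) ℝ) (B : Matrix (Fin n) (Fin k) ℝ)
    (C : Matrix (Fin m) (Fin n) ℝ) (D : Matrix (Fin m) (Fin k) ℝ) :
    Matrix (Fin m) (Fin k) (RatFunc ℝ) :=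
  C.map RatFunc.C *
    ((RatFunc.X : RatFunc ℝ) • (1 : Matrix (Fin n) (Fin n) (RatFunc ℝ)) - A.map RatFunc.C)⁻¹ *
      B.map RatFunc.C + D.map RatFunc.C

namespace Plant

variable {n nv nz : ℕ} (P : Plant n nv nz)

/-- `(A, B₂)` is stabilizable. -/
def IsStabilizable : Prop := ∃ F : Matrix (Fin 1) (Fin n) ℝ, IsSchur (P.A + P.B₂ * F)

/-- `(C₂, A)` is detectable. -/
def IsDetectable : Prop := ∃ R : Matrix (Fin n) (Fin 1) ℝ, IsSchur (P.A + R * P.C₂)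

def Gzv : Matrix (Fin nz) (Fin nv) (RatFunc ℝ) := transfer P.A P.B₁ P.C₁ P.D₁₁

def Gzu : Matrix (Fin nz) (Fin 1) (RatFunc ℝ) := transfer P.A P.B₂ P.C₁ P.D₁₂

def Gyv : Matrix (Fin 1) (Fin nv) (RatFunc ℝ) := transfer P.A P.B₁ P.C₂ P.D₂₁

def Gyu : RatFunc ℝ := transfer P.A P.B₂ P.C₂ 0 0 0

/-- The scalar rational function `Gzu^* Gzu`. -/
def gramZu : RatFunc ℝ := (starTransfer P.Gzu * P.Gzu) 0 0

/-- The scalar rational function `Gyv Gyv^*`. -/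
def gramYv : RatFunc ℝ := (P.Gyv * starTransfer P.Gyv) 0 0

end Plant

/-! ### The control problem over pairs `(C, D)` -/

section Problem

variable {n nv nz : ℕ} (P : Plant n nv nz) (H M N U V : RatFunc ℝ) (σ : ℝ)

/-- The closed loop map `T` from `(w₁, w₂, n)` to `(y, t, u)`, on the unit circle. -/
def closedLoop (C D : ℝ → ℂ) (ω : ℝ) : Matrix (Fin 3) (Fin 3) ℂ :=
  let G := onCirc P.Gyu ω
  let K := D ω * C ω
  !![K * G / (1 - K * G), G / (1 - K * G), D ω * G / (1 - K * G);
     C ω / (1 - K * G), C ω * G / (1 - K * G), K * G / (1 - K * G);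
     K / (1 - K * G), K * G / (1 - K * G), D ω / (1 - K * G)]

/-- Internal stability: every closed loop transfer function is in `H²`. -/
def InternallyStable (C D : ℝ → ℂ) : Prop :=
  ∀ i j, MemHardyTwo fun ω => closedLoop P C D ω i j

/-- The cost `J(C, D)`. -/
def J (C D : ℝ → ℂ) : ℝ≥0∞ :=
  normTwoSq (fun ω => matOnCirc P.Gzv ω +
    (D ω * C ω / (1 - D ω * C ω * onCirc P.Gyu ω)) • (matOnCirc P.Gzu ω * matOnCirc P.Gyv ω)) +
  normTwoSq (fun ω =>
    (D ω * onCirc H ω / (1 - D ω * C ω * onCirc P.Gyu ω)) • matOnCirc P.Gzu ω)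

/-- The SNR (power) constraint. -/
def SNRConstraint (C D : ℝ → ℂ) : Prop :=
  normTwoSq (fun ω => (C ω / (1 - D ω * C ω * onCirc P.Gyu ω)) • matOnCirc P.Gyv ω) +
  normTwoSq (scal fun ω =>
    D ω * C ω * onCirc H ω * onCirc P.Gyu ω / (1 - D ω * C ω * onCirc P.Gyu ω)) ≤
  ENNReal.ofReal (σ ^ 2)

/-- The feasible set `Θ_{C,D}`: the product `D C` is a real rational proper transfer function, the
SNR constraint holds and the closed loop is internally stable. -/
def ThetaCD : Set ((ℝ → ℂ) × (ℝ → ℂ)) :=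
  {p | (∃ K : RatFunc ℝ, IsProper K ∧ ∀ᵐ ω ∂circMeasure, p.2 ω * p.1 ω = onCirc K ω) ∧
    SNRConstraint P H σ p.1 p.2 ∧ InternallyStable P p.1 p.2}

/-! ### The problem in the Youla parameter -/

def Amat : Matrix (Fin nz) (Fin nv) (RatFunc ℝ) := M ^ 2 • (P.Gzu * P.Gyv)

def Bmat : Matrix (Fin nz) (Fin nv) (RatFunc ℝ) := (M ^ 2 * N⁻¹ * V) • (P.Gzu * P.Gyv)

def Efun : RatFunc ℝ := M * N * H

def Ffun : RatFunc ℝ := (M * V - 1) * H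

def Lmat : Matrix (Fin nz) (Fin nv) (RatFunc ℝ) := P.Gzv - (M * N⁻¹) • (P.Gzu * P.Gyv)

/-- `‖E Q + F‖₂²`. -/
def effort (Q : RatFunc ℝ) : ℝ≥0∞ :=
  normTwoSq (scal (onCirc (Efun H M N * Q + Ffun H M V)))

/-- The feasible set `Θ_Q`. -/
def ThetaQ : Set (RatFunc ℝ) := {Q | MemRH Q ∧ effort H M N V Q < ENNReal.ofReal (σ ^ 2)}

/-- `φ(Q) = ‖L + A Q + B‖₂² + ‖(A Q + B) (E Q + F)‖₁² / (σ² - ‖E Q + F‖₂²)`. -/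
def phi (Q : RatFunc ℝ) : ℝ≥0∞ :=
  normTwoSq (matOnCirc (Lmat P M N + Q • Amat P M + Bmat P M N V)) +
  normOne (matOnCirc
    ((Efun H M N * Q + Ffun H M V) • (Q • Amat P M + Bmat P M N V))) ^ 2 /
      (ENNReal.ofReal (σ ^ 2) - effort H M N V Q)

/-- The Youla formula `K = (M Q - U) / (N Q + V)`. -/
def youla (Q : RatFunc ℝ) : RatFunc ℝ := (M * Q - U) / (N * Q + V)

/-- `Q'` is an `ε`-perturbation of `Q`: feasible, with `K` free of poles on the unit circle, and
with cost less than `φ(Q) + ε`. -/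
def IsPerturbation (Q : RatFunc ℝ) (ε : ℝ) (Q' : RatFunc ℝ) : Prop :=
  Q' ∈ ThetaQ H M N V σ ∧ MemRL (youla M N U V Q') ∧
    phi P H M N V σ Q' < phi P H M N V σ Q + ENNReal.ofReal ε

/-- The constant `(σ² - ‖K H G_yu / (1 - K G_yu)‖₂²) / ‖K H G_zu G_yv / (1 - K G_yu)²‖₁`. -/
def gain (K : RatFunc ℝ) : ℝ :=
  (σ ^ 2 - (normTwoSq (scal (onCirc (K * H * P.Gyu / (1 - K * P.Gyu))))).toReal) /
  (normOne (matOnCirc ((K * H / (1 - K * P.Gyu) ^ 2) • (P.Gzu * P.Gyv)))).toReal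

/-- The encoder/decoder pair built from `Q`: with `K` given by the Youla formula, `C ∈ H²` is
outer with prescribed modulus and `D = K C⁻¹ ∈ L²`; in the degenerate case `K = 0` both
vanish. -/
def IsFactorPair (Q : RatFunc ℝ) (C D : ℝ → ℂ) : Prop :=
  let K := youla M N U V Q
  (M * Q - U ≠ 0 →
    IsOuterHardyTwo C ∧ MemLp D 2 circMeasure ∧
    (∀ᵐ ω ∂circMeasure, ‖C ω‖ ^ 2 =
      gain P H σ K *
        Real.sqrt ((((matOnCirc P.Gzu ω).conjTranspose * matOnCirc P.Gzu ω) 0 0).re /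
          ((matOnCirc P.Gyv ω * (matOnCirc P.Gyv ω).conjTranspose) 0 0).re) *
        ‖onCirc K ω * onCirc H ω‖) ∧
    ∀ᵐ ω ∂circMeasure, D ω = onCirc K ω * (C ω)⁻¹) ∧
  (M * Q - U = 0 → (∀ᵐ ω ∂circMeasure, C ω = 0) ∧ ∀ᵐ ω ∂circMeasure, D ω = 0)

end Problem

end

end SNRControl

open SNRControl

/-!
With `a = M Q - U` and `b = N Q + V` the Bézout identity becomes `M b - N a = 1`, so the controller
`K = a / b` has `(1 - K G_yu)⁻¹ = M b`, and every closed loop function that depends on `K` alone is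
a product of elements of `𝓡H_∞`. Writing `T = G_zv + M a G_zu G_yv`, the cost and the power spent on
a pair with `D C = K` are

* `J(C, D) = ‖T‖₂² + ‖D H M b G_zu‖₂²`,
* `‖C M b G_yv‖₂² + ‖H N a‖₂²`, where `H N a = E Q + F`,

while the cross term of `φ(Q)` is the `L¹` norm of `(D H M b G_zu) (C M b G_yv)`, because the nuclear
norm of a product of a column and a row is the product of their Euclidean norms.

*Lower bound* (`Standing.exists_phi_le`). If the loop is stable, the closed loop functions
`K / (1 - K G_yu)`, `K G_yu / (1 - K G_yu)` and `G_yu / (1 - K G_yu)` are rational and in `H²`. A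
rational function in `H²` is stable and proper (`memRH_of_memHardyTwo`): a pole on the circle would
destroy integrability, and off the circle uniqueness of boundary values identifies the `H²`
extension with the rational function. Hence `K` is given by a Youla parameter
(`Standing.exists_youla`), and the Cauchy–Schwarz inequality with the power constraint gives
`φ(Q) ≤ J(C, D)`. Strict feasibility of `Q` holds because equality would force `C = 0`, hence `K = 0`.

*Upper bound* (`OptimalPair.spec`). If `K` has no poles on the circle, Cauchy–Schwarz is an equality,
with all the power spent, exactly for the stated modulus of `C`. Its logarithm is a combination of
logarithms of moduli of rational functions, whose Herglotz transforms are explicit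
(`hasOuterExtension_log_onCirc`): for `log |ζ - α|` with `|α| ≤ 1` the transform is
`log (1 - α / z)`, and other zeros are reflected in the circle. Exponentiating gives the outer `C`,
which is bounded because the modulus is (`exists_isOuterHardyTwo`). For the stability of the loop,
`D M b` and `D N b` are quotients `M a / C` and `N a / C`, bounded on the circle since `|D|²` is
comparable to `|K|`; a quotient by an outer function with bounded boundary values is bounded outside
the disc (`IsOuterHardyTwo.memHardyTwo_div`), by the Jensen inequality for the numerator.

*Perturbation* (`Standing.exists_perturbation`). Poles of `K` on the circle are removed by moving `Q`
to `Q + δ s` with `δ` real and `s = 1` or `s = X⁻¹`. A zero of `b + δ N s` on the circle is a point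
where the real rational function `b / (N s)` is real; unless that function agrees with its complex
conjugate on the whole circle there are finitely many such points, and this exception cannot occur
for both choices of `s`. The cost depends continuously on `δ`, by dominated convergence, since `T`
has no poles on the circle: stabilizability and detectability pass from the loop around `G_yu` to
the whole plant (`Plant.regMatAt_closedLoop`).
-/

namespace SNRControl

noncomputable section

/-! ### Evaluation of rational functions -/

/-- `p` is regular at `z`: in lowest terms its denominator does not vanish at `z`. -/
def RegAt (z : ℂ) (p : RatFunc ℝ) : Prop := Polynomial.aeval z p.denom ≠ 0

lemma evalAt_def (p : RatFunc ℝ) (z : ℂ) :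
    evalAt p z = Polynomial.aeval z p.num / Polynomial.aeval z p.denom := rfl

lemma regAt_of_eq_div {p : RatFunc ℝ} {a b : Polynomial ℝ} {z : ℂ}
    (h : p = algebraMap _ _ a / algebraMap _ _ b) (hb : Polynomial.aeval z b ≠ 0) :
    RegAt z p ∧ evalAt p z = Polynomial.aeval z a / Polynomial.aeval z b := by
  have hb0 : b ≠ 0 := by rintro rfl; simp at hb
  have h1 : p.denom ∣ b := (RatFunc.denom_dvd hb0).2 ⟨a, h⟩
  have h2 := (RatFunc.num_mul_eq_mul_denom_iff hb0).2 h
  have hd : Polynomial.aeval z p.denom ≠ 0 := by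
    obtain ⟨c, rfl⟩ := h1
    rw [map_mul] at hb
    exact left_ne_zero_of_mul hb
  refine ⟨hd, ?_⟩
  rw [evalAt_def, div_eq_div_iff hd hb, ← map_mul, ← map_mul, h2]

lemma RegAt.add {z : ℂ} {p q : RatFunc ℝ} (hp : RegAt z p) (hq : RegAt z q) :
    RegAt z (p + q) ∧ evalAt (p + q) z = evalAt p z + evalAt q z := by
  have hb : Polynomial.aeval z (p.denom * q.denom) ≠ 0 := by
    rw [map_mul]; exact mul_ne_zero hp hq
  have := regAt_of_eq_div (p := p + q) (a := p.num * q.denom + p.denom * q.num) (z := z)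
    (b := p.denom * q.denom)
    (by
      conv_lhs => rw [← RatFunc.num_div_denom p, ← RatFunc.num_div_denom q]
      rw [div_add_div _ _ (by simpa using p.denom_ne_zero) (by simpa using q.denom_ne_zero)]
      simp only [map_mul, map_add]) hb
  refine ⟨this.1, ?_⟩
  rw [this.2, evalAt_def, evalAt_def, div_add_div _ _ hp hq]
  simp only [map_mul, map_add]

lemma RegAt.mul {z : ℂ} {p q : RatFunc ℝ} (hp : RegAt z p) (hq : RegAt z q) :
    RegAt z (p * q) ∧ evalAt (p * q) z = evalAt p z * evalAt q z := by
  have hb : Polynomial.aeval z (p.denom * q.denom) ≠ 0 := by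
    rw [map_mul]; exact mul_ne_zero hp hq
  have := regAt_of_eq_div (p := p * q) (a := p.num * q.num) (z := z)
    (b := p.denom * q.denom)
    (by
      conv_lhs => rw [← RatFunc.num_div_denom p, ← RatFunc.num_div_denom q]
      rw [div_mul_div_comm]
      simp only [map_mul]) hb
  refine ⟨this.1, ?_⟩
  rw [this.2, evalAt_def, evalAt_def, div_mul_div_comm]
  simp only [map_mul]

lemma regAt_algebraMap (z : ℂ) (a : Polynomial ℝ) :
    RegAt z (algebraMap _ _ a) ∧ evalAt (algebraMap _ _ a) z = Polynomial.aeval z a := by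
  simpa using regAt_of_eq_div (p := algebraMap _ _ a) (a := a) (b := 1) (z := z) (by simp) (by simp)

lemma regAt_C (z : ℂ) (c : ℝ) : RegAt z (RatFunc.C c) ∧ evalAt (RatFunc.C c) z = c := by
  simpa using regAt_algebraMap z (Polynomial.C c)

lemma regAt_zero (z : ℂ) : RegAt z 0 ∧ evalAt 0 z = 0 := by
  simpa using regAt_algebraMap z 0

lemma regAt_one (z : ℂ) : RegAt z 1 ∧ evalAt 1 z = 1 := by
  simpa using regAt_algebraMap z 1

lemma regAt_X (z : ℂ) : RegAt z RatFunc.X ∧ evalAt RatFunc.X z = z := by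
  simpa using regAt_algebraMap z Polynomial.X

lemma RegAt.neg {z : ℂ} {p : RatFunc ℝ} (hp : RegAt z p) :
    RegAt z (-p) ∧ evalAt (-p) z = - evalAt p z := by
  have h := (regAt_C z (-1)).1.mul hp
  have e : RatFunc.C (-1 : ℝ) * p = -p := by simp
  rw [e, (regAt_C z (-1)).2] at h
  simpa using h

lemma RegAt.inv {z : ℂ} {p : RatFunc ℝ} (hp : evalAt p z ≠ 0) :
    RegAt z p⁻¹ ∧ evalAt p⁻¹ z = (evalAt p z)⁻¹ := by
  have hn : Polynomial.aeval z p.num ≠ 0 := by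
    intro h; rw [evalAt_def, h] at hp; simp at hp
  have := regAt_of_eq_div (p := p⁻¹) (a := p.denom) (b := p.num) (z := z)
    (by conv_lhs => rw [← RatFunc.num_div_denom p, inv_div]) hn
  refine ⟨this.1, ?_⟩
  rw [this.2, evalAt_def, inv_div]

lemma RegAt.sub {z : ℂ} {p q : RatFunc ℝ} (hp : RegAt z p) (hq : RegAt z q) :
    RegAt z (p - q) ∧ evalAt (p - q) z = evalAt p z - evalAt q z := by
  have h := hp.add hq.neg.1
  rw [hq.neg.2] at h
  simpa [sub_eq_add_neg] using h

lemma RegAt.sum {ι : Type*} (s : Finset ι) {z : ℂ} {p : ι → RatFunc ℝ}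
    (hp : ∀ i ∈ s, RegAt z (p i)) :
    RegAt z (∑ i ∈ s, p i) ∧ evalAt (∑ i ∈ s, p i) z = ∑ i ∈ s, evalAt (p i) z := by
  classical
  induction s using Finset.induction_on with
  | empty => simpa using regAt_zero z
  | insert a s ha ih =>
    have ih := ih fun i hi => hp i (Finset.mem_insert_of_mem hi)
    have h := (hp a (Finset.mem_insert_self _ _)).add ih.1
    rw [Finset.sum_insert ha, Finset.sum_insert ha, ← ih.2]
    exact h

/-! ### Degree at infinity -/

/-- The order of growth of `p` at infinity is at most `k`; the zero function has every bound. -/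
def DegLE (p : RatFunc ℝ) (k : ℤ) : Prop := p = 0 ∨ p.intDegree ≤ k

lemma isProper_iff {p : RatFunc ℝ} : IsProper p ↔ DegLE p 0 := by
  unfold IsProper DegLE RatFunc.intDegree
  constructor
  · intro h; right; omega
  · rintro (rfl | h)
    · simp
    · omega

lemma DegLE.mono {p : RatFunc ℝ} {k l : ℤ} (h : DegLE p k) (hkl : k ≤ l) : DegLE p l :=
  h.imp id fun h => h.trans hkl

lemma DegLE.add {p q : RatFunc ℝ} {k : ℤ} (hp : DegLE p k) (hq : DegLE q k) :
    DegLE (p + q) k := by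
  rcases eq_or_ne q 0 with rfl | hq0
  · simpa using hp
  rcases eq_or_ne p 0 with rfl | hp0
  · simpa using hq
  by_cases h : p + q = 0
  · exact Or.inl h
  · exact Or.inr ((RatFunc.intDegree_add_le hq0 h).trans
      (max_le (hp.resolve_left hp0) (hq.resolve_left hq0)))

lemma DegLE.mul {p q : RatFunc ℝ} {k l : ℤ} (hp : DegLE p k) (hq : DegLE q l) :
    DegLE (p * q) (k + l) := by
  rcases eq_or_ne q 0 with rfl | hq0
  · exact Or.inl (by simp)
  rcases eq_or_ne p 0 with rfl | hp0
  · exact Or.inl (by simp)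
  right
  rw [RatFunc.intDegree_mul hp0 hq0]
  exact add_le_add (hp.resolve_left hp0) (hq.resolve_left hq0)

lemma DegLE.neg {p : RatFunc ℝ} {k : ℤ} (hp : DegLE p k) : DegLE (-p) k :=
  hp.imp (by rintro rfl; simp) (by simp)

lemma degLE_C (c : ℝ) : DegLE (RatFunc.C c) 0 := Or.inr (by simp)

lemma degLE_one : DegLE 1 0 := Or.inr (by simp)

lemma DegLE.sum {ι : Type*} (s : Finset ι) {p : ι → RatFunc ℝ} {k : ℤ}
    (hp : ∀ i ∈ s, DegLE (p i) k) : DegLE (∑ i ∈ s, p i) k := by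
  classical
  induction s using Finset.induction_on with
  | empty => exact Or.inl (by simp)
  | insert a s ha ih =>
    rw [Finset.sum_insert ha]
    exact (hp a (Finset.mem_insert_self _ _)).add
      (ih fun i hi => hp i (Finset.mem_insert_of_mem hi))

/-- `𝓡H_∞` as a ring. -/
def ringRH : Subring (RatFunc ℝ) where
  carrier := {p | MemRH p}
  mul_mem' hp hq := ⟨isProper_iff.2 ((isProper_iff.1 hp.1).mul (isProper_iff.1 hq.1)),
    fun z hz => (RegAt.mul (hp.2 z hz) (hq.2 z hz)).1⟩
  add_mem' hp hq := ⟨isProper_iff.2 ((isProper_iff.1 hp.1).add (isProper_iff.1 hq.1)),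
    fun z hz => (RegAt.add (hp.2 z hz) (hq.2 z hz)).1⟩
  one_mem' := ⟨isProper_iff.2 degLE_one, fun z _ => (regAt_one z).1⟩
  zero_mem' := ⟨isProper_iff.2 (Or.inl rfl), fun z _ => (regAt_zero z).1⟩
  neg_mem' hp := ⟨isProper_iff.2 (isProper_iff.1 hp.1).neg,
    fun z hz => (RegAt.neg (hp.2 z hz)).1⟩

lemma mem_ringRH {p : RatFunc ℝ} : p ∈ ringRH ↔ MemRH p := Iff.rfl

lemma C_mem_ringRH (c : ℝ) : RatFunc.C c ∈ ringRH :=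
  ⟨isProper_iff.2 (degLE_C c), fun z _ => (regAt_C z c).1⟩

lemma inv_X_mem_ringRH : (RatFunc.X : RatFunc ℝ)⁻¹ ∈ ringRH := by
  refine ⟨isProper_iff.2 (Or.inr (by simp)), fun z hz => (RegAt.inv ?_).1⟩
  rw [(regAt_X z).2]
  rintro rfl
  norm_num at hz

/-! ### Restriction to the circle -/

lemma norm_pt (ω : ℝ) : ‖pt ω‖ = 1 := Complex.norm_exp_ofReal_mul_I ω

lemma pt_ne_zero (ω : ℝ) : pt ω ≠ 0 := Complex.exp_ne_zero _

lemma pt_neg (ω : ℝ) : pt (-ω) = (starRingEnd ℂ) (pt ω) := by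
  simp only [pt, ← Complex.exp_conj]
  simp

lemma pt_neg_eq_inv (ω : ℝ) : pt (-ω) = (pt ω)⁻¹ := by
  rw [pt_neg, Complex.inv_def, Complex.normSq_eq_norm_sq, norm_pt]; simp

lemma continuous_pt : Continuous pt := by unfold pt; fun_prop

lemma pt_arg {z : ℂ} (hz : ‖z‖ = 1) : pt z.arg = z := by
  have := Complex.norm_mul_exp_arg_mul_I z
  rw [hz] at this
  simpa [pt] using this

lemma circMeasure_ac : circMeasure ≪ volume :=
  (Measure.absolutelyContinuous_of_le Measure.restrict_le_self).smul_left _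

lemma ae_pt_ne (a : ℂ) : ∀ᵐ ω ∂circMeasure, pt ω ≠ a := by
  suffices h : ∀ᵐ ω ∂volume, pt ω ≠ a from circMeasure_ac.ae_le h
  rw [ae_iff]
  refine Set.Countable.measure_zero ?_ _
  by_cases h : ∃ ω₀, pt ω₀ = a
  · obtain ⟨ω₀, rfl⟩ := h
    refine (Set.countable_range fun n : ℤ => ω₀ + n * (2 * Real.pi)).mono ?_
    intro ω hω
    simp only [ne_eq, not_not, Set.mem_ofPred_eq, pt] at hω
    obtain ⟨n, hn⟩ := Complex.exp_eq_exp_iff_exists_int.1 hω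
    refine ⟨n, ?_⟩
    have : ((ω₀ + n * (2 * Real.pi) : ℝ) : ℂ) = ω := by
      have h2 : (ω : ℂ) * Complex.I = (ω₀ + n * (2 * Real.pi)) * Complex.I := by
        rw [hn]; ring
      rw [mul_right_cancel₀ Complex.I_ne_zero h2]; push_cast; ring
    exact_mod_cast this
  · push Not at h
    simp [h]

lemma ae_aeval_pt_ne_zero {b : Polynomial ℝ} (hb : b ≠ 0) :
    ∀ᵐ ω ∂circMeasure, Polynomial.aeval (pt ω) b ≠ 0 := by
  have h := (ae_ball_iff (μ := circMeasure) (S := (b.rootSet ℂ))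
    (b.rootSet_finite ℂ).countable (p := fun ω a _ => pt ω ≠ a)).2 fun a _ => ae_pt_ne a
  filter_upwards [h] with ω hω h0
  exact hω _ (Polynomial.mem_rootSet.2 ⟨hb, h0⟩) rfl

lemma ae_regAt (p : RatFunc ℝ) : ∀ᵐ ω ∂circMeasure, RegAt (pt ω) p :=
  ae_aeval_pt_ne_zero p.denom_ne_zero

lemma ae_onCirc_ne_zero {p : RatFunc ℝ} (hp : p ≠ 0) : ∀ᵐ ω ∂circMeasure, onCirc p ω ≠ 0 := by
  filter_upwards [ae_regAt p, ae_aeval_pt_ne_zero (RatFunc.num_ne_zero hp)] with ω h1 h2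
  exact div_ne_zero h2 h1

lemma measurable_onCirc (p : RatFunc ℝ) : Measurable (onCirc p) := by
  have h (b : Polynomial ℝ) : Continuous fun ω => Polynomial.aeval (pt ω) b :=
    (Polynomial.continuous_aeval b).comp continuous_pt
  exact (h p.num).measurable.div (h p.denom).measurable

lemma MemRH.noPolesOnCircle {p : RatFunc ℝ} (hp : MemRH p) : NoPolesOnCircle p :=
  fun z hz => hp.2 z hz.ge

lemma MemRH.regAt {p : RatFunc ℝ} (hp : MemRH p) (ω : ℝ) : RegAt (pt ω) p :=
  hp.noPolesOnCircle _ (norm_pt ω)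

lemma exists_norm_onCirc_le {p : RatFunc ℝ} (hp : NoPolesOnCircle p) :
    ∃ B : ℝ, 0 < B ∧ ∀ ω, ‖onCirc p ω‖ ≤ B := by
  have hc : ContinuousOn (evalAt p) (Metric.sphere 0 1) := by
    have : evalAt p = fun z => Polynomial.aeval z p.num / Polynomial.aeval z p.denom := rfl
    rw [this]
    exact (Polynomial.continuous_aeval _).continuousOn.div
      (Polynomial.continuous_aeval _).continuousOn fun z hz => hp z (by simpa using hz)
  obtain ⟨B, hB⟩ := (isCompact_sphere (0 : ℂ) 1).exists_bound_of_continuousOn hc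
  exact ⟨max B 1, by positivity, fun ω => (hB _ (by simp [norm_pt])).trans (le_max_left _ _)⟩

/-! ### Averages over the circle -/

lemma integral_circMeasure {E : Type*} [NormedAddCommGroup E] [NormedSpace ℝ E] (f : ℝ → E) :
    ∫ ω, f ω ∂circMeasure = (2 * Real.pi)⁻¹ • ∫ ω in (-Real.pi)..Real.pi, f ω := by
  rw [circMeasure, integral_smul_measure, ENNReal.toReal_ofReal (by positivity),
    intervalIntegral.integral_of_le (by linarith [Real.pi_pos])]

instance : IsProbabilityMeasure circMeasure := by
  constructor
  rw [circMeasure, Measure.smul_apply, Measure.restrict_apply MeasurableSet.univ, Set.univ_inter,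
    Real.volume_Ioc, smul_eq_mul, ← ENNReal.ofReal_mul (by positivity), ENNReal.ofReal_eq_one]
  field_simp
  ring

lemma periodic_pt : Function.Periodic pt (2 * Real.pi) := fun ω => by
  simp only [pt]
  push_cast
  rw [add_mul, Complex.exp_add, Complex.exp_two_pi_mul_I, mul_one]

lemma integral_mul_pt {E : Type*} [NormedAddCommGroup E] [NormedSpace ℝ E] (F : ℂ → E) (r : ℝ) :
    ∫ ω, F (r * pt ω) ∂circMeasure = Real.circleAverage F 0 r := by
  have hp : Function.Periodic (fun ω => F (r * pt ω)) (2 * Real.pi) := fun ω => by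
    simp only [periodic_pt ω]
  have h := hp.intervalIntegral_add_eq (-Real.pi) 0
  rw [show -Real.pi + 2 * Real.pi = Real.pi by ring, zero_add] at h
  rw [integral_circMeasure, h, Real.circleAverage_def]
  simp only [circleMap_zero, pt]

lemma integral_comp_neg_circMeasure {E : Type*} [NormedAddCommGroup E] [NormedSpace ℝ E]
    (f : ℝ → E) : ∫ ω, f (-ω) ∂circMeasure = ∫ ω, f ω ∂circMeasure := by
  rw [integral_circMeasure, integral_circMeasure, intervalIntegral.integral_comp_neg, neg_neg]

lemma integrable_circMeasure_iff {E : Type*} [NormedAddCommGroup E] {f : ℝ → E} :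
    Integrable f circMeasure ↔ IntervalIntegrable f volume (-Real.pi) Real.pi := by
  rw [circMeasure, integrable_smul_measure (by simp [Real.pi_pos]) (by simp),
    intervalIntegrable_iff_integrableOn_Ioc_of_le (by linarith [Real.pi_pos]), IntegrableOn]

/-! ### Hardy space -/

lemma norm_inv_lt_one {z : ℂ} (hz : 1 < ‖z‖) : z⁻¹ ∈ Metric.ball (0 : ℂ) 1 := by
  simpa using inv_lt_one_of_one_lt₀ hz

lemma norm_mul_pt {r : ℝ} (hr : 0 ≤ r) (ω : ℝ) : ‖(r : ℂ) * pt ω‖ = r := by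
  simp [norm_pt, abs_of_nonneg hr]

lemma one_lt_norm_mul_pt {r : ℝ} (hr : 1 < r) (ω : ℝ) : 1 < ‖(r : ℂ) * pt ω‖ := by
  rw [norm_mul_pt (by linarith)]; exact hr

/-- `X` is analytic in `|z| > 1`, including `∞`. -/
def AnalyticOutside (X : ℂ → ℂ) : Prop :=
  ∃ Y : ℂ → ℂ, DifferentiableOn ℂ Y (Metric.ball 0 1) ∧ ∀ z : ℂ, 1 < ‖z‖ → X z = Y z⁻¹

lemma AnalyticOutside.continuous_circle {X : ℂ → ℂ} (hX : AnalyticOutside X) {r : ℝ}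
    (hr : 1 < r) : Continuous fun ω => X (r * pt ω) := by
  obtain ⟨Y, hY, hXY⟩ := hX
  have : (fun ω => X (r * pt ω)) = fun ω => Y (r * pt ω)⁻¹ := by
    funext ω; exact hXY _ (one_lt_norm_mul_pt hr ω)
  rw [this]
  refine hY.continuousOn.comp_continuous ?_ fun ω => norm_inv_lt_one (one_lt_norm_mul_pt hr ω)
  exact (continuous_const.mul continuous_pt).inv₀ fun ω =>
    norm_pos_iff.1 (zero_lt_one.trans (one_lt_norm_mul_pt hr ω))

lemma AnalyticOutside.mul {X Z : ℂ → ℂ} (hX : AnalyticOutside X) (hZ : AnalyticOutside Z) :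
    AnalyticOutside fun z => X z * Z z := by
  obtain ⟨Y, hY, h⟩ := hX
  obtain ⟨Y', hY', h'⟩ := hZ
  exact ⟨fun w => Y w * Y' w, hY.mul hY', fun z hz => by simp only [h z hz, h' z hz]⟩

lemma AnalyticOutside.sub {X Z : ℂ → ℂ} (hX : AnalyticOutside X) (hZ : AnalyticOutside Z) :
    AnalyticOutside fun z => X z - Z z := by
  obtain ⟨Y, hY, h⟩ := hX
  obtain ⟨Y', hY', h'⟩ := hZ
  exact ⟨fun w => Y w - Y' w, hY.sub hY', fun z hz => by simp only [h z hz, h' z hz]⟩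

/-- Radii decreasing to `1`. -/
def outerRadius (n : ℕ) : ℝ := 1 + 1 / ((n : ℝ) + 1)

lemma one_lt_outerRadius (n : ℕ) : 1 < outerRadius n := by
  have : (0 : ℝ) < 1 / ((n : ℝ) + 1) := by positivity
  unfold outerRadius; linarith

lemma tendsto_outerRadius : Tendsto outerRadius atTop (𝓝[>] 1) := by
  refine tendsto_nhdsWithin_iff.2 ⟨?_, Eventually.of_forall one_lt_outerRadius⟩
  have := (tendsto_const_nhds (x := (1 : ℝ))).add tendsto_one_div_add_atTop_nhds_zero_nat
  have e : outerRadius = fun n : ℕ => 1 + 1 / ((n : ℝ) + 1) := rfl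
  rw [e]
  simpa using this

lemma MemHardyTwo.aemeasurable {f : ℝ → ℂ} (hf : MemHardyTwo f) :
    AEMeasurable f circMeasure := by
  obtain ⟨X, hX, hXf⟩ := hf
  refine aemeasurable_of_tendsto_metrizable_ae' (f := fun n ω => X (outerRadius n * pt ω))
    (fun n => (AnalyticOutside.continuous_circle hX.1 (one_lt_outerRadius n)).measurable.aemeasurable)
    ?_
  filter_upwards [hXf] with ω hω using hω.comp tendsto_outerRadius

lemma MemHardyTwo.lintegral_lt_top {f : ℝ → ℂ} (hf : MemHardyTwo f) :
    ∫⁻ ω, ‖f ω‖ₑ ^ 2 ∂circMeasure < ∞ := by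
  obtain ⟨X, ⟨hX, b, hb, hXb⟩, hXf⟩ := hf
  refine lt_of_le_of_lt ?_ hb
  calc ∫⁻ ω, ‖f ω‖ₑ ^ 2 ∂circMeasure
      = ∫⁻ ω, liminf (fun n => ‖X (outerRadius n * pt ω)‖ₑ ^ 2) atTop ∂circMeasure := by
        refine lintegral_congr_ae ?_
        filter_upwards [hXf] with ω hω
        have h : Tendsto (fun n => X (outerRadius n * pt ω)) atTop (𝓝 (f ω)) :=
          hω.comp tendsto_outerRadius
        exact ((ENNReal.continuous_pow 2).continuousAt.tendsto.comp h.enorm).liminf_eq.symm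
    _ ≤ liminf (fun n => ∫⁻ ω, ‖X (outerRadius n * pt ω)‖ₑ ^ 2 ∂circMeasure) atTop :=
        lintegral_liminf_le fun n =>
          ((AnalyticOutside.continuous_circle hX (one_lt_outerRadius n)).measurable.enorm).pow_const 2
    _ ≤ b := by
        refine liminf_le_of_frequently_le' (Frequently.of_forall fun n => ?_)
        exact hXb _ (one_lt_outerRadius n)

lemma MemHardyTwo.congr {f g : ℝ → ℂ} (hf : MemHardyTwo f) (h : f =ᵐ[circMeasure] g) :
    MemHardyTwo g := by
  obtain ⟨X, hX, hXf⟩ := hf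
  refine ⟨X, hX, ?_⟩
  filter_upwards [hXf, h] with ω h1 h2
  rwa [← h2]

/-- `X` is analytic and bounded in `|z| > 1`. -/
def IsBoundedOutside (X : ℂ → ℂ) : Prop :=
  AnalyticOutside X ∧ ∃ B : ℝ, ∀ z : ℂ, 1 < ‖z‖ → ‖X z‖ ≤ B

lemma IsBoundedOutside.isHardyTwo {X : ℂ → ℂ} (hX : IsBoundedOutside X) : IsHardyTwo X := by
  obtain ⟨h, B, hB⟩ := hX
  refine ⟨h, ENNReal.ofReal B ^ 2, by simp, fun r hr => ?_⟩
  calc ∫⁻ ω, ‖X (r * pt ω)‖ₑ ^ 2 ∂circMeasure ≤ ∫⁻ _, ENNReal.ofReal B ^ 2 ∂circMeasure := by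
        refine lintegral_mono fun ω => ?_
        simp only
        rw [← ofReal_norm]
        gcongr
        exact hB _ (one_lt_norm_mul_pt hr ω)
    _ = _ := by simp

lemma IsHardyTwo.mul_sub {X g h : ℂ → ℂ} (hX : IsHardyTwo X) (hg : IsBoundedOutside g)
    (hh : IsBoundedOutside h) : IsHardyTwo fun z => X z * g z - h z := by
  obtain ⟨hXa, b, hb, hXb⟩ := hX
  obtain ⟨c, hc, hhc⟩ := hh.isHardyTwo.2
  obtain ⟨hga, B, hB⟩ := hg
  refine ⟨(AnalyticOutside.mul hXa hga).sub hh.1, 2 * (ENNReal.ofReal B ^ 2 * b + c),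
    ?_, fun r hr => ?_⟩
  · exact ENNReal.mul_lt_top (by simp)
      (ENNReal.add_lt_top.2 ⟨ENNReal.mul_lt_top (by simp) hb, hc⟩)
  have key : ∀ x y : ℂ, ‖x - y‖ₑ ^ 2 ≤ 2 * (‖x‖ₑ ^ 2 + ‖y‖ₑ ^ 2) := fun x y => by
    simp only [← ofReal_norm]
    rw [← ENNReal.ofReal_pow (norm_nonneg _), ← ENNReal.ofReal_pow (norm_nonneg _),
      ← ENNReal.ofReal_pow (norm_nonneg _), ← ENNReal.ofReal_add (by positivity) (by positivity),
      ← ENNReal.ofReal_ofNat, ← ENNReal.ofReal_mul (by positivity)]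
    refine ENNReal.ofReal_le_ofReal ?_
    nlinarith [norm_sub_le x y, norm_nonneg (x - y), sq_nonneg (‖x‖ - ‖y‖)]
  have hm {Z : ℂ → ℂ} (hZ : AnalyticOutside Z) :
      Measurable fun ω => ‖Z (r * pt ω)‖ₑ ^ 2 :=
    (hZ.continuous_circle hr).measurable.enorm.pow_const 2
  calc ∫⁻ ω, ‖X (r * pt ω) * g (r * pt ω) - h (r * pt ω)‖ₑ ^ 2 ∂circMeasure
      ≤ ∫⁻ ω, 2 * (ENNReal.ofReal B ^ 2 * ‖X (r * pt ω)‖ₑ ^ 2 + ‖h (r * pt ω)‖ₑ ^ 2)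
          ∂circMeasure := by
        refine lintegral_mono fun ω => (key _ _).trans ?_
        rw [enorm_mul, mul_pow, mul_comm (ENNReal.ofReal B ^ 2)]
        gcongr
        rw [← ofReal_norm]
        gcongr
        exact hB _ (one_lt_norm_mul_pt hr ω)
    _ = 2 * (ENNReal.ofReal B ^ 2 * ∫⁻ ω, ‖X (r * pt ω)‖ₑ ^ 2 ∂circMeasure +
          ∫⁻ ω, ‖h (r * pt ω)‖ₑ ^ 2 ∂circMeasure) := by
        rw [lintegral_const_mul' _ _ (by simp),
          lintegral_add_left ((hm hXa).const_mul _), lintegral_const_mul _ (hm hXa)]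
    _ ≤ _ := by gcongr <;> [exact hXb r hr; exact hhc r hr]

/-- An `L²` bounded sequence that tends to zero almost everywhere tends to zero in `L¹`: the part
where it exceeds a threshold `K` contributes at most `b / K`, the rest is dominated by `K`. -/
lemma tendsto_lintegral_enorm_of_bounded {u : ℕ → ℝ → ℂ} (hu : ∀ n, Measurable (u n)) {b : ℝ≥0∞}
    (hb : b < ∞) (hub : ∀ n, ∫⁻ ω, ‖u n ω‖ₑ ^ 2 ∂circMeasure ≤ b)
    (h0 : ∀ᵐ ω ∂circMeasure, Tendsto (fun n => u n ω) atTop (𝓝 0)) :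
    Tendsto (fun n => ∫⁻ ω, ‖u n ω‖ₑ ∂circMeasure) atTop (𝓝 0) := by
  refine ENNReal.tendsto_nhds_zero.2 fun ε hε => ?_
  rcases eq_or_ne ε ∞ with rfl | hεt
  · simp
  set K : ℝ≥0∞ := b / (ε / 2) + 1 with hK
  have hε2 : ε / 2 ≠ 0 := (ENNReal.half_pos hε.ne').ne'
  have hε2t : ε / 2 ≠ ∞ := (ENNReal.div_lt_top hεt (by simp)).ne
  have hKt : K ≠ ∞ := by
    rw [hK]
    exact ENNReal.add_ne_top.2 ⟨(ENNReal.div_lt_top hb.ne hε2).ne, by simp⟩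
  have hK0 : K ≠ 0 := by simp [hK]
  have hbK : b / K ≤ ε / 2 := by
    rw [ENNReal.div_le_iff hK0 hKt, hK, mul_add, ENNReal.mul_div_cancel hε2 hε2t]
    exact le_self_add
  have hpt : ∀ x : ℝ≥0∞, x ≤ min x K + x ^ 2 / K := fun x => by
    rcases le_total x K with h | h
    · rw [min_eq_left h]; exact le_self_add
    · refine le_trans ?_ le_add_self
      rw [ENNReal.le_div_iff_mul_le (Or.inl hK0) (Or.inl hKt), sq]
      gcongr
  have hmin : Tendsto (fun n => ∫⁻ ω, min ‖u n ω‖ₑ K ∂circMeasure) atTop (𝓝 0) := by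
    have := tendsto_lintegral_of_dominated_convergence (μ := circMeasure)
      (F := fun n ω => min ‖u n ω‖ₑ K) (f := fun _ => 0) (fun _ => K)
      (fun n => (hu n).enorm.min measurable_const)
      (fun n => Eventually.of_forall fun ω => min_le_right _ _) (by simpa using hKt) (by
        filter_upwards [h0] with ω hω
        simpa using hω.enorm.min (tendsto_const_nhds (x := K)))
    simpa using this
  filter_upwards [ENNReal.tendsto_nhds_zero.1 hmin (ε / 2) (ENNReal.half_pos hε.ne')] with n hn
  calc ∫⁻ ω, ‖u n ω‖ₑ ∂circMeasure
      ≤ ∫⁻ ω, (min ‖u n ω‖ₑ K + ‖u n ω‖ₑ ^ 2 / K) ∂circMeasure := lintegral_mono fun ω => hpt _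
    _ = ∫⁻ ω, min ‖u n ω‖ₑ K ∂circMeasure + (∫⁻ ω, ‖u n ω‖ₑ ^ 2 ∂circMeasure) / K := by
        rw [lintegral_add_left ((hu n).enorm.min measurable_const)]
        simp only [div_eq_mul_inv]
        rw [lintegral_mul_const _ ((hu n).enorm.pow_const 2)]
    _ ≤ ε / 2 + b / K := by gcongr; exact hub n
    _ ≤ ε / 2 + ε / 2 := by gcongr
    _ = ε := ENNReal.add_halves ε

/-- An `H²` function is determined by its boundary values: Cauchy's formula on circles tending to
the boundary. -/
lemma IsHardyTwo.eq_zero_of_boundary {X : ℂ → ℂ} {Y : ℂ → ℂ}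
    (hY : DifferentiableOn ℂ Y (Metric.ball 0 1)) (hXY : ∀ z : ℂ, 1 < ‖z‖ → X z = Y z⁻¹)
    (hX : IsHardyTwo X) (h0 : IsBoundaryValue X 0) {w : ℂ} (hw : w ∈ Metric.ball (0 : ℂ) 1) :
    Y w = 0 := by
  obtain ⟨hXa, b, hb, hXb⟩ := hX
  have hw1 : ‖w‖ < 1 := by simpa using hw
  have hL := tendsto_lintegral_enorm_of_bounded (u := fun n ω => X (outerRadius n * pt ω))
    (fun n => (AnalyticOutside.continuous_circle hXa (one_lt_outerRadius n)).measurable) hb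
    (fun n => hXb _ (one_lt_outerRadius n))
    (by filter_upwards [h0] with ω hω using hω.comp tendsto_outerRadius)
  have hρ : Tendsto (fun n => (outerRadius n)⁻¹) atTop (𝓝 1) := by
    simpa using (tendsto_nhdsWithin_iff.1 tendsto_outerRadius).1.inv₀ one_ne_zero
  have hbd : ∀ᶠ n in atTop, ‖Y w‖ ≤ ((outerRadius n)⁻¹ / ((outerRadius n)⁻¹ - ‖w‖)) *
      (∫⁻ ω, ‖X (outerRadius n * pt ω)‖ₑ ∂circMeasure).toReal := by
    filter_upwards [hρ.eventually (lt_mem_nhds hw1)] with n hn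
    set ρ := (outerRadius n)⁻¹ with hρdef
    have hr := one_lt_outerRadius n
    have hρ1 : ρ < 1 := inv_lt_one_of_one_lt₀ hr
    have hρ0 : 0 < ρ := inv_pos.2 (by linarith)
    have hc := DiffContOnCl.circleAverage_smul_div (f := Y) (c := 0) (R := ρ) (w := w)
      (by
        rw [abs_of_pos hρ0]
        refine DifferentiableOn.diffContOnCl (hY.mono ?_)
        rw [closure_ball _ hρ0.ne']
        exact Metric.closedBall_subset_ball hρ1) (by simpa [abs_of_pos hρ0] using hn)
    rw [← integral_mul_pt, ← integral_comp_neg_circMeasure] at hc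
    rw [← hc]
    have hcont := AnalyticOutside.continuous_circle hXa hr
    have hint : Integrable (fun ω => X (outerRadius n * pt ω)) circMeasure := by
      rw [integrable_circMeasure_iff]
      exact hcont.intervalIntegrable _ _
    rw [← integral_norm_eq_lintegral_enorm hint.1, ← integral_const_mul]
    refine norm_integral_le_of_norm_le (hint.norm.const_mul _) (Eventually.of_forall fun ω => ?_)
    have e : (ρ : ℂ) * pt (-ω) = (outerRadius n * pt ω)⁻¹ := by
      rw [pt_neg_eq_inv, mul_inv, hρdef]; push_cast; rfl
    have hn' : ‖(ρ : ℂ) * pt (-ω)‖ = ρ := norm_mul_pt hρ0.le _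
    rw [norm_smul, hXY _ (one_lt_norm_mul_pt hr ω), ← e, sub_zero, norm_div, hn']
    have hle := norm_sub_norm_le ((ρ : ℂ) * pt (-ω)) w
    rw [hn'] at hle
    have hpos : 0 < ρ - ‖w‖ := by linarith
    gcongr
  have hlim : Tendsto (fun n => ((outerRadius n)⁻¹ / ((outerRadius n)⁻¹ - ‖w‖)) *
      (∫⁻ ω, ‖X (outerRadius n * pt ω)‖ₑ ∂circMeasure).toReal) atTop
      (𝓝 (1 / (1 - ‖w‖) * (0 : ℝ≥0∞).toReal)) :=
    (hρ.div (hρ.sub_const _) (by linarith)).mul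
      ((ENNReal.tendsto_toReal (by simp)).comp hL)
  have := ge_of_tendsto hlim hbd
  simpa using this

/-! ### Rational functions in the Hardy space -/

lemma aeval_reflect {f : Polynomial ℝ} {k : ℕ} (hk : f.natDegree ≤ k) {z : ℂ} (hz : z ≠ 0) :
    Polynomial.aeval z⁻¹ (f.reflect k) = Polynomial.aeval z f * z⁻¹ ^ k := by
  let := invertibleOfNonzero hz
  have h := Polynomial.eval₂_reflect_mul_pow (algebraMap ℝ ℂ) z k f hk
  rw [invOf_eq_inv] at h
  rw [Polynomial.aeval_def, Polynomial.aeval_def, ← h, mul_assoc, ← mul_pow, mul_inv_cancel₀ hz,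
    one_pow, mul_one]

lemma tendsto_radial {F : ℂ → ℂ} {ω : ℝ} (hF : ContinuousAt F (pt ω)) :
    Tendsto (fun r : ℝ => F (r * pt ω)) (𝓝[>] 1) (𝓝 (F (pt ω))) := by
  refine hF.tendsto.comp (tendsto_nhdsWithin_of_tendsto_nhds ?_)
  have : Continuous fun r : ℝ => (r : ℂ) * pt ω := by fun_prop
  simpa using this.tendsto 1

lemma isBoundedOutside_of_continuousOn {Y : ℂ → ℂ}
    (hd : DifferentiableOn ℂ Y (Metric.ball 0 1)) (hc : ContinuousOn Y (Metric.closedBall 0 1))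
    {X : ℂ → ℂ} (hXY : ∀ z : ℂ, 1 < ‖z‖ → X z = Y z⁻¹) : IsBoundedOutside X := by
  obtain ⟨B, hB⟩ := (isCompact_closedBall (0 : ℂ) 1).exists_bound_of_continuousOn hc
  refine ⟨⟨Y, hd, hXY⟩, B, fun z hz => ?_⟩
  rw [hXY z hz]
  exact hB _ (Metric.ball_subset_closedBall (norm_inv_lt_one hz))

lemma isBoundedOutside_aeval_inv (f : Polynomial ℝ) :
    IsBoundedOutside fun z => Polynomial.aeval z⁻¹ f :=
  isBoundedOutside_of_continuousOn (Y := fun w => Polynomial.aeval w f)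
    f.differentiable_aeval.differentiableOn (Polynomial.continuous_aeval f).continuousOn
    fun _ _ => rfl

lemma IsBoundedOutside.zero : IsBoundedOutside fun _ => 0 :=
  isBoundedOutside_of_continuousOn (Y := fun _ => 0) (differentiableOn_const _)
    continuousOn_const fun _ _ => rfl

lemma MemRH.isBoundedOutside {p : RatFunc ℝ} (hp : MemRH p) : IsBoundedOutside (evalAt p) := by
  set k := p.denom.natDegree with hk
  have hb : ∀ w ∈ Metric.closedBall (0 : ℂ) 1, Polynomial.aeval w (p.denom.reflect k) ≠ 0 := by
    intro w hw
    rcases eq_or_ne w 0 with rfl | hw0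
    · rw [← Polynomial.coeff_zero_eq_aeval_zero', Polynomial.coeff_reflect,
        Polynomial.revAt_le (Nat.zero_le _)]
      simpa [hk] using p.denom_ne_zero
    · have h := aeval_reflect (f := p.denom) hk.ge (inv_ne_zero hw0)
      rw [inv_inv] at h
      rw [h]
      refine mul_ne_zero (hp.2 _ ?_) (pow_ne_zero _ hw0)
      rw [norm_inv]
      exact (one_le_inv₀ (norm_pos_iff.2 hw0)).2 (by simpa using hw)
  refine isBoundedOutside_of_continuousOn
    (Y := fun w => Polynomial.aeval w (p.num.reflect k) / Polynomial.aeval w (p.denom.reflect k))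
    ?_ ?_ fun z hz => ?_
  · exact DifferentiableOn.div (Polynomial.differentiable_aeval _).differentiableOn
      (Polynomial.differentiable_aeval _).differentiableOn
      fun w hw => hb w (Metric.ball_subset_closedBall hw)
  · exact (Polynomial.continuous_aeval _).continuousOn.div
      (Polynomial.continuous_aeval _).continuousOn hb
  · have hz0 : z ≠ 0 := norm_pos_iff.1 (by linarith)
    rw [aeval_reflect hp.1 hz0, aeval_reflect hk.ge hz0, evalAt_def,
      mul_div_mul_right _ _ (pow_ne_zero _ (inv_ne_zero hz0))]

lemma continuousAt_evalAt {p : RatFunc ℝ} {z : ℂ} (hp : RegAt z p) :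
    ContinuousAt (evalAt p) z :=
  (Polynomial.continuous_aeval p.num).continuousAt.div
    (Polynomial.continuous_aeval p.denom).continuousAt hp

lemma MemRH.isBoundaryValue {p : RatFunc ℝ} (hp : MemRH p) :
    IsBoundaryValue (evalAt p) (onCirc p) :=
  Eventually.of_forall fun ω => tendsto_radial (continuousAt_evalAt (hp.regAt ω))

lemma MemRH.memHardyTwo {p : RatFunc ℝ} (hp : MemRH p) : MemHardyTwo (onCirc p) :=
  ⟨_, hp.isBoundedOutside.isHardyTwo, hp.isBoundaryValue⟩

lemma MemHardyTwo.mul_onCirc {f : ℝ → ℂ} (hf : MemHardyTwo f) {p : RatFunc ℝ} (hp : MemRH p) :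
    MemHardyTwo fun ω => f ω * onCirc p ω := by
  obtain ⟨X, hX, hXf⟩ := hf
  refine ⟨_, hX.mul_sub hp.isBoundedOutside IsBoundedOutside.zero, ?_⟩
  filter_upwards [hXf, hp.isBoundaryValue] with ω h1 h2
  simpa using h1.mul h2

/-- A pole on the unit circle is incompatible with square integrability. -/
lemma noPolesOnCircle_of_lintegral {p : RatFunc ℝ}
    (hp : ∫⁻ ω, ‖onCirc p ω‖ₑ ^ 2 ∂circMeasure < ∞) : NoPolesOnCircle p := by
  intro z hz hd
  have hnum : Polynomial.aeval z p.num ≠ 0 := by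
    intro hn
    obtain ⟨u, v, huv⟩ := p.isCoprime_num_denom
    have := congrArg (Polynomial.aeval z) huv
    simp [hn, hd] at this
  set ω₀ := z.arg with hω₀
  have hpt : pt ω₀ = z := pt_arg hz
  -- the denominator is divisible by `X - z` over `ℂ`
  obtain ⟨e, he⟩ : ∃ e : Polynomial ℂ,
      p.denom.map (algebraMap ℝ ℂ) = (Polynomial.X - Polynomial.C z) * e := by
    refine Polynomial.dvd_iff_isRoot.2 ?_
    rw [Polynomial.IsRoot.def, Polynomial.eval_map_algebraMap, hd]
  have hden : ∀ ω, Polynomial.aeval (pt ω) p.denom = (pt ω - z) * e.eval (pt ω) := fun ω => by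
    rw [← Polynomial.eval_map_algebraMap, he]; simp
  obtain ⟨E, hE⟩ := (isCompact_sphere (0 : ℂ) 1).exists_bound_of_continuousOn
    e.continuous.continuousOn
  have hE' : ∀ ω, ‖e.eval (pt ω)‖ ≤ E := fun ω => hE _ (by simp [norm_pt])
  have hE0 : 0 ≤ E := (norm_nonneg _).trans (hE' 0)
  have hlip : ∀ ω, ‖pt ω - z‖ ≤ |ω - ω₀| := fun ω => by
    have h1 : pt ω - z = pt ω₀ * (Complex.exp (Complex.I * ((ω - ω₀ : ℝ) : ℂ)) - 1) := by
      rw [mul_sub, mul_one]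
      nth_rw 1 [← hpt]
      rw [pt, pt, ← Complex.exp_add]; congr 2; push_cast; ring
    rw [h1, norm_mul, norm_pt, one_mul]
    exact Real.norm_exp_I_mul_ofReal_sub_one_le
  set c := ‖Polynomial.aeval z p.num‖ / 2 with hc
  have hc0 : 0 < c := by have := norm_pos_iff.2 hnum; positivity
  have hcont : Continuous fun ω => ‖Polynomial.aeval (pt ω) p.num‖ :=
    ((Polynomial.continuous_aeval _).comp continuous_pt).norm
  obtain ⟨δ, hδ, hδc⟩ : ∃ δ > 0, ∀ ω, |ω - ω₀| < δ → c < ‖Polynomial.aeval (pt ω) p.num‖ := by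
    have := (hcont.tendsto ω₀).eventually (lt_mem_nhds (a := c) (by rw [hpt, hc]; linarith))
    obtain ⟨δ, hδ, h⟩ := Metric.eventually_nhds_iff.1 this
    exact ⟨δ, hδ, fun ω hω => h (by simpa [Real.dist_eq] using hω)⟩
  -- a square integrable `p` is integrable, and would dominate `1 / (ω - ω₀)`, which is not
  have hbound : ∀ᵐ ω ∂circMeasure, ‖(ω - ω₀)⁻¹‖ ≤ E / c * ‖onCirc p ω‖ + δ⁻¹ := by
    filter_upwards [ae_regAt p] with ω hω
    rw [norm_inv, Real.norm_eq_abs]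
    by_cases h : |ω - ω₀| < δ
    · have h1 := hδc ω h
      have hne : 0 < |ω - ω₀| := by
        refine lt_of_lt_of_le (norm_pos_iff.2 ?_) (hlip ω)
        intro h0
        exact hω (by rw [hden, h0, zero_mul])
      have h2 : ‖Polynomial.aeval (pt ω) p.num‖ ≤ ‖onCirc p ω‖ * (|ω - ω₀| * E) := by
        have : Polynomial.aeval (pt ω) p.num =
            onCirc p ω * ((pt ω - z) * e.eval (pt ω)) := by
          rw [← hden, onCirc, evalAt_def, div_mul_cancel₀ _ hω]
        rw [this, norm_mul, norm_mul]
        gcongr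
        · exact hlip ω
        · exact hE' ω
      have h3 : |ω - ω₀|⁻¹ ≤ E / c * ‖onCirc p ω‖ := by
        rw [inv_le_iff_one_le_mul₀ hne]
        have : 1 ≤ (‖onCirc p ω‖ * (|ω - ω₀| * E)) / c := by
          rw [le_div_iff₀ hc0]; linarith
        calc (1 : ℝ) ≤ _ := this
          _ = _ := by ring
      have := inv_pos.2 hδ
      linarith
    · have h1 : |ω - ω₀|⁻¹ ≤ δ⁻¹ := inv_anti₀ hδ (not_lt.1 h)
      have : 0 ≤ E / c * ‖onCirc p ω‖ := by positivity
      linarith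
  have hint : Integrable (onCirc p) circMeasure := by
    refine MemLp.integrable (q := 2) (by norm_num) ⟨(measurable_onCirc p).aestronglyMeasurable, ?_⟩
    rw [eLpNorm_lt_top_iff_lintegral_rpow_enorm_lt_top (by norm_num) (by norm_num)]
    simpa using hp
  have hbad : Integrable (fun ω => (ω - ω₀)⁻¹) circMeasure :=
    ((hint.norm.const_mul (E / c)).add (integrable_const δ⁻¹)).mono'
      ((measurable_id.sub_const ω₀).inv).aestronglyMeasurable hbound
  rw [integrable_circMeasure_iff, intervalIntegrable_sub_inv_iff] at hbad
  rcases hbad with h | h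
  · linarith [Real.pi_pos]
  · refine h ?_
    rw [Set.uIcc_of_le (by linarith [Real.pi_pos])]
    exact ⟨(Complex.neg_pi_lt_arg z).le, Complex.arg_le_pi z⟩

/-- A rational function whose restriction to the circle lies in `H²` is stable and proper: after
multiplication by the reflected denominator, uniqueness of boundary values identifies the `H²`
extension with the rational function. -/
lemma memRH_of_memHardyTwo {p : RatFunc ℝ} (hp : MemHardyTwo (onCirc p)) : MemRH p := by
  have hcirc := noPolesOnCircle_of_lintegral hp.lintegral_lt_top
  obtain ⟨X, hX, hXp⟩ := hp
  obtain ⟨Y, hY, hXY⟩ := hX.1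
  set k := max p.num.natDegree p.denom.natDegree with hk
  set a := p.num.reflect k with ha
  set b := p.denom.reflect k with hb
  have hcop : ∀ z : ℂ, Polynomial.aeval z p.denom = 0 → Polynomial.aeval z p.num ≠ 0 := by
    intro z hd hn
    obtain ⟨u, v, huv⟩ := p.isCoprime_num_denom
    have := congrArg (Polynomial.aeval z) huv
    simp [hn, hd] at this
  have hid : ∀ w ∈ Metric.ball (0 : ℂ) 1,
      Y w * Polynomial.aeval w b - Polynomial.aeval w a = 0 := by
    intro w hw
    refine IsHardyTwo.eq_zero_of_boundary
      (X := fun z => X z * Polynomial.aeval z⁻¹ b - Polynomial.aeval z⁻¹ a)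
      (Y := fun w => Y w * Polynomial.aeval w b - Polynomial.aeval w a) ?_ ?_ ?_ ?_ hw
    · exact (hY.mul (Polynomial.differentiable_aeval _).differentiableOn).sub
        (Polynomial.differentiable_aeval _).differentiableOn
    · intro z hz; simp only [hXY z hz]
    · exact hX.mul_sub (isBoundedOutside_aeval_inv b) (isBoundedOutside_aeval_inv a)
    · filter_upwards [hXp] with ω hω
      have hinv (f : Polynomial ℝ) : ContinuousAt (fun z : ℂ => Polynomial.aeval z⁻¹ f) (pt ω) :=
        (Polynomial.continuous_aeval f).continuousAt.comp
          (continuousAt_inv₀ (pt_ne_zero ω))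
      have h := (hω.mul (tendsto_radial (hinv b))).sub (tendsto_radial (hinv a))
      convert h using 2
      rw [ha, hb, aeval_reflect (le_max_left _ _) (pt_ne_zero ω),
        aeval_reflect (le_max_right _ _) (pt_ne_zero ω), onCirc, evalAt_def, ← mul_assoc,
        div_mul_cancel₀ _ (hcirc _ (norm_pt ω)), sub_self]
      rfl
  constructor
  · by_contra hprop
    unfold IsProper at hprop
    rw [not_le] at hprop
    have hkn : k = p.num.natDegree := max_eq_left hprop.le
    have h0 := hid 0 (by simp)
    rw [← Polynomial.coeff_zero_eq_aeval_zero', ← Polynomial.coeff_zero_eq_aeval_zero', ha, hb,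
      Polynomial.coeff_reflect, Polynomial.coeff_reflect, Polynomial.revAt_le (Nat.zero_le _),
      Nat.sub_zero, Polynomial.coeff_eq_zero_of_natDegree_lt (p := p.denom) (by omega), hkn] at h0
    have hn0 : p.num ≠ 0 := by
      intro h; rw [h] at hprop; simp at hprop
    simp [hn0] at h0
  · intro z hz hd
    rcases hz.eq_or_lt with hz | hz
    · exact hcirc z hz.symm hd
    · have hz0 : z ≠ 0 := norm_pos_iff.1 (by linarith)
      have h := hid _ (norm_inv_lt_one hz)
      rw [ha, hb, aeval_reflect (le_max_left _ _) hz0, aeval_reflect (le_max_right _ _) hz0, hd,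
        zero_mul, mul_zero, zero_sub, neg_eq_zero] at h
      rcases mul_eq_zero.1 h with h | h
      · exact hcop z hd h
      · exact pow_ne_zero _ (inv_ne_zero hz0) h

/-! ### The Herglotz transform and outer functions -/

/-- The Herglotz kernel of the exterior of the disc. -/
def kernel (z : ℂ) (t : ℝ) : ℂ := (z + pt t) / (z - pt t)

/-- The Herglotz transform of a real function on the circle; its real part is the Poisson
integral. -/
def herglotz (u : ℝ → ℝ) (z : ℂ) : ℂ := ∫ t, kernel z t * (u t : ℂ) ∂circMeasure

lemma sub_pt_ne_zero {z : ℂ} (hz : 1 < ‖z‖) (t : ℝ) : z - pt t ≠ 0 := by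
  intro h
  rw [sub_eq_zero.1 h, norm_pt] at hz
  exact lt_irrefl _ hz

lemma continuous_kernel {z : ℂ} (hz : 1 < ‖z‖) : Continuous (kernel z) :=
  (continuous_const.add continuous_pt).div (continuous_const.sub continuous_pt)
    (sub_pt_ne_zero hz)

lemma norm_kernel_le {z : ℂ} (hz : 1 < ‖z‖) (t : ℝ) :
    ‖kernel z t‖ ≤ (‖z‖ + 1) / (‖z‖ - 1) := by
  have h1 := norm_add_le z (pt t)
  have h2 := norm_sub_norm_le z (pt t)
  rw [norm_pt] at h1 h2
  rw [kernel, norm_div]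
  have : 0 < ‖z‖ - 1 := by linarith
  gcongr

lemma re_kernel_nonneg {z : ℂ} (hz : 1 < ‖z‖) (t : ℝ) : 0 ≤ (kernel z t).re := by
  rw [kernel, Complex.div_re, ← add_div]
  refine div_nonneg ?_ (Complex.normSq_nonneg _)
  have h1 : Complex.normSq (pt t) = 1 := by rw [Complex.normSq_eq_norm_sq, norm_pt]; norm_num
  have h2 : 1 < Complex.normSq z := by
    rw [Complex.normSq_eq_norm_sq]; nlinarith
  rw [Complex.normSq_apply] at h1 h2
  simp only [Complex.add_re, Complex.sub_re, Complex.add_im, Complex.sub_im]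
  nlinarith

lemma integrable_kernel_mul {u : ℝ → ℝ} (hu : Integrable u circMeasure) {z : ℂ} (hz : 1 < ‖z‖) :
    Integrable (fun t => kernel z t * (u t : ℂ)) circMeasure :=
  hu.ofReal.bdd_mul (continuous_kernel hz).aestronglyMeasurable
    (Eventually.of_forall (norm_kernel_le hz))

lemma herglotz_add {u v : ℝ → ℝ} (hu : Integrable u circMeasure) (hv : Integrable v circMeasure)
    {z : ℂ} (hz : 1 < ‖z‖) : herglotz (fun t => u t + v t) z = herglotz u z + herglotz v z := by
  rw [herglotz, herglotz, herglotz,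
    ← integral_add (integrable_kernel_mul hu hz) (integrable_kernel_mul hv hz)]
  refine integral_congr_ae (Eventually.of_forall fun t => ?_)
  simp only
  push_cast; ring

lemma herglotz_const_mul (c : ℝ) (u : ℝ → ℝ) (z : ℂ) :
    herglotz (fun t => c * u t) z = c * herglotz u z := by
  rw [herglotz, herglotz, ← integral_const_mul]
  refine integral_congr_ae (Eventually.of_forall fun t => ?_)
  simp only
  push_cast; ring

lemma herglotz_congr {u v : ℝ → ℝ} (h : u =ᵐ[circMeasure] v) (z : ℂ) :
    herglotz u z = herglotz v z := by
  refine integral_congr_ae ?_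
  filter_upwards [h] with t ht
  rw [ht]

lemma herglotz_re_mono {u v : ℝ → ℝ} (hu : Integrable u circMeasure)
    (hv : Integrable v circMeasure) (h : u ≤ᵐ[circMeasure] v) {z : ℂ} (hz : 1 < ‖z‖) :
    (herglotz u z).re ≤ (herglotz v z).re := by
  have e : ∀ {w : ℝ → ℝ}, Integrable w circMeasure → (herglotz w z).re =
      ∫ t, (kernel z t).re * w t ∂circMeasure := fun {w} hw => by
    have h1 := integral_re (𝕜 := ℂ) (integrable_kernel_mul hw hz)
    simp only [RCLike.re_to_complex, Complex.re_mul_ofReal] at h1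
    rw [herglotz, h1]
  have i : ∀ {w : ℝ → ℝ}, Integrable w circMeasure →
      Integrable (fun t => (kernel z t).re * w t) circMeasure := fun {w} hw => by
    simpa using (integrable_kernel_mul hw hz).re
  rw [e hu, e hv]
  refine integral_mono_ae (i hu) (i hv) ?_
  filter_upwards [h] with t ht
  exact mul_le_mul_of_nonneg_left ht (re_kernel_nonneg hz t)

lemma integral_comp_inv_pt {E : Type*} [NormedAddCommGroup E] [NormedSpace ℝ E] (F : ℂ → E) :
    ∫ ω, F (pt ω)⁻¹ ∂circMeasure = Real.circleAverage F 0 1 := by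
  have h := integral_mul_pt F 1
  rw [← integral_comp_neg_circMeasure] at h
  simpa [pt_neg_eq_inv] using h

/-- The kernel at `z` in the coordinates `w = 1 / z`, `η = e^{-it}` of the unit disc. -/
lemma kernel_eq {z : ℂ} (hz : 1 < ‖z‖) (t : ℝ) :
    kernel z t = 2 * ((pt t)⁻¹ / ((pt t)⁻¹ - z⁻¹)) - 1 := by
  have h1 := sub_pt_ne_zero hz t
  have h2 := pt_ne_zero t
  have hz0 : z ≠ 0 := norm_pos_iff.1 (by linarith)
  have h3 : (pt t)⁻¹ - z⁻¹ ≠ 0 := by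
    rw [inv_sub_inv h2 hz0]
    exact div_ne_zero h1 (mul_ne_zero h2 hz0)
  rw [kernel, inv_sub_inv h2 hz0]
  field_simp
  ring

lemma integrable_of_continuous {f : ℝ → ℂ} (hf : Continuous f) : Integrable f circMeasure :=
  integrable_circMeasure_iff.2 (hf.intervalIntegrable _ _)

lemma herglotz_one {z : ℂ} (hz : 1 < ‖z‖) : herglotz (fun _ => 1) z = 1 := by
  have hc := DiffContOnCl.circleAverage_smul_div (f := fun _ => (1 : ℂ)) (c := 0) (R := 1)
    (w := z⁻¹) diffContOnCl_const (by simpa using norm_inv_lt_one hz)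
  rw [← integral_comp_inv_pt] at hc
  have hcont : Continuous fun t => (pt t)⁻¹ / ((pt t)⁻¹ - z⁻¹) := by
    have : (fun t => (pt t)⁻¹ / ((pt t)⁻¹ - z⁻¹)) = fun t => (kernel z t + 1) / 2 := by
      funext t; rw [kernel_eq hz]; ring
    rw [this]
    exact ((continuous_kernel hz).add continuous_const).div_const _
  simp only [sub_zero, smul_eq_mul, mul_one] at hc
  simp only [herglotz, kernel_eq hz, Complex.ofReal_one, mul_one]
  rw [integral_sub ((integrable_of_continuous hcont).const_mul 2) (integrable_const _),
    integral_const_mul, hc]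
  norm_num

/-- The Schwarz formula: an analytic function of `1 / z` that vanishes at `∞` is the Herglotz
transform of the real part of its boundary values. -/
lemma herglotz_re_eq {F : ℂ → ℂ} (hF : DiffContOnCl ℂ F (Metric.ball 0 1)) (h0 : F 0 = 0)
    {z : ℂ} (hz : 1 < ‖z‖) : herglotz (fun t => (F (pt t)⁻¹).re) z = F z⁻¹ := by
  have hw := norm_inv_lt_one hz
  set w := z⁻¹ with hwdef
  have hw1 : ‖w‖ < 1 := by simpa using hw
  have hFc : Continuous fun t => F (pt t)⁻¹ := by
    have := hF.continuousOn
    rw [closure_ball _ one_ne_zero] at this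
    refine this.comp_continuous (continuous_pt.inv₀ pt_ne_zero) fun t => ?_
    simp [norm_pt]
  have hk : Continuous fun t => (pt t)⁻¹ / ((pt t)⁻¹ - w) := by
    have : (fun t => (pt t)⁻¹ / ((pt t)⁻¹ - w)) = fun t => (kernel z t + 1) / 2 := by
      funext t; rw [kernel_eq hz]; ring
    rw [this]
    exact ((continuous_kernel hz).add continuous_const).div_const _
  -- the contribution of `F`
  have h1 := DiffContOnCl.circleAverage_smul_div (f := F) (c := 0) (R := 1) (w := w)
    (by simpa using hF) (by simpa using hw)
  have h2 := DiffContOnCl.circleAverage (f := F) (c := 0) (R := 1) (by simpa using hF)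
  rw [← integral_comp_inv_pt] at h1 h2
  simp only [sub_zero, smul_eq_mul] at h1
  rw [h0] at h2
  have hI1 : ∫ t, kernel z t * F (pt t)⁻¹ ∂circMeasure = 2 * F w := by
    have e : ∀ t, kernel z t * F (pt t)⁻¹ =
        2 * ((pt t)⁻¹ / ((pt t)⁻¹ - w) * F (pt t)⁻¹) - F (pt t)⁻¹ := fun t => by
      rw [kernel_eq hz]; ring
    simp only [e]
    have i1 : Integrable (fun t => (pt t)⁻¹ / ((pt t)⁻¹ - w) * F (pt t)⁻¹) circMeasure :=
      integrable_of_continuous (hk.mul hFc)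
    rw [integral_sub (i1.const_mul 2) (integrable_of_continuous hFc), integral_const_mul, h1, h2,
      sub_zero]
  -- the contribution of the conjugate of `F`, where the conjugate kernel is analytic
  have hd : ∀ η ∈ Metric.closedBall (0 : ℂ) 1, 1 - (starRingEnd ℂ) w * η ≠ 0 := by
    intro η hη h
    have : ‖(starRingEnd ℂ) w * η‖ = 1 := by rw [← sub_eq_zero.1 h, norm_one]
    rw [norm_mul, RCLike.norm_conj] at this
    have hη1 : ‖η‖ ≤ 1 := by simpa using hη
    nlinarith [norm_nonneg w, norm_nonneg η]
  have hg : DiffContOnCl ℂ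
      (fun η => ((1 + (starRingEnd ℂ) w * η) / (1 - (starRingEnd ℂ) w * η)) * F η)
      (Metric.ball 0 1) := by
    refine DiffContOnCl.smul (𝕜' := ℂ) ?_ hF
    refine ⟨?_, ?_⟩
    · exact DifferentiableOn.div (by fun_prop) (by fun_prop)
        fun η hη => hd η (Metric.ball_subset_closedBall hη)
    · rw [closure_ball _ one_ne_zero]
      exact ContinuousOn.div (by fun_prop) (by fun_prop) hd
  have h3 := DiffContOnCl.circleAverage (c := 0) (R := 1) (by simpa using hg)
  rw [← integral_comp_inv_pt] at h3
  have hI2 : ∫ t, kernel z t * (starRingEnd ℂ) (F (pt t)⁻¹) ∂circMeasure = 0 := by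
    have h4 := congrArg (starRingEnd ℂ) h3
    rw [← integral_conj] at h4
    simp only [h0, mul_zero, map_zero] at h4
    rw [← h4]
    refine integral_congr_ae (Eventually.of_forall fun t => ?_)
    simp only [map_mul, map_div₀, map_add, map_sub, map_one, Complex.conj_conj]
    congr 1
    have hc : (starRingEnd ℂ) (pt t)⁻¹ = pt t := by
      rw [← pt_neg_eq_inv, pt_neg, Complex.conj_conj]
    have hz0 : z ≠ 0 := norm_pos_iff.1 (by linarith)
    have := sub_pt_ne_zero hz t
    rw [hc, hwdef, kernel]
    have h5 : 1 - z⁻¹ * pt t = (z - pt t) * z⁻¹ := by field_simp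
    have h6 : 1 + z⁻¹ * pt t = (z + pt t) * z⁻¹ := by field_simp
    rw [h5, h6, mul_div_mul_right _ _ (inv_ne_zero hz0)]
  have hkc := continuous_kernel hz
  have e : ∀ t, kernel z t * (((F (pt t)⁻¹).re : ℝ) : ℂ) = 2⁻¹ * (kernel z t * F (pt t)⁻¹) +
      2⁻¹ * (kernel z t * (starRingEnd ℂ) (F (pt t)⁻¹)) := fun t => by
    have := Complex.add_conj (F (pt t)⁻¹)
    rw [← mul_add, ← mul_add, this]; push_cast; ring
  simp only [herglotz, e]
  have i1 : Integrable (fun t => kernel z t * F (pt t)⁻¹) circMeasure :=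
    integrable_of_continuous (hkc.mul hFc)
  have i2 : Integrable (fun t => kernel z t * (starRingEnd ℂ) (F (pt t)⁻¹)) circMeasure :=
    integrable_of_continuous (hkc.mul (Complex.continuous_conj.comp hFc))
  rw [integral_add (i1.const_mul _) (i2.const_mul _), integral_const_mul, integral_const_mul, hI1,
    hI2]
  ring

lemma one_sub_mem_slitPlane {x : ℂ} (hx : ‖x‖ ≤ 1) (h1 : x ≠ 1) : 1 - x ∈ Complex.slitPlane := by
  left
  rw [Complex.sub_re, Complex.one_re, sub_pos]
  refine lt_of_le_of_ne ((Complex.re_le_norm x).trans hx) fun h => h1 ?_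
  have h2 : x.re ^ 2 + x.im ^ 2 = ‖x‖ ^ 2 := by
    rw [← Complex.normSq_eq_norm_sq, Complex.normSq_apply]; ring
  have h3 : x.im = 0 := by
    rw [h] at h2
    have : ‖x‖ ^ 2 ≤ 1 := pow_le_one₀ (norm_nonneg _) hx
    nlinarith [sq_nonneg x.im]
  exact Complex.ext h h3

lemma integrable_log_norm_pt_sub (a : ℂ) :
    Integrable (fun t => Real.log ‖pt t - a‖) circMeasure := by
  rw [integrable_circMeasure_iff]
  have h := circleIntegrable_log_norm_sub_const (a := a) (c := 0) 1
  rw [CircleIntegrable] at h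
  have hp : Function.Periodic (fun ω => Real.log ‖pt ω - a‖) (2 * Real.pi) := fun ω => by
    simp only [periodic_pt ω]
  have h' : IntervalIntegrable (fun ω => Real.log ‖pt ω - a‖) volume 0 (0 + 2 * Real.pi) := by
    simpa [circleMap_zero, pt] using h
  exact hp.intervalIntegrable Real.two_pi_pos.ne' h' _ _

lemma norm_pt_sub_eq (ω : ℝ) (a : ℂ) : ‖pt ω - a‖ = ‖1 - a * (pt ω)⁻¹‖ := by
  have h : pt ω - a = pt ω * (1 - a * (pt ω)⁻¹) := by
    have := pt_ne_zero ω
    field_simp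
  rw [h, norm_mul, norm_pt, one_mul]

lemma herglotz_log_of_lt {a : ℂ} (ha : ‖a‖ < 1) {z : ℂ} (hz : 1 < ‖z‖) :
    herglotz (fun t => Real.log ‖pt t - a‖) z = Complex.log (1 - a * z⁻¹) := by
  have hs : ∀ η ∈ Metric.closedBall (0 : ℂ) 1, 1 - a * η ∈ Complex.slitPlane := by
    intro η hη
    have hη1 : ‖η‖ ≤ 1 := by simpa using hη
    have hlt : ‖a * η‖ < 1 := by
      rw [norm_mul]; nlinarith [norm_nonneg a, norm_nonneg η]
    exact one_sub_mem_slitPlane hlt.le fun h => by rw [h, norm_one] at hlt; exact lt_irrefl _ hlt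
  have hF : DiffContOnCl ℂ (fun η => Complex.log (1 - a * η)) (Metric.ball 0 1) := by
    refine DifferentiableOn.diffContOnCl ?_
    rw [closure_ball _ one_ne_zero]
    exact DifferentiableOn.clog (by fun_prop) hs
  rw [← herglotz_re_eq hF (by simp) hz]
  refine herglotz_congr (Eventually.of_forall fun t => ?_) z
  simp only [Complex.log_re, norm_pt_sub_eq t a]

/-- Also for a zero on the unit circle the Herglotz transform of `log|ζ - a|` is a logarithm: the
zero is moved radially into the disc, with `log 2 + |log|ζ - a||` as integrable majorant. -/
lemma herglotz_log_of_le {a : ℂ} (ha : ‖a‖ ≤ 1) {z : ℂ} (hz : 1 < ‖z‖) :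
    herglotz (fun t => Real.log ‖pt t - a‖) z = Complex.log (1 - a * z⁻¹) := by
  set ρ : ℕ → ℝ := fun n => (outerRadius n)⁻¹ with hρdef
  have hρ : Tendsto ρ atTop (𝓝 1) := by
    simpa using (tendsto_nhdsWithin_iff.1 tendsto_outerRadius).1.inv₀ one_ne_zero
  have hρ1 : ∀ n, ρ n < 1 := fun n => inv_lt_one_of_one_lt₀ (one_lt_outerRadius n)
  have hρ0 : ∀ n, 0 < ρ n := fun n => inv_pos.2 (by linarith [one_lt_outerRadius n])
  have hρa : Tendsto (fun n => (ρ n : ℂ) * a) atTop (𝓝 a) := by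
    have h1 : Tendsto (fun n => (ρ n : ℂ)) atTop (𝓝 ((1 : ℝ) : ℂ)) :=
      (Complex.continuous_ofReal.tendsto 1).comp hρ
    have h := h1.mul_const a
    simpa only [Complex.ofReal_one, one_mul] using h
  have hnorm : ∀ n, ‖(ρ n : ℂ) * a‖ < 1 := fun n => by
    rw [norm_mul, Complex.norm_real, Real.norm_eq_abs, abs_of_pos (hρ0 n)]
    nlinarith [hρ0 n, hρ1 n, norm_nonneg a]
  have hzi : ‖a * z⁻¹‖ < 1 := by
    have : ‖z⁻¹‖ < 1 := by simpa using norm_inv_lt_one hz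
    rw [norm_mul]; nlinarith [norm_nonneg a, norm_nonneg z⁻¹]
  have hR : Tendsto (fun n => Complex.log (1 - (ρ n : ℂ) * a * z⁻¹)) atTop
      (𝓝 (Complex.log (1 - a * z⁻¹))) :=
    (tendsto_const_nhds.sub (hρa.mul_const _)).clog (one_sub_mem_slitPlane hzi.le fun h => by
      rw [h, norm_one] at hzi; exact lt_irrefl _ hzi)
  have hbound : ∀ n t, pt t ≠ a →
      |Real.log ‖pt t - ρ n * a‖| ≤ |Real.log ‖pt t - a‖| + Real.log 2 := by
    intro n t hne
    have hpos : 0 < ‖pt t - a‖ := norm_pos_iff.2 (sub_ne_zero.2 hne)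
    have hn := hnorm n
    have hsub : ‖((ρ n : ℂ) - 1) * a‖ ≤ 1 - ρ n := by
      rw [norm_mul, ← Complex.ofReal_one, ← Complex.ofReal_sub, Complex.norm_real,
        Real.norm_eq_abs, abs_of_neg (by linarith [hρ1 n])]
      nlinarith [hρ1 n, norm_nonneg a]
    have hrr : ‖(ρ n : ℂ) * a‖ ≤ ρ n := by
      rw [norm_mul, Complex.norm_real, Real.norm_eq_abs, abs_of_pos (hρ0 n)]
      nlinarith [hρ0 n]
    have hlow : 1 - ρ n ≤ ‖pt t - ρ n * a‖ := by
      have := norm_sub_norm_le (pt t) (ρ n * a)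
      rw [norm_pt] at this; linarith
    have h1 : ‖pt t - a‖ ≤ 2 * ‖pt t - ρ n * a‖ := by
      have e : pt t - a = (pt t - ρ n * a) + ((ρ n : ℂ) - 1) * a := by ring
      have := norm_add_le (pt t - ρ n * a) (((ρ n : ℂ) - 1) * a)
      rw [← e] at this
      linarith
    have h2 : ‖pt t - ρ n * a‖ ≤ 2 := by
      have := norm_sub_le (pt t) (ρ n * a)
      rw [norm_pt] at this; linarith
    have hp : 0 < ‖pt t - ρ n * a‖ := by linarith
    have l1 := Real.log_le_log hpos h1
    rw [Real.log_mul (by norm_num) hp.ne'] at l1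
    have l2 := Real.log_le_log hp h2
    rw [abs_le]
    constructor <;> linarith [neg_abs_le (Real.log ‖pt t - a‖), abs_nonneg (Real.log ‖pt t - a‖)]
  have hL : Tendsto (fun n => herglotz (fun t => Real.log ‖pt t - ρ n * a‖) z) atTop
      (𝓝 (herglotz (fun t => Real.log ‖pt t - a‖) z)) := by
    refine tendsto_integral_of_dominated_convergence
      (fun t => (‖z‖ + 1) / (‖z‖ - 1) * (|Real.log ‖pt t - a‖| + Real.log 2))
      (fun n => (integrable_kernel_mul (integrable_log_norm_pt_sub _) hz).1)
      (((integrable_log_norm_pt_sub a).abs.add (integrable_const _)).const_mul _)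
      (fun n => ?_) ?_
    · filter_upwards [ae_pt_ne a] with t ht
      rw [norm_mul, Complex.norm_real, Real.norm_eq_abs]
      have : 0 < ‖z‖ - 1 := by linarith
      gcongr
      · exact norm_kernel_le hz t
      · exact hbound n t ht
    · filter_upwards [ae_pt_ne a] with t ht
      refine Tendsto.const_mul _ ((Complex.continuous_ofReal.tendsto _).comp ?_)
      exact (tendsto_const_nhds.sub hρa).norm.log (norm_ne_zero_iff.2 (sub_ne_zero.2 ht))
  refine tendsto_nhds_unique hL ?_
  simpa only [herglotz_log_of_lt (hnorm _) hz] using hR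

lemma norm_pt_sub_reflect (ω : ℝ) {a : ℂ} (ha : a ≠ 0) :
    ‖pt ω - a‖ = ‖a‖ * ‖pt ω - ((starRingEnd ℂ) a)⁻¹‖ := by
  have ha' : (starRingEnd ℂ) a ≠ 0 := by simpa using ha
  have h1 : ‖pt ω - a‖ = ‖(starRingEnd ℂ) (pt ω - a)‖ := (RCLike.norm_conj _).symm
  have h2 : (starRingEnd ℂ) (pt ω - a) =
      -((starRingEnd ℂ) a * (pt ω)⁻¹ * (pt ω - ((starRingEnd ℂ) a)⁻¹)) := by
    have := pt_ne_zero ω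
    rw [map_sub, ← pt_neg, pt_neg_eq_inv]
    field_simp
    ring
  rw [h1, h2, norm_neg, norm_mul, norm_mul, norm_inv, norm_pt, RCLike.norm_conj]
  simp

/-- `u` is the boundary function of the real part of an analytic function in `|z| > 1`, which is
the Herglotz transform of `u` and has radial limits almost everywhere. -/
def HasOuterExtension (u : ℝ → ℝ) : Prop :=
  Integrable u circMeasure ∧ AnalyticOutside (herglotz u) ∧
    ∃ Λ : ℝ → ℂ, IsBoundaryValue (herglotz u) Λ ∧ ∀ᵐ ω ∂circMeasure, (Λ ω).re = u ω

lemma AnalyticOutside.congr {X Z : ℂ → ℂ} (hX : AnalyticOutside X)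
    (h : ∀ z : ℂ, 1 < ‖z‖ → Z z = X z) : AnalyticOutside Z := by
  obtain ⟨Y, hY, e⟩ := hX
  exact ⟨Y, hY, fun z hz => (h z hz).trans (e z hz)⟩

lemma IsBoundaryValue.congr {X Z : ℂ → ℂ} {f : ℝ → ℂ} (hX : IsBoundaryValue X f)
    (h : ∀ z : ℂ, 1 < ‖z‖ → Z z = X z) : IsBoundaryValue Z f := by
  filter_upwards [hX] with ω hω
  refine hω.congr' ?_
  filter_upwards [self_mem_nhdsWithin] with r hr
  exact (h _ (one_lt_norm_mul_pt hr ω)).symm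

namespace HasOuterExtension

lemma congr {u v : ℝ → ℝ} (hu : HasOuterExtension u) (h : u =ᵐ[circMeasure] v) :
    HasOuterExtension v := by
  have e : herglotz v = herglotz u := funext fun z => herglotz_congr h.symm z
  obtain ⟨h1, h2, Λ, h3, h4⟩ := hu
  refine ⟨h1.congr h, e ▸ h2, Λ, e ▸ h3, ?_⟩
  filter_upwards [h4, h] with ω h5 h6
  rw [h5, h6]

lemma const (c : ℝ) : HasOuterExtension fun _ => c := by
  have e : ∀ z : ℂ, 1 < ‖z‖ → herglotz (fun _ => c) z = c := fun z hz => by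
    have := herglotz_const_mul c (fun _ => 1) z
    rw [herglotz_one hz] at this
    simpa using this
  refine ⟨integrable_const _, ⟨fun _ => c, differentiableOn_const _, e⟩, fun _ => c, ?_, by simp⟩
  exact IsBoundaryValue.congr (X := fun _ => c) (Eventually.of_forall fun ω => tendsto_const_nhds) e

lemma add {u v : ℝ → ℝ} (hu : HasOuterExtension u) (hv : HasOuterExtension v) :
    HasOuterExtension fun t => u t + v t := by
  obtain ⟨h1, ⟨Y, hY, hYe⟩, Λ, h3, h4⟩ := hu
  obtain ⟨k1, ⟨Z, hZ, hZe⟩, Λ', k3, k4⟩ := hv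
  have e : ∀ z : ℂ, 1 < ‖z‖ → herglotz (fun t => u t + v t) z = herglotz u z + herglotz v z :=
    fun z hz => herglotz_add h1 k1 hz
  refine ⟨h1.add k1, ⟨fun w => Y w + Z w, hY.add hZ, fun z hz => ?_⟩, fun ω => Λ ω + Λ' ω,
    ?_, ?_⟩
  · rw [e z hz, hYe z hz, hZe z hz]
  · refine IsBoundaryValue.congr (X := fun z => herglotz u z + herglotz v z) ?_ e
    filter_upwards [h3, k3] with ω h5 h6 using h5.add h6
  · filter_upwards [h4, k4] with ω h5 h6
    rw [Complex.add_re, h5, h6]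

lemma const_mul {u : ℝ → ℝ} (hu : HasOuterExtension u) (c : ℝ) :
    HasOuterExtension fun t => c * u t := by
  obtain ⟨h1, ⟨Y, hY, hYe⟩, Λ, h3, h4⟩ := hu
  have e := herglotz_const_mul c u
  refine ⟨h1.const_mul c, ⟨fun w => c * Y w, hY.const_mul _, fun z hz => ?_⟩, fun ω => c * Λ ω,
    ?_, ?_⟩
  · rw [e z, hYe z hz]
  · refine IsBoundaryValue.congr (X := fun z => c * herglotz u z) ?_ fun z _ => e z
    filter_upwards [h3] with ω h5 using h5.const_mul _
  · filter_upwards [h4] with ω h5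
    rw [Complex.re_ofReal_mul, h5]

lemma log_norm_pt_sub_of_le {a : ℂ} (ha : ‖a‖ ≤ 1) :
    HasOuterExtension fun t => Real.log ‖pt t - a‖ := by
  have e : ∀ z : ℂ, 1 < ‖z‖ → _ := fun z hz => herglotz_log_of_le ha hz
  refine ⟨integrable_log_norm_pt_sub a, ⟨fun w => Complex.log (1 - a * w), ?_, e⟩,
    fun ω => Complex.log (1 - a * (pt ω)⁻¹), ?_, ?_⟩
  · refine DifferentiableOn.clog (by fun_prop) fun w hw => ?_
    have hw1 : ‖w‖ < 1 := by simpa using hw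
    have hlt : ‖a * w‖ < 1 := by
      rw [norm_mul]; nlinarith [norm_nonneg a, norm_nonneg w]
    exact one_sub_mem_slitPlane hlt.le fun h => by rw [h, norm_one] at hlt; exact lt_irrefl _ hlt
  · refine IsBoundaryValue.congr (X := fun z => Complex.log (1 - a * z⁻¹)) ?_ e
    filter_upwards [ae_pt_ne a] with ω hω
    refine tendsto_radial (F := fun z => Complex.log (1 - a * z⁻¹)) (ContinuousAt.clog ?_ ?_)
    · exact continuousAt_const.sub (continuousAt_const.mul (continuousAt_inv₀ (pt_ne_zero ω)))
    · refine one_sub_mem_slitPlane (by simpa [norm_pt] using ha) fun h => hω ?_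
      exact (mul_inv_eq_one₀ (pt_ne_zero ω)).1 h |>.symm
  · exact Eventually.of_forall fun ω => by
      simp only [Complex.log_re, norm_pt_sub_eq ω a]

lemma log_norm_pt_sub (a : ℂ) : HasOuterExtension fun t => Real.log ‖pt t - a‖ := by
  by_cases ha : ‖a‖ ≤ 1
  · exact log_norm_pt_sub_of_le ha
  · rw [not_le] at ha
    have ha0 : a ≠ 0 := norm_pos_iff.1 (by linarith)
    have hle : ‖((starRingEnd ℂ) a)⁻¹‖ ≤ 1 := by
      rw [norm_inv, RCLike.norm_conj]; exact inv_le_one_of_one_le₀ ha.le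
    refine ((const (Real.log ‖a‖)).add (log_norm_pt_sub_of_le hle)).congr ?_
    filter_upwards [ae_pt_ne ((starRingEnd ℂ) a)⁻¹] with ω hω
    rw [norm_pt_sub_reflect ω ha0, Real.log_mul (norm_ne_zero_iff.2 ha0)
      (norm_ne_zero_iff.2 (sub_ne_zero.2 hω))]

end HasOuterExtension

/-! ### Poisson majorants of rational functions -/

/-- The factor `|z - a|` against its Poisson majorant; equality holds if `a` lies in the closed
disc. -/
lemma log_norm_sub_le_herglotz (a : ℂ) {z : ℂ} (hz : 1 < ‖z‖) (hza : z ≠ a) :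
    Real.log ‖z - a‖ ≤ (herglotz (fun t => Real.log ‖pt t - a‖) z).re + Real.log ‖z‖ ∧
    (‖a‖ ≤ 1 → Real.log ‖z - a‖ =
      (herglotz (fun t => Real.log ‖pt t - a‖) z).re + Real.log ‖z‖) := by
  have hz0 : z ≠ 0 := norm_pos_iff.1 (by linarith)
  have hzn : ‖z‖ ≠ 0 := norm_ne_zero_iff.2 hz0
  have key : ∀ b : ℂ, ‖b‖ ≤ 1 → z ≠ b → Real.log ‖z - b‖ =
      (herglotz (fun t => Real.log ‖pt t - b‖) z).re + Real.log ‖z‖ := by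
    intro b hb hzb
    have e : z - b = (1 - b * z⁻¹) * z := by field_simp
    have h1 : 1 - b * z⁻¹ ≠ 0 := by
      intro h; rw [h, zero_mul] at e; exact hzb (sub_eq_zero.1 e)
    rw [herglotz_log_of_le hb hz, Complex.log_re, e, norm_mul,
      Real.log_mul (norm_ne_zero_iff.2 h1) hzn]
  refine ⟨?_, fun ha => key a ha hza⟩
  by_cases ha : ‖a‖ ≤ 1
  · exact (key a ha hza).le
  rw [not_le] at ha
  have ha0 : a ≠ 0 := norm_pos_iff.1 (by linarith)
  have hca : (starRingEnd ℂ) a ≠ 0 := by simpa using ha0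
  have hbn : ‖((starRingEnd ℂ) a)⁻¹‖ ≤ 1 := by
    rw [norm_inv, RCLike.norm_conj]; exact inv_le_one_of_one_le₀ ha.le
  have hzb : z ≠ ((starRingEnd ℂ) a)⁻¹ := by
    rintro rfl; linarith
  have hsum : (herglotz (fun t => Real.log ‖pt t - a‖) z).re =
      Real.log ‖a‖ + (herglotz (fun t => Real.log ‖pt t - ((starRingEnd ℂ) a)⁻¹‖) z).re := by
    have h1 : herglotz (fun t => Real.log ‖pt t - a‖) z = herglotz (fun t => Real.log ‖a‖ * 1 +
        Real.log ‖pt t - ((starRingEnd ℂ) a)⁻¹‖) z := by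
      refine herglotz_congr ?_ z
      filter_upwards [ae_pt_ne ((starRingEnd ℂ) a)⁻¹] with ω hω
      rw [norm_pt_sub_reflect ω ha0, Real.log_mul (norm_ne_zero_iff.2 ha0)
        (norm_ne_zero_iff.2 (sub_ne_zero.2 hω)), mul_one]
    rw [h1, herglotz_add (integrable_const _) (integrable_log_norm_pt_sub _) hz,
      herglotz_const_mul, herglotz_one hz]
    simp
  have h2 := key _ hbn hzb
  rw [hsum, add_assoc, ← h2, ← Real.log_mul (norm_ne_zero_iff.2 ha0)
    (norm_ne_zero_iff.2 (sub_ne_zero.2 hzb))]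
  refine Real.log_le_log (norm_pos_iff.2 (sub_ne_zero.2 hza)) ?_
  -- `|z - a|² ≤ |conj a * z - 1|²` as both points lie outside the disc
  have h3 : ‖a‖ * ‖z - ((starRingEnd ℂ) a)⁻¹‖ = ‖(starRingEnd ℂ) a * z - 1‖ := by
    rw [← RCLike.norm_conj a, ← norm_mul, mul_sub, mul_inv_cancel₀ hca]
  rw [h3]
  refine (pow_le_pow_iff_left₀ (norm_nonneg _) (norm_nonneg _) two_ne_zero).1 ?_
  have h4 : 1 < ‖a‖ ^ 2 := by nlinarith
  have h5 : 1 < ‖z‖ ^ 2 := by nlinarith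
  rw [← Complex.normSq_eq_norm_sq, Complex.normSq_apply] at h4 h5 ⊢
  rw [← Complex.normSq_eq_norm_sq, Complex.normSq_apply]
  simp only [Complex.sub_re, Complex.sub_im, Complex.mul_re, Complex.mul_im, Complex.conj_re,
    Complex.conj_im, Complex.one_re, Complex.one_im]
  nlinarith [mul_pos (sub_pos.2 h4) (sub_pos.2 h5)]

lemma multiset_log_majorant (s : Multiset ℂ) :
    HasOuterExtension (fun t => (s.map fun a => Real.log ‖pt t - a‖).sum) ∧
    ∀ z : ℂ, 1 < ‖z‖ → z ∉ s →
      (s.map fun a => Real.log ‖z - a‖).sum ≤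
        (herglotz (fun t => (s.map fun a => Real.log ‖pt t - a‖).sum) z).re +
          s.card * Real.log ‖z‖ ∧
      ((∀ a ∈ s, ‖a‖ ≤ 1) → (s.map fun a => Real.log ‖z - a‖).sum =
        (herglotz (fun t => (s.map fun a => Real.log ‖pt t - a‖).sum) z).re +
          s.card * Real.log ‖z‖) := by
  induction s using Multiset.induction_on with
  | empty =>
    refine ⟨by simpa using HasOuterExtension.const 0, fun z _ _ => ?_⟩
    simp [herglotz]
  | cons a s ih =>
    obtain ⟨ih1, ih2⟩ := ih
    simp only [Multiset.map_cons, Multiset.sum_cons, Multiset.card_cons, Multiset.mem_cons,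
      not_or]
    refine ⟨(HasOuterExtension.log_norm_pt_sub a).add ih1, fun z hz hzs => ?_⟩
    obtain ⟨h1, h2⟩ := log_norm_sub_le_herglotz a hz hzs.1
    obtain ⟨h3, h4⟩ := ih2 z hz hzs.2
    rw [herglotz_add (integrable_log_norm_pt_sub a) ih1.1 hz, Complex.add_re]
    push_cast
    refine ⟨by linarith, fun h => ?_⟩
    have := h2 (h a (Or.inl rfl))
    have := h4 fun b hb => h b (Or.inr hb)
    linarith

lemma log_norm_multiset_prod (s : Multiset ℂ) {z : ℂ} (hz : z ∉ s) :
    Real.log ‖(s.map fun a => z - a).prod‖ = (s.map fun a => Real.log ‖z - a‖).sum := by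
  induction s using Multiset.induction_on with
  | empty => simp
  | cons a s ih =>
    rw [Multiset.mem_cons, not_or] at hz
    have h0 : (s.map fun a => z - a).prod ≠ 0 := by
      rw [Ne, Multiset.prod_eq_zero_iff]
      intro h
      obtain ⟨b, hb, hb0⟩ := Multiset.mem_map.1 h
      exact hz.2 (sub_eq_zero.1 hb0 ▸ hb)
    rw [Multiset.map_cons, Multiset.prod_cons, norm_mul,
      Real.log_mul (norm_ne_zero_iff.2 (sub_ne_zero.2 hz.1)) (norm_ne_zero_iff.2 h0), ih hz.2,
      Multiset.map_cons, Multiset.sum_cons]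

/-- `log|f|` for a polynomial `f` against its Poisson majorant; equality holds if all zeros lie in
the closed disc. -/
lemma polynomial_log_majorant {f : Polynomial ℝ} (hf : f ≠ 0) :
    HasOuterExtension (fun t => Real.log ‖Polynomial.aeval (pt t) f‖) ∧
    ∀ z : ℂ, 1 < ‖z‖ → Polynomial.aeval z f ≠ 0 →
      Real.log ‖Polynomial.aeval z f‖ ≤
        (herglotz (fun t => Real.log ‖Polynomial.aeval (pt t) f‖) z).re +
          f.natDegree * Real.log ‖z‖ ∧
      ((∀ a : ℂ, Polynomial.aeval a f = 0 → ‖a‖ ≤ 1) → Real.log ‖Polynomial.aeval z f‖ =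
        (herglotz (fun t => Real.log ‖Polynomial.aeval (pt t) f‖) z).re +
          f.natDegree * Real.log ‖z‖) := by
  set F := f.map (algebraMap ℝ ℂ) with hF
  have hF0 : F ≠ 0 := Polynomial.map_ne_zero hf
  set s := F.roots with hs
  have hcard : s.card = f.natDegree := by
    rw [hs, ← (IsAlgClosed.splits F).natDegree_eq_card_roots, hF, Polynomial.natDegree_map]
  have hlead : F.leadingCoeff ≠ 0 := Polynomial.leadingCoeff_ne_zero.2 hF0
  have hmem : ∀ z : ℂ, z ∈ s ↔ Polynomial.aeval z f = 0 := fun z => by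
    rw [hs, Polynomial.mem_roots hF0, Polynomial.IsRoot.def, hF, Polynomial.eval_map_algebraMap]
  have hval : ∀ z : ℂ, Polynomial.aeval z f ≠ 0 → Real.log ‖Polynomial.aeval z f‖ =
      Real.log ‖F.leadingCoeff‖ + (s.map fun a => Real.log ‖z - a‖).sum := by
    intro z hz
    have h1 : Polynomial.aeval z f = F.leadingCoeff * (s.map fun a => z - a).prod := by
      rw [← Polynomial.eval_map_algebraMap, ← hF]
      conv_lhs => rw [(IsAlgClosed.splits F).eq_prod_roots]
      rw [Polynomial.eval_mul, Polynomial.eval_C, Polynomial.eval_multiset_prod, Multiset.map_map]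
      simp [hs]
    have h2 : (s.map fun a => z - a).prod ≠ 0 := fun h => hz (by rw [h1, h, mul_zero])
    rw [h1, norm_mul, Real.log_mul (norm_ne_zero_iff.2 hlead) (norm_ne_zero_iff.2 h2),
      log_norm_multiset_prod s ((hmem z).not.2 hz)]
  obtain ⟨m1, m2⟩ := multiset_log_majorant s
  have hae : (fun t => Real.log ‖F.leadingCoeff‖ * 1 + (s.map fun a => Real.log ‖pt t - a‖).sum)
      =ᵐ[circMeasure] fun t => Real.log ‖Polynomial.aeval (pt t) f‖ := by
    filter_upwards [ae_aeval_pt_ne_zero hf] with t ht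
    rw [hval _ ht, mul_one]
  refine ⟨((HasOuterExtension.const _).add m1).congr hae, fun z hz hz0 => ?_⟩
  rw [← herglotz_congr hae, herglotz_add (integrable_const _) m1.1 hz, herglotz_const_mul,
    herglotz_one hz, hval z hz0, ← hcard, Complex.add_re, mul_one, Complex.ofReal_re]
  obtain ⟨h1, h2⟩ := m2 z hz ((hmem z).not.2 hz0)
  refine ⟨by linarith, fun h => ?_⟩
  have := h2 fun a ha => h a ((hmem a).1 ha)
  linarith

lemma log_norm_onCirc_ae {p : RatFunc ℝ} (hp : p ≠ 0) :
    (fun t => Real.log ‖Polynomial.aeval (pt t) p.num‖ +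
      (-1) * Real.log ‖Polynomial.aeval (pt t) p.denom‖)
      =ᵐ[circMeasure] fun t => Real.log ‖onCirc p t‖ := by
  filter_upwards [ae_aeval_pt_ne_zero (RatFunc.num_ne_zero hp),
    ae_aeval_pt_ne_zero p.denom_ne_zero] with t h1 h2
  rw [onCirc, evalAt_def, norm_div, Real.log_div (norm_ne_zero_iff.2 h1) (norm_ne_zero_iff.2 h2)]
  ring

lemma hasOuterExtension_log_onCirc {p : RatFunc ℝ} (hp : p ≠ 0) :
    HasOuterExtension fun t => Real.log ‖onCirc p t‖ :=
  ((polynomial_log_majorant (RatFunc.num_ne_zero hp)).1.add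
    ((polynomial_log_majorant p.denom_ne_zero).1.const_mul (-1))).congr (log_norm_onCirc_ae hp)

/-- The Jensen inequality for stable proper rational functions. -/
lemma MemRH.log_norm_le_herglotz {p : RatFunc ℝ} (hp : MemRH p) {z : ℂ} (hz : 1 < ‖z‖)
    (hpz : evalAt p z ≠ 0) :
    Real.log ‖evalAt p z‖ ≤ (herglotz (fun t => Real.log ‖onCirc p t‖) z).re := by
  have hp0 : p ≠ 0 := by
    rintro rfl; exact hpz (regAt_zero z).2
  have hd : Polynomial.aeval z p.denom ≠ 0 := hp.2 z hz.le
  have hn : Polynomial.aeval z p.num ≠ 0 := by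
    intro h; rw [evalAt_def, h, zero_div] at hpz; exact hpz rfl
  obtain ⟨n1, n2⟩ := polynomial_log_majorant (RatFunc.num_ne_zero hp0)
  obtain ⟨d1, d2⟩ := polynomial_log_majorant p.denom_ne_zero
  have h1 := (n2 z hz hn).1
  have h2 := (d2 z hz hd).2 fun a ha => by
    by_contra h
    exact hp.2 a (not_le.1 h).le ha
  rw [← herglotz_congr (log_norm_onCirc_ae hp0), herglotz_add n1.1 (d1.1.const_mul _) hz,
    herglotz_const_mul, evalAt_def, norm_div,
    Real.log_div (norm_ne_zero_iff.2 hn) (norm_ne_zero_iff.2 hd), Complex.add_re,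
    Complex.re_ofReal_mul]
  have h3 : (p.num.natDegree : ℝ) * Real.log ‖z‖ ≤ p.denom.natDegree * Real.log ‖z‖ := by
    have := Real.log_nonneg hz.le
    gcongr
    exact hp.1
  linarith

/-! ### Outer functions -/

lemma exists_isOuterHardyTwo {u : ℝ → ℝ} (hu : HasOuterExtension u) {B : ℝ}
    (hB : ∀ᵐ ω ∂circMeasure, u ω ≤ B) :
    ∃ f : ℝ → ℂ, IsOuterHardyTwo f ∧ ∀ᵐ ω ∂circMeasure, ‖f ω‖ = Real.exp (u ω) := by
  obtain ⟨h1, ⟨Y, hY, hYe⟩, Λ, h3, h4⟩ := hu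
  have hn : ∀ᵐ ω ∂circMeasure, ‖Complex.exp (Λ ω)‖ = Real.exp (u ω) := by
    filter_upwards [h4] with ω hω
    rw [Complex.norm_exp, hω]
  have hlog : (fun ω => Real.log ‖Complex.exp (Λ ω)‖) =ᵐ[circMeasure] u := by
    filter_upwards [hn] with ω hω
    rw [hω, Real.log_exp]
  refine ⟨fun ω => Complex.exp (Λ ω), ⟨fun z => Complex.exp (herglotz u z), ?_, ?_, ?_, ?_, 1,
    by simp, fun z hz => ?_⟩, hn⟩
  · refine IsBoundedOutside.isHardyTwo ⟨⟨fun w => Complex.exp (Y w), hY.cexp, fun z hz => ?_⟩,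
      Real.exp B, fun z hz => ?_⟩
    · simp only [hYe z hz]
    · rw [Complex.norm_exp, Real.exp_le_exp]
      refine (herglotz_re_mono h1 (integrable_const B) hB hz).trans ?_
      have := herglotz_const_mul B (fun _ => 1) z
      rw [herglotz_one hz] at this
      simp only [mul_one] at this
      rw [this, Complex.ofReal_re]
  · filter_upwards [h3] with ω hω
    exact (Complex.continuous_exp.tendsto _).comp hω
  · exact Eventually.of_forall fun ω => Complex.exp_ne_zero _
  · exact h1.congr hlog.symm
  · simp only [one_mul, ← herglotz_congr hlog z]
    rfl

lemma IsOuterHardyTwo.memHardyTwo {f : ℝ → ℂ} (hf : IsOuterHardyTwo f) : MemHardyTwo f := by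
  obtain ⟨X, h1, h2, -⟩ := hf
  exact ⟨X, h1, h2⟩

lemma IsOuterHardyTwo.ne_zero {f : ℝ → ℂ} (hf : IsOuterHardyTwo f) :
    ∀ᵐ ω ∂circMeasure, f ω ≠ 0 := by
  obtain ⟨X, -, -, h, -⟩ := hf
  exact h

/-- Smirnov's maximum principle for quotients by an outer function: if `p / f` is bounded on the
circle, then so is its analytic extension, by the Jensen inequality for `p` and equality for `f`. -/
lemma IsOuterHardyTwo.memHardyTwo_div {f : ℝ → ℂ} (hf : IsOuterHardyTwo f)
    (hu : HasOuterExtension fun ω => Real.log ‖f ω‖) {p : RatFunc ℝ} (hp : MemRH p) {B : ℝ}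
    (hB : ∀ᵐ ω ∂circMeasure, ‖onCirc p ω‖ ≤ B * ‖f ω‖) :
    MemHardyTwo fun ω => onCirc p ω / f ω := by
  obtain ⟨X, hX, hXf, hf0, hlog, c, hc, hXc⟩ := hf
  obtain ⟨-, ⟨Y, hY, hYe⟩, -⟩ := hu
  have hc0 : c ≠ 0 := by rintro rfl; simp at hc
  have hXc' : ∀ z : ℂ, 1 < ‖z‖ → X z = c * Complex.exp (herglotz (fun ω => Real.log ‖f ω‖) z) :=
    hXc
  refine ⟨fun z => evalAt p z / X z, IsBoundedOutside.isHardyTwo ⟨?_, max B 1, fun z hz => ?_⟩, ?_⟩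
  · refine (hp.isBoundedOutside.1.mul (Z := fun z => (X z)⁻¹)
      ⟨fun w => (c * Complex.exp (Y w))⁻¹, ?_, fun z hz => ?_⟩).congr fun z hz => div_eq_mul_inv _ _
    · exact (hY.cexp.const_mul c).inv fun w _ => mul_ne_zero hc0 (Complex.exp_ne_zero _)
    · simp only [hXc' z hz, hYe z hz]
  · by_cases hpz : evalAt p z = 0
    · simp only [hpz, zero_div, norm_zero]; positivity
    have hp0 : p ≠ 0 := by
      rintro rfl; exact hpz (regAt_zero z).2
    set B' := max B 1
    have hB'0 : 0 < B' := by positivity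
    have hXz : X z ≠ 0 := by
      rw [hXc' z hz]; exact mul_ne_zero hc0 (Complex.exp_ne_zero _)
    have hXlog : Real.log ‖X z‖ = (herglotz (fun ω => Real.log ‖f ω‖) z).re := by
      rw [hXc' z hz, norm_mul, hc, one_mul, Complex.norm_exp, Real.log_exp]
    have h1 := hp.log_norm_le_herglotz hz hpz
    have h2 : (herglotz (fun t => Real.log ‖onCirc p t‖) z).re ≤
        (herglotz (fun t => Real.log B' * 1 + Real.log ‖f t‖) z).re := by
      refine herglotz_re_mono (hasOuterExtension_log_onCirc hp0).1
        ((integrable_const _).add hlog) ?_ hz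
      filter_upwards [hB, hf0, ae_onCirc_ne_zero hp0] with ω h3 h4 h5
      simp only [Pi.add_apply, mul_one]
      rw [← Real.log_mul hB'0.ne' (norm_ne_zero_iff.2 h4)]
      refine Real.log_le_log (norm_pos_iff.2 h5) (h3.trans ?_)
      gcongr
      exact le_max_left _ _
    rw [herglotz_add (integrable_const _) hlog hz, herglotz_const_mul, herglotz_one hz, mul_one,
      Complex.add_re, Complex.ofReal_re, ← hXlog, ← Real.log_mul hB'0.ne'
      (norm_ne_zero_iff.2 hXz)] at h2
    rw [norm_div, div_le_iff₀ (norm_pos_iff.2 hXz)]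
    exact (Real.log_le_log_iff (norm_pos_iff.2 hpz)
      (mul_pos hB'0 (norm_pos_iff.2 hXz))).1 (h1.trans h2)
  · filter_upwards [hp.isBoundaryValue, hXf, hf0] with ω h1 h2 h3 using h1.div h2 h3

/-! ### Resolvents and the stability of the closed loop -/

/-- The matrix `zI - A` over the field of rational functions. -/
def pencil {n : ℕ} (A : Matrix (Fin n) (Fin n) ℝ) : Matrix (Fin n) (Fin n) (RatFunc ℝ) :=
  (RatFunc.X : RatFunc ℝ) • (1 : Matrix (Fin n) (Fin n) (RatFunc ℝ)) - A.map RatFunc.C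

lemma pencil_eq {n : ℕ} (A : Matrix (Fin n) (Fin n) ℝ) :
    pencil A = (Matrix.charmatrix A).map (algebraMap (Polynomial ℝ) (RatFunc ℝ)) := by
  ext i j
  by_cases h : i = j
  · subst h
    simp [pencil, Matrix.charmatrix_apply_eq]
  · simp [pencil, h]

lemma det_pencil {n : ℕ} (A : Matrix (Fin n) (Fin n) ℝ) :
    (pencil A).det = algebraMap _ _ A.charpoly := by
  rw [pencil_eq, Matrix.charpoly, RingHom.map_det]; rfl

lemma isUnit_det_pencil {n : ℕ} (A : Matrix (Fin n) (Fin n) ℝ) : IsUnit (pencil A).det := by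
  rw [det_pencil, isUnit_iff_ne_zero]
  simpa using A.charpoly_monic.ne_zero

/-- All entries of the matrix are regular at `z`. -/
def RegMatAt {m k : ℕ} (z : ℂ) (X : Matrix (Fin m) (Fin k) (RatFunc ℝ)) : Prop :=
  ∀ i j, RegAt z (X i j)

namespace RegMatAt

variable {m k l : ℕ} {z : ℂ}

lemma add {X Y : Matrix (Fin m) (Fin k) (RatFunc ℝ)} (hX : RegMatAt z X) (hY : RegMatAt z Y) :
    RegMatAt z (X + Y) := fun i j => ((hX i j).add (hY i j)).1

lemma sub {X Y : Matrix (Fin m) (Fin k) (RatFunc ℝ)} (hX : RegMatAt z X) (hY : RegMatAt z Y) :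
    RegMatAt z (X - Y) := fun i j => ((hX i j).sub (hY i j)).1

lemma mul {X : Matrix (Fin m) (Fin k) (RatFunc ℝ)} {Y : Matrix (Fin k) (Fin l) (RatFunc ℝ)}
    (hX : RegMatAt z X) (hY : RegMatAt z Y) : RegMatAt z (X * Y) := fun i j => by
  rw [Matrix.mul_apply]
  exact (RegAt.sum _ fun a _ => ((hX i a).mul (hY a j)).1).1

lemma smul {p : RatFunc ℝ} {X : Matrix (Fin m) (Fin k) (RatFunc ℝ)} (hp : RegAt z p)
    (hX : RegMatAt z X) : RegMatAt z (p • X) := fun i j => (hp.mul (hX i j)).1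

lemma map_C (A : Matrix (Fin m) (Fin k) ℝ) : RegMatAt z (A.map RatFunc.C) :=
  fun _ _ => (regAt_C z _).1

lemma inv_pencil {n : ℕ} {A : Matrix (Fin n) (Fin n) ℝ} (hA : IsSchur A) (hz : 1 ≤ ‖z‖) :
    RegMatAt z (pencil A)⁻¹ := fun i j => by
  have hd : Polynomial.aeval z A.charpoly ≠ 0 := fun h => absurd (hA z h) (not_lt.2 hz)
  have hadj : (pencil A).adjugate =
      (Matrix.charmatrix A).adjugate.map (algebraMap (Polynomial ℝ) (RatFunc ℝ)) := by
    rw [pencil_eq]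
    exact (RingHom.map_adjugate (algebraMap (Polynomial ℝ) (RatFunc ℝ)) _).symm
  rw [Matrix.inv_def, Ring.inverse_eq_inv', det_pencil, Matrix.smul_apply, smul_eq_mul, hadj]
  have h1 := regAt_algebraMap z A.charpoly
  exact ((RegAt.inv (h1.2 ▸ hd)).1.mul (regAt_algebraMap z _).1).1

end RegMatAt

/-- The resolvent of `A` in terms of the one of `A + D`, with the correction on the right. -/
lemma inv_pencil_right {n : ℕ} (A D : Matrix (Fin n) (Fin n) ℝ) :
    (pencil A)⁻¹ = (pencil (A + D))⁻¹ - (pencil A)⁻¹ * D.map RatFunc.C * (pencil (A + D))⁻¹ := by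
  have h : pencil A = pencil (A + D) + D.map RatFunc.C := by
    ext i j
    simp only [pencil, Matrix.sub_apply, Matrix.add_apply, Matrix.map_apply, map_add]
    ring
  have h1 := Matrix.nonsing_inv_mul _ (isUnit_det_pencil A)
  have h2 := Matrix.mul_nonsing_inv _ (isUnit_det_pencil (A + D))
  set Φ := (pencil A)⁻¹
  set Ψ := (pencil (A + D))⁻¹
  rw [h, mul_add] at h1
  have h3 : Φ * pencil (A + D) = 1 - Φ * D.map RatFunc.C := eq_sub_of_add_eq h1
  calc Φ = Φ * pencil (A + D) * Ψ := by rw [mul_assoc, h2, mul_one]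
    _ = _ := by rw [h3, sub_mul, one_mul]

lemma inv_pencil_left {n : ℕ} (A D : Matrix (Fin n) (Fin n) ℝ) :
    (pencil A)⁻¹ = (pencil (A + D))⁻¹ - (pencil (A + D))⁻¹ * D.map RatFunc.C * (pencil A)⁻¹ := by
  have h : pencil A = pencil (A + D) + D.map RatFunc.C := by
    ext i j
    simp only [pencil, Matrix.sub_apply, Matrix.add_apply, Matrix.map_apply, map_add]
    ring
  have h1 := Matrix.mul_nonsing_inv _ (isUnit_det_pencil A)
  have h2 := Matrix.nonsing_inv_mul _ (isUnit_det_pencil (A + D))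
  set Φ := (pencil A)⁻¹
  set Ψ := (pencil (A + D))⁻¹
  rw [h, add_mul] at h1
  have h3 : pencil (A + D) * Φ = 1 - D.map RatFunc.C * Φ := eq_sub_of_add_eq h1
  calc Φ = Ψ * (pencil (A + D) * Φ) := by rw [← mul_assoc, h2, one_mul]
    _ = _ := by rw [h3, mul_sub, mul_one, mul_assoc]

lemma transfer_def {n m k : ℕ} (A : Matrix (Fin n) (Fin n) ℝ) (B : Matrix (Fin n) (Fin k) ℝ)
    (C : Matrix (Fin m) (Fin n) ℝ) (D : Matrix (Fin m) (Fin k) ℝ) :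
    transfer A B C D = C.map RatFunc.C * (pencil A)⁻¹ * B.map RatFunc.C + D.map RatFunc.C := rfl

/-- Stability of the full plant in closed loop: if `S`, `S G_yu` and `G_yu + G_yu S G_yu` are
regular at a point outside the open disc, then so is `G_zv + G_zu S G_yv`. By stabilizability and
detectability the resolvent of `A` may be replaced by resolvents of Schur matrices on both
sides. -/
lemma Plant.regMatAt_closedLoop {n nv nz : ℕ} (P : Plant n nv nz) (hstab : P.IsStabilizable)
    (hdet : P.IsDetectable) {z : ℂ} (hz : 1 ≤ ‖z‖) {s : RatFunc ℝ} (h1 : RegAt z s)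
    (h2 : RegAt z (s * P.Gyu)) (h3 : RegAt z (P.Gyu + P.Gyu * s * P.Gyu)) :
    RegMatAt z (P.Gzv + s • (P.Gzu * P.Gyv)) := by
  obtain ⟨F, hF⟩ := hstab
  obtain ⟨R, hR⟩ := hdet
  have hΦF := RegMatAt.inv_pencil hF hz
  have hΦR := RegMatAt.inv_pencil hR hz
  have e1 := inv_pencil_right P.A (P.B₂ * F)
  have e2 := inv_pencil_left P.A (R * P.C₂)
  rw [Matrix.map_mul] at e1 e2
  set ΦF := (pencil (P.A + P.B₂ * F))⁻¹
  set ΦR := (pencil (P.A + R * P.C₂))⁻¹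
  have hg : P.C₂.map RatFunc.C * (pencil P.A)⁻¹ * P.B₂.map RatFunc.C =
      P.Gyu • (1 : Matrix (Fin 1) (Fin 1) (RatFunc ℝ)) := by
    ext i j
    fin_cases i; fin_cases j
    simp [Plant.Gyu, transfer_def]
  rw [Plant.Gzv, Plant.Gzu, Plant.Gyv, transfer_def, transfer_def, transfer_def]
  set g := P.Gyu
  set Φ := (pencil P.A)⁻¹
  have hc (m k : ℕ) (X : Matrix (Fin m) (Fin k) ℝ) : RegMatAt z (X.map RatFunc.C) :=
    RegMatAt.map_C X
  have hB1 := hc _ _ P.B₁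
  have hB2 := hc _ _ P.B₂
  have hC1 := hc _ _ P.C₁
  have hC2 := hc _ _ P.C₂
  have hD11 := hc _ _ P.D₁₁
  have hD12 := hc _ _ P.D₁₂
  have hD21 := hc _ _ P.D₂₁
  have hFc := hc _ _ F
  have hRc := hc _ _ R
  set b1 := P.B₁.map RatFunc.C
  set b2 := P.B₂.map RatFunc.C
  set c1 := P.C₁.map RatFunc.C
  set c2 := P.C₂.map RatFunc.C
  set d11 := P.D₁₁.map RatFunc.C
  set d12 := P.D₁₂.map RatFunc.C
  set d21 := P.D₂₁.map RatFunc.C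
  set f := F.map RatFunc.C
  set r := R.map RatFunc.C
  have α : c2 * Φ = c2 * ΦF - g • (f * ΦF) := by
    conv_lhs => rw [e1]
    rw [Matrix.mul_sub]
    congr 1
    calc c2 * (Φ * (b2 * f) * ΦF) = (c2 * Φ * b2) * (f * ΦF) := by simp only [Matrix.mul_assoc]
      _ = _ := by rw [hg, Matrix.smul_mul, Matrix.one_mul]
  have β : Φ * b2 = ΦR * b2 - g • (ΦR * r) := by
    conv_lhs => rw [e2]
    rw [Matrix.sub_mul]
    congr 1
    calc ΦR * (r * c2) * Φ * b2 = (ΦR * r) * (c2 * Φ * b2) := by simp only [Matrix.mul_assoc]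
      _ = _ := by rw [hg, Matrix.mul_smul, Matrix.mul_one]
  have r1 : RegMatAt z (s • (c2 * Φ)) := by
    rw [α, smul_sub, smul_smul]
    exact ((hC2.mul hΦF).smul h1).sub ((hFc.mul hΦF).smul h2)
  have r2 : RegMatAt z (s • (Φ * b2)) := by
    rw [β, smul_sub, smul_smul]
    exact ((hΦR.mul hB2).smul h1).sub ((hΦR.mul hRc).smul h2)
  have r3 : RegMatAt z ((1 + g * s) • (c2 * Φ)) := by
    rw [α, smul_sub, smul_smul]
    refine ((hC2.mul hΦF).smul ((regAt_one z).1.add ?_).1).sub ((hFc.mul hΦF).smul ?_)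
    · rw [mul_comm]; exact h2
    · rw [add_mul, one_mul]; exact h3
  have hΨ : Φ + s • (Φ * b2 * (c2 * Φ)) =
      ΦR - ΦR * r * ((1 + g * s) • (c2 * Φ)) + ΦR * b2 * (s • (c2 * Φ)) := by
    rw [β]
    have e3 : Φ = ΦR - ΦR * r * (c2 * Φ) := by
      conv_lhs => rw [e2]
      simp only [Matrix.mul_assoc]
    conv_lhs => lhs; rw [e3]
    simp only [Matrix.sub_mul, Matrix.smul_mul, Matrix.mul_smul, Matrix.mul_add, smul_sub, add_smul, one_smul,
      smul_smul, mul_comm s g]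
    abel
  have r4 : RegMatAt z (Φ + s • (Φ * b2 * (c2 * Φ))) := by
    rw [hΨ]
    exact (hΦR.sub ((hΦR.mul hRc).mul r3)).add ((hΦR.mul hB2).mul r1)
  have total : c1 * Φ * b1 + d11 + s • ((c1 * Φ * b2 + d12) * (c2 * Φ * b1 + d21)) =
      d11 + c1 * (Φ + s • (Φ * b2 * (c2 * Φ))) * b1 + c1 * (s • (Φ * b2)) * d21 +
        d12 * (s • (c2 * Φ)) * b1 + s • (d12 * d21) := by
    simp only [Matrix.add_mul, Matrix.mul_add, Matrix.smul_mul, Matrix.mul_smul, smul_add,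
      Matrix.mul_assoc]
    abel
  rw [total]
  exact ((((hD11.add ((hC1.mul r4).mul hB1)).add ((hC1.mul r2).mul hD21)).add
    ((hD12.mul r1).mul hB1))).add ((hD12.mul hD21).smul h1)

/-- The entries of the resolvent vanish at infinity: a bound `k ≥ 0` for the degrees improves by
one through `z Φ = 1 + A Φ`. -/
lemma degLE_inv_pencil {n : ℕ} (A : Matrix (Fin n) (Fin n) ℝ) (i j : Fin n) :
    DegLE ((pencil A)⁻¹ i j) (-1) := by
  have hX : (RatFunc.X : RatFunc ℝ) ≠ 0 := RatFunc.X_ne_zero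
  have h1 := Matrix.mul_nonsing_inv _ (isUnit_det_pencil A)
  have key : ∀ i j, (pencil A)⁻¹ i j = RatFunc.X⁻¹ *
      ((1 : Matrix (Fin n) (Fin n) (RatFunc ℝ)) i j +
        ∑ l, RatFunc.C (A i l) * (pencil A)⁻¹ l j) := by
    intro i j
    have h2 := congrFun (congrFun h1 i) j
    have h3 : ∀ Ψ : Matrix (Fin n) (Fin n) (RatFunc ℝ), (pencil A * Ψ) i j =
        RatFunc.X * Ψ i j - ∑ l, RatFunc.C (A i l) * Ψ l j := fun Ψ => by
      rw [pencil, Matrix.sub_mul, Matrix.smul_mul, Matrix.one_mul, Matrix.sub_apply, Matrix.smul_apply,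
        smul_eq_mul, Matrix.mul_apply]
      rfl
    rw [← h2, h3, sub_add_cancel, inv_mul_cancel_left₀ hX]
  have step : ∀ k : ℕ, (∀ i j, DegLE ((pencil A)⁻¹ i j) k) →
      ∀ i j, DegLE ((pencil A)⁻¹ i j) (k - 1) := by
    intro k hk i j
    rw [key i j, show (k : ℤ) - 1 = -1 + k by ring]
    refine DegLE.mul (Or.inr (by simp)) (DegLE.add ?_ (DegLE.sum _ fun l _ => ?_))
    · rw [Matrix.one_apply]
      split_ifs
      · exact degLE_one.mono (by positivity)
      · exact Or.inl rfl
    · simpa using (degLE_C (A i l)).mul (hk l j)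
  have all : ∀ k : ℕ, (∀ i j, DegLE ((pencil A)⁻¹ i j) k) →
      ∀ i j, DegLE ((pencil A)⁻¹ i j) (-1) := by
    intro k
    induction k with
    | zero => intro h; simpa using step 0 h
    | succ k ih => intro h; exact ih (by simpa using step (k + 1) h)
  refine all (∑ i, ∑ j, ((pencil A)⁻¹ i j).intDegree.toNat) (fun i j => Or.inr ?_) i j
  refine (Int.self_le_toNat _).trans ?_
  have h4 : ((pencil A)⁻¹ i j).intDegree.toNat ≤
      ∑ j, ((pencil A)⁻¹ i j).intDegree.toNat :=
    Finset.single_le_sum (f := fun j => ((pencil A)⁻¹ i j).intDegree.toNat)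
      (fun _ _ => Nat.zero_le _) (Finset.mem_univ j)
  have h5 : ∑ j, ((pencil A)⁻¹ i j).intDegree.toNat ≤
      ∑ i, ∑ j, ((pencil A)⁻¹ i j).intDegree.toNat :=
    Finset.single_le_sum (f := fun i => ∑ j, ((pencil A)⁻¹ i j).intDegree.toNat)
      (fun _ _ => Nat.zero_le _) (Finset.mem_univ i)
  exact_mod_cast h4.trans h5

lemma Plant.degLE_Gyu {n nv nz : ℕ} (P : Plant n nv nz) : DegLE P.Gyu (-1) := by
  rw [Plant.Gyu, transfer_def]
  simp only [Matrix.add_apply, Matrix.mul_apply, Matrix.map_apply, Matrix.zero_apply, map_zero,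
    add_zero]
  refine DegLE.sum _ fun j _ => ?_
  rw [show (-1 : ℤ) = -1 + 0 by ring]
  refine DegLE.mul (DegLE.sum _ fun l _ => ?_) (degLE_C _)
  rw [show (-1 : ℤ) = 0 + -1 by ring]
  exact (degLE_C _).mul (degLE_inv_pencil _ _ _)

/-! ### Gram functions on the circle -/

lemma aeval_conj (f : Polynomial ℝ) (z : ℂ) :
    Polynomial.aeval ((starRingEnd ℂ) z) f = (starRingEnd ℂ) (Polynomial.aeval z f) :=
  Polynomial.aeval_algHom_apply Complex.conjAe.toAlgHom z f

lemma regAt_eval₂_inv {z : ℂ} (hz : z ≠ 0) (f : Polynomial ℝ) :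
    RegAt z (f.eval₂ RatFunc.C (RatFunc.X : RatFunc ℝ)⁻¹) ∧
      evalAt (f.eval₂ RatFunc.C (RatFunc.X : RatFunc ℝ)⁻¹) z = Polynomial.aeval z⁻¹ f := by
  have hX : RegAt z (RatFunc.X : RatFunc ℝ)⁻¹ ∧ evalAt (RatFunc.X : RatFunc ℝ)⁻¹ z = z⁻¹ := by
    have h := RegAt.inv (p := RatFunc.X) (z := z) (by rw [(regAt_X z).2]; exact hz)
    rw [(regAt_X z).2] at h
    exact h
  induction f using Polynomial.induction_on' with
  | add p q hp hq =>
    rw [Polynomial.eval₂_add, map_add, ← hp.2, ← hq.2]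
    exact hp.1.add hq.1
  | monomial k a =>
    rw [Polynomial.eval₂_monomial, Polynomial.aeval_monomial]
    have hpow : ∀ k : ℕ, RegAt z ((RatFunc.X : RatFunc ℝ)⁻¹ ^ k) ∧
        evalAt ((RatFunc.X : RatFunc ℝ)⁻¹ ^ k) z = z⁻¹ ^ k := by
      intro k
      induction k with
      | zero => simpa using regAt_one z
      | succ k ih =>
        rw [pow_succ, pow_succ]
        have h := ih.1.mul hX.1
        rwa [ih.2, hX.2] at h
    have h := (regAt_C z a).1.mul (hpow k).1
    rw [(regAt_C z a).2, (hpow k).2] at h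
    exact h

lemma onCirc_paraConj {p : RatFunc ℝ} {ω : ℝ} (hp : RegAt (pt ω) p) :
    RegAt (pt ω) (paraConj p) ∧ onCirc (paraConj p) ω = (starRingEnd ℂ) (onCirc p ω) := by
  have hc : ∀ f : Polynomial ℝ, Polynomial.aeval (pt ω)⁻¹ f =
      (starRingEnd ℂ) (Polynomial.aeval (pt ω) f) := fun f => by
    rw [← pt_neg_eq_inv, pt_neg, aeval_conj]
  have hn := regAt_eval₂_inv (pt_ne_zero ω) p.num
  have hd := regAt_eval₂_inv (pt_ne_zero ω) p.denom
  have hd0 : evalAt (p.denom.eval₂ RatFunc.C (RatFunc.X : RatFunc ℝ)⁻¹) (pt ω) ≠ 0 := by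
    rw [hd.2, hc]
    exact fun h => hp ((map_eq_zero _).1 h)
  have h := hn.1.mul (RegAt.inv hd0).1
  rw [(RegAt.inv hd0).2, hn.2, hd.2, hc, hc, ← div_eq_mul_inv, ← div_eq_mul_inv] at h
  refine ⟨h.1, h.2.trans ?_⟩
  rw [onCirc, evalAt_def, map_div₀]

variable {n nv nz : ℕ} (P : Plant n nv nz)

/-- `G_zu^* G_zu` on the circle, as a real number. -/
def Plant.zuSq (ω : ℝ) : ℝ := ∑ i, ‖onCirc (P.Gzu i 0) ω‖ ^ 2

/-- `G_yv G_yv^*` on the circle, as a real number. -/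
def Plant.yvSq (ω : ℝ) : ℝ := ∑ j, ‖onCirc (P.Gyv 0 j) ω‖ ^ 2

lemma Plant.onCirc_gramZu : ∀ᵐ ω ∂circMeasure, onCirc P.gramZu ω = P.zuSq ω := by
  have h := ae_all_iff.2 fun i => ae_regAt (P.Gzu i 0)
  filter_upwards [h] with ω hω
  simp only [Plant.gramZu, Matrix.mul_apply, starTransfer, Matrix.transpose_apply,
    Matrix.map_apply, Plant.zuSq]
  rw [onCirc, (RegAt.sum _ fun i _ => ((onCirc_paraConj (hω i)).1.mul (hω i)).1).2]
  push_cast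
  refine Finset.sum_congr rfl fun i _ => ?_
  rw [((onCirc_paraConj (hω i)).1.mul (hω i)).2]
  have := (onCirc_paraConj (hω i)).2
  rw [onCirc] at this
  rw [this]
  exact Complex.conj_mul' _

lemma Plant.onCirc_gramYv : ∀ᵐ ω ∂circMeasure, onCirc P.gramYv ω = P.yvSq ω := by
  have h := ae_all_iff.2 fun i => ae_regAt (P.Gyv 0 i)
  filter_upwards [h] with ω hω
  simp only [Plant.gramYv, Matrix.mul_apply, starTransfer, Matrix.transpose_apply,
    Matrix.map_apply, Plant.yvSq]
  rw [onCirc, (RegAt.sum _ fun i _ => ((hω i).mul (onCirc_paraConj (hω i)).1).1).2]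
  push_cast
  refine Finset.sum_congr rfl fun i _ => ?_
  rw [((hω i).mul (onCirc_paraConj (hω i)).1).2]
  have := (onCirc_paraConj (hω i)).2
  rw [onCirc] at this
  rw [this]
  exact Complex.mul_conj' _

lemma exists_le_norm_onCirc {p : RatFunc ℝ} (h0 : NoZerosOnCircle p) (h1 : NoPolesOnCircle p) :
    ∃ b : ℝ, 0 < b ∧ ∀ ω, b ≤ ‖onCirc p ω‖ := by
  have hne : ∀ ω, onCirc p ω ≠ 0 := fun ω =>
    div_ne_zero (h0 _ (norm_pt ω)) (h1 _ (norm_pt ω))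
  have hinv : NoPolesOnCircle p⁻¹ := fun z hz => by
    have h := hne z.arg
    rw [onCirc, pt_arg hz] at h
    exact (RegAt.inv h).1
  obtain ⟨B, hB, hBω⟩ := exists_norm_onCirc_le hinv
  refine ⟨B⁻¹, inv_pos.2 hB, fun ω => ?_⟩
  have h := hBω ω
  rw [onCirc, (RegAt.inv (hne ω)).2, norm_inv] at h
  exact inv_le_of_inv_le₀ (norm_pos_iff.2 (hne ω)) h

lemma exists_bounds_of_gram {q : RatFunc ℝ} {x : ℝ → ℝ} (hx : ∀ ω, 0 ≤ x ω)
    (h : ∀ᵐ ω ∂circMeasure, onCirc q ω = x ω) (h0 : NoZerosOnCircle q) (h1 : NoPolesOnCircle q) :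
    ∃ b B : ℝ, 0 < b ∧ 0 < B ∧ ∀ᵐ ω ∂circMeasure, b ≤ x ω ∧ x ω ≤ B := by
  obtain ⟨b, hb, hb'⟩ := exists_le_norm_onCirc h0 h1
  obtain ⟨B, hB, hB'⟩ := exists_norm_onCirc_le h1
  refine ⟨b, B, hb, hB, ?_⟩
  filter_upwards [h] with ω hω
  have e : ‖onCirc q ω‖ = x ω := by
    rw [hω, Complex.norm_real, Real.norm_eq_abs, abs_of_nonneg (hx ω)]
  rw [← e]
  exact ⟨hb' ω, hB' ω⟩

lemma Plant.zuSq_nonneg (ω : ℝ) : 0 ≤ P.zuSq ω := Finset.sum_nonneg fun _ _ => sq_nonneg _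

lemma Plant.yvSq_nonneg (ω : ℝ) : 0 ≤ P.yvSq ω := Finset.sum_nonneg fun _ _ => sq_nonneg _

lemma ne_zero_of_noZerosOnCircle {q : RatFunc ℝ} (h : NoZerosOnCircle q) : q ≠ 0 := by
  rintro rfl
  exact h 1 (by simp) (by simp)

lemma hasOuterExtension_log_of_gram {q : RatFunc ℝ} {x : ℝ → ℝ} (hx : ∀ ω, 0 ≤ x ω)
    (h : ∀ᵐ ω ∂circMeasure, onCirc q ω = x ω) (h0 : q ≠ 0) :
    HasOuterExtension fun ω => Real.log (x ω) := by
  refine (hasOuterExtension_log_onCirc h0).congr ?_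
  filter_upwards [h] with ω hω
  rw [hω, Complex.norm_real, Real.norm_eq_abs, abs_of_nonneg (hx ω)]

lemma measurable_zuSq : Measurable P.zuSq :=
  Finset.measurable_sum _ fun i _ => ((measurable_onCirc (P.Gzu i 0)).norm.pow_const 2)

lemma measurable_yvSq : Measurable P.yvSq :=
  Finset.measurable_sum _ fun i _ => ((measurable_onCirc (P.Gyv 0 i)).norm.pow_const 2)

/-! ### The nuclear norm of matrices of rank one -/

/-- If `Xᴴ X` is a multiple of a projection of rank one, then all singular values but one vanish,
and the nuclear norm is the Frobenius norm. -/
lemma nuclearNorm_of_sq {m k : ℕ} {X : Matrix (Fin m) (Fin k) ℂ} {t : ℝ} (ht : 0 ≤ t)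
    (htr : (X.conjTranspose * X).trace = t)
    (hsq : X.conjTranspose * X * (X.conjTranspose * X) = (t : ℂ) • (X.conjTranspose * X)) :
    nuclearNorm X = Real.sqrt t := by
  set hA := Matrix.isHermitian_conjTranspose_mul_self X
  have hev : ∀ i, hA.eigenvalues i = 0 ∨ hA.eigenvalues i = t := by
    intro i
    have h1 := hA.mulVec_eigenvectorBasis i
    set v : Fin k → ℂ := ⇑(hA.eigenvectorBasis i) with hv
    have hv0 : v ≠ 0 := by
      intro h
      have := hA.eigenvectorBasis.toBasis.ne_zero i
      apply this
      rw [OrthonormalBasis.coe_toBasis]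
      ext j
      exact congrFun h j
    have h2 : (X.conjTranspose * X * (X.conjTranspose * X)).mulVec v =
        (hA.eigenvalues i * hA.eigenvalues i) • v := by
      rw [← Matrix.mulVec_mulVec, h1, Matrix.mulVec_smul, h1, smul_smul]
    rw [hsq, Matrix.smul_mulVec, h1] at h2
    have h3 : (hA.eigenvalues i * hA.eigenvalues i - t * hA.eigenvalues i) • v = 0 := by
      rw [sub_smul, ← h2, mul_smul]
      ext j
      simp
    rcases smul_eq_zero.1 h3 with h | h
    · rcases eq_or_ne (hA.eigenvalues i) 0 with h0 | h0
      · exact Or.inl h0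
      · right
        have : hA.eigenvalues i * (hA.eigenvalues i - t) = 0 := by linarith
        linarith [(mul_eq_zero.1 this).resolve_left h0]
    · exact absurd h hv0
  have hsum : ∑ i, hA.eigenvalues i = t := by
    have h : ((∑ i, hA.eigenvalues i : ℝ) : ℂ) = t := by
      rw [← htr, hA.trace_eq_sum_eigenvalues]
      push_cast
      rfl
    exact Complex.ofReal_injective h
  have hterm : ∀ i, Real.sqrt (hA.eigenvalues i) * Real.sqrt t = hA.eigenvalues i := by
    intro i
    rcases hev i with h | h
    · rw [h]; simp
    · rw [h, Real.mul_self_sqrt ht]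
  have h : nuclearNorm X * Real.sqrt t = t := by
    rw [nuclearNorm, Finset.sum_mul, Finset.sum_congr rfl fun i _ => hterm i, hsum]
  rcases eq_or_lt_of_le ht with h0 | h0
  · have : ∀ i, hA.eigenvalues i = 0 := fun i => (hev i).elim id fun h => by rw [h, ← h0]
    rw [← h0, Real.sqrt_zero, nuclearNorm]
    exact Finset.sum_eq_zero fun i _ => by rw [this i, Real.sqrt_zero]
  · have hs := Real.sqrt_pos.2 h0
    refine mul_right_cancel₀ hs.ne' ?_
    rw [h, Real.mul_self_sqrt ht]

lemma nuclearNorm_rankOne {m k : ℕ} (c : ℂ) (x : Fin m → ℂ) (y : Fin k → ℂ) :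
    nuclearNorm (Matrix.of fun i j => c * (x i * y j)) =
      ‖c‖ * (Real.sqrt (∑ i, ‖x i‖ ^ 2) * Real.sqrt (∑ j, ‖y j‖ ^ 2)) := by
  have hX : ∀ a b, ((Matrix.of fun i j => c * (x i * y j)).conjTranspose *
      (Matrix.of fun i j => c * (x i * y j))) a b =
      ((‖c‖ ^ 2 * ∑ i, ‖x i‖ ^ 2 : ℝ) : ℂ) * ((starRingEnd ℂ) (y a) * y b) := by
    intro a b
    simp only [Matrix.mul_apply, Matrix.conjTranspose_apply, Matrix.of_apply]
    push_cast
    rw [Finset.mul_sum, Finset.sum_mul]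
    refine Finset.sum_congr rfl fun i _ => ?_
    rw [← Complex.conj_mul' c, ← Complex.conj_mul' (x i)]
    simp only [RCLike.star_def, map_mul]
    ring
  rw [nuclearNorm_of_sq (t := ‖c‖ ^ 2 * (∑ i, ‖x i‖ ^ 2) * ∑ j, ‖y j‖ ^ 2)
    (by positivity)]
  · rw [Real.sqrt_mul (by positivity), Real.sqrt_mul (by positivity), Real.sqrt_sq (norm_nonneg _),
      mul_assoc]
  · simp only [Matrix.trace, Matrix.diag_apply, hX]
    rw [← Finset.mul_sum]
    push_cast
    congr 1
    exact Finset.sum_congr rfl fun j _ => Complex.conj_mul' _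
  · ext a b
    rw [Matrix.mul_apply, Matrix.smul_apply, hX, smul_eq_mul]
    simp only [hX]
    push_cast
    have : ∀ l, (‖c‖ : ℂ) ^ 2 * (∑ i, (‖x i‖ : ℂ) ^ 2) * ((starRingEnd ℂ) (y a) * y l) *
        ((‖c‖ : ℂ) ^ 2 * (∑ i, (‖x i‖ : ℂ) ^ 2) * ((starRingEnd ℂ) (y l) * y b)) =
        (‖c‖ : ℂ) ^ 2 * (∑ i, (‖x i‖ : ℂ) ^ 2) *
          ((‖c‖ : ℂ) ^ 2 * (∑ i, (‖x i‖ : ℂ) ^ 2) * ((starRingEnd ℂ) (y a) * y b)) *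
          (‖y l‖ : ℂ) ^ 2 := fun l => by
      rw [← Complex.conj_mul' (y l)]; ring
    simp only [this]
    rw [← Finset.mul_sum]
    ring

/-! ### Norms of functions on the circle -/

lemma normTwoSq_congr {m k : ℕ} {X Y : ℝ → Matrix (Fin m) (Fin k) ℂ}
    (h : X =ᵐ[circMeasure] Y) : normTwoSq X = normTwoSq Y := by
  refine lintegral_congr_ae ?_
  filter_upwards [h] with ω hω
  rw [hω]

lemma enorm_sq (x : ℂ) : ‖x‖ₑ ^ 2 = ENNReal.ofReal (‖x‖ ^ 2) := by
  rw [← ofReal_norm x, ENNReal.ofReal_pow (norm_nonneg x)]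

lemma normTwoSq_scal (f : ℝ → ℂ) :
    normTwoSq (scal f) = ∫⁻ ω, ENNReal.ofReal (‖f ω‖ ^ 2) ∂circMeasure := by
  simp only [normTwoSq, scal, Matrix.of_apply, Fin.sum_univ_one, enorm_sq]

lemma onCirc_mul {p q : RatFunc ℝ} {ω : ℝ} (hp : RegAt (pt ω) p) (hq : RegAt (pt ω) q) :
    onCirc (p * q) ω = onCirc p ω * onCirc q ω := (hp.mul hq).2

lemma onCirc_add {p q : RatFunc ℝ} {ω : ℝ} (hp : RegAt (pt ω) p) (hq : RegAt (pt ω) q) :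
    onCirc (p + q) ω = onCirc p ω + onCirc q ω := (hp.add hq).2

lemma onCirc_mul_ae (p q : RatFunc ℝ) :
    ∀ᵐ ω ∂circMeasure, onCirc (p * q) ω = onCirc p ω * onCirc q ω := by
  filter_upwards [ae_regAt p, ae_regAt q] with ω hp hq using onCirc_mul hp hq

lemma matOnCirc_smul_mul_ae {m k : ℕ} (p : RatFunc ℝ) (Z : Matrix (Fin m) (Fin 1) (RatFunc ℝ))
    (Y : Matrix (Fin 1) (Fin k) (RatFunc ℝ)) :
    ∀ᵐ ω ∂circMeasure, matOnCirc (p • (Z * Y)) ω =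
      Matrix.of fun i j => onCirc p ω * (onCirc (Z i 0) ω * onCirc (Y 0 j) ω) := by
  filter_upwards [ae_regAt p, ae_all_iff.2 fun i => ae_regAt (Z i 0),
    ae_all_iff.2 fun j => ae_regAt (Y 0 j)] with ω h1 h2 h3
  ext i j
  simp only [matOnCirc, Matrix.map_apply, Matrix.smul_apply, smul_eq_mul, Matrix.mul_apply,
    Fin.sum_univ_one, Matrix.of_apply]
  rw [onCirc_mul h1 ((h2 i).mul (h3 j)).1, onCirc_mul (h2 i) (h3 j)]

lemma matOnCirc_add_smul_mul_ae {m k : ℕ} (X : Matrix (Fin m) (Fin k) (RatFunc ℝ))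
    (p : RatFunc ℝ) (Z : Matrix (Fin m) (Fin 1) (RatFunc ℝ))
    (Y : Matrix (Fin 1) (Fin k) (RatFunc ℝ)) :
    ∀ᵐ ω ∂circMeasure, matOnCirc (X + p • (Z * Y)) ω =
      matOnCirc X ω + onCirc p ω • (matOnCirc Z ω * matOnCirc Y ω) := by
  filter_upwards [ae_regAt p, ae_all_iff.2 fun i => ae_regAt (Z i 0),
    ae_all_iff.2 fun j => ae_regAt (Y 0 j), ae_all_iff.2 fun i => ae_all_iff.2 fun j =>
      ae_regAt (X i j)] with ω h1 h2 h3 h4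
  ext i j
  simp only [matOnCirc, Matrix.map_apply, Matrix.add_apply, Matrix.smul_apply, smul_eq_mul,
    Matrix.mul_apply, Fin.sum_univ_one]
  rw [onCirc_add (h4 i j) (h1.mul ((h2 i).mul (h3 j)).1).1, onCirc_mul h1 ((h2 i).mul (h3 j)).1,
    onCirc_mul (h2 i) (h3 j)]

variable {n nv nz : ℕ} (P : Plant n nv nz)

lemma normOne_smul_gram (p : RatFunc ℝ) :
    normOne (matOnCirc (p • (P.Gzu * P.Gyv))) =
      ∫⁻ ω, ENNReal.ofReal (‖onCirc p ω‖ * (Real.sqrt (P.zuSq ω) * Real.sqrt (P.yvSq ω)))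
        ∂circMeasure := by
  refine lintegral_congr_ae ?_
  filter_upwards [matOnCirc_smul_mul_ae p P.Gzu P.Gyv] with ω hω
  rw [hω, nuclearNorm_rankOne]
  rfl

lemma normTwoSq_smul_Gzu (c : ℝ → ℂ) :
    normTwoSq (fun ω => c ω • matOnCirc P.Gzu ω) =
      ∫⁻ ω, ENNReal.ofReal (‖c ω‖ ^ 2 * P.zuSq ω) ∂circMeasure := by
  refine lintegral_congr fun ω => ?_
  simp only [Plant.zuSq, Finset.mul_sum, Matrix.smul_apply, smul_eq_mul, matOnCirc,
    Matrix.map_apply, Fin.sum_univ_one, enorm_sq, norm_mul, mul_pow]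
  rw [ENNReal.ofReal_sum_of_nonneg fun i _ => by positivity]

lemma normTwoSq_smul_Gyv (c : ℝ → ℂ) :
    normTwoSq (fun ω => c ω • matOnCirc P.Gyv ω) =
      ∫⁻ ω, ENNReal.ofReal (‖c ω‖ ^ 2 * P.yvSq ω) ∂circMeasure := by
  refine lintegral_congr fun ω => ?_
  simp only [Plant.yvSq, Finset.mul_sum, Matrix.smul_apply, smul_eq_mul, matOnCirc,
    Matrix.map_apply, Fin.sum_univ_one, enorm_sq, norm_mul, mul_pow]
  rw [ENNReal.ofReal_sum_of_nonneg fun i _ => by positivity]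

/-! ### The problem in the Youla parameter -/

/-- The standing assumptions on the plant, the channel filter and the coprime factorization. -/
structure Standing (H M N U V : RatFunc ℝ) : Prop where
  stab : P.IsStabilizable
  det : P.IsDetectable
  Gyu_ne : P.Gyu ≠ 0
  hM : MemRH M
  hN : MemRH N
  hU : MemRH U
  hV : MemRH V
  M_ne : M ≠ 0
  fact : P.Gyu = N * M⁻¹
  bezout : V * M + U * N = 1
  hH : MemRH H
  H_zeros : NoZerosOnCircle H
  zu_poles : NoPolesOnCircle P.gramZu
  zu_zeros : NoZerosOnCircle P.gramZu
  yv_poles : NoPolesOnCircle P.gramYv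
  yv_zeros : NoZerosOnCircle P.gramYv

variable {P} {H M N U V : RatFunc ℝ}

namespace Standing

variable (hs : Standing P H M N U V)

include hs

lemma N_ne : N ≠ 0 := by
  rintro rfl
  exact hs.Gyu_ne (by rw [hs.fact, zero_mul])

lemma Gyu_mul : P.Gyu * M = N := by
  rw [hs.fact, inv_mul_cancel_right₀ hs.M_ne]

lemma num_mem {Q : RatFunc ℝ} (hQ : MemRH Q) : MemRH (M * Q - U) :=
  mem_ringRH.1 (ringRH.sub_mem (ringRH.mul_mem hs.hM hQ) hs.hU)

lemma den_mem {Q : RatFunc ℝ} (hQ : MemRH Q) : MemRH (N * Q + V) :=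
  mem_ringRH.1 (ringRH.add_mem (ringRH.mul_mem hs.hN hQ) hs.hV)

lemma bezout_youla (Q : RatFunc ℝ) : M * (N * Q + V) - N * (M * Q - U) = 1 := by
  linear_combination hs.bezout

/-- `N` vanishes at infinity, so `N Q + V` has a nonzero value there. -/
lemma den_intDegree {Q : RatFunc ℝ} (hQ : MemRH Q) :
    N * Q + V ≠ 0 ∧ 0 ≤ (N * Q + V).intDegree := by
  have hN : DegLE N (-1) := by
    rw [← hs.Gyu_mul]
    simpa using P.degLE_Gyu.mul (isProper_iff.1 hs.hM.1)
  have h1 : DegLE (N * (M * Q - U)) (-1) := by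
    simpa using hN.mul (isProper_iff.1 (hs.num_mem hQ).1)
  have h2 := hs.bezout_youla Q
  have hne : M * (N * Q + V) ≠ 0 := by
    intro h0
    rw [h0, zero_sub] at h2
    have : DegLE (1 : RatFunc ℝ) (-1) := h2 ▸ h1.neg
    rcases this with h | h
    · exact one_ne_zero h
    · simp at h
  have hb := right_ne_zero_of_mul hne
  refine ⟨hb, ?_⟩
  by_contra hlt
  have h3 : DegLE (M * (N * Q + V)) (-1) := by
    have : DegLE (N * Q + V) (-1) := Or.inr (by omega)
    simpa using (isProper_iff.1 hs.hM.1).mul this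
  have h4 : DegLE (1 : RatFunc ℝ) (-1) := by
    rw [← h2, sub_eq_add_neg]
    exact h3.add h1.neg
  rcases h4 with h | h
  · exact one_ne_zero h
  · simp at h

lemma isProper_youla {Q : RatFunc ℝ} (hQ : MemRH Q) : IsProper (youla M N U V Q) := by
  obtain ⟨h1, h2⟩ := hs.den_intDegree hQ
  rw [isProper_iff, youla, div_eq_mul_inv]
  have h3 : DegLE (N * Q + V)⁻¹ 0 := Or.inr (by rw [RatFunc.intDegree_inv]; omega)
  simpa using (isProper_iff.1 (hs.num_mem hQ).1).mul h3

lemma effort_eq (Q : RatFunc ℝ) :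
    effort H M N V Q =
      ∫⁻ ω, ENNReal.ofReal (‖onCirc (H * N * (M * Q - U)) ω‖ ^ 2) ∂circMeasure := by
  have e : Efun H M N * Q + Ffun H M V = H * N * (M * Q - U) := by
    unfold Efun Ffun
    linear_combination H * hs.bezout
  rw [effort, normTwoSq_scal, e]

/-- `φ(Q)` in terms of the coprime factors `M Q - U` and `N Q + V` of the controller. -/
lemma phi_eq (σ : ℝ) (Q : RatFunc ℝ) :
    phi P H M N V σ Q =
      normTwoSq (fun ω => matOnCirc P.Gzv ω +
        onCirc (M * (M * Q - U)) ω • (matOnCirc P.Gzu ω * matOnCirc P.Gyv ω)) +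
      (∫⁻ ω, ENNReal.ofReal (‖onCirc (H * M ^ 2 * (M * Q - U) * (N * Q + V)) ω‖ *
        (Real.sqrt (P.zuSq ω) * Real.sqrt (P.yvSq ω))) ∂circMeasure) ^ 2 /
      (ENNReal.ofReal (σ ^ 2) - effort H M N V Q) := by
  have hN := hs.N_ne
  have e1 : Lmat P M N + Q • Amat P M + Bmat P M N V =
      P.Gzv + (M * (M * Q - U)) • (P.Gzu * P.Gyv) := by
    unfold Lmat Amat Bmat
    have : M * (M * Q - U) = -(M * N⁻¹) + Q * M ^ 2 + M ^ 2 * N⁻¹ * V := by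
      field_simp
      linear_combination (-M) * hs.bezout
    rw [this, add_smul, add_smul, neg_smul, smul_smul]
    abel
  have e2 : (Efun H M N * Q + Ffun H M V) • (Q • Amat P M + Bmat P M N V) =
      (H * M ^ 2 * (M * Q - U) * (N * Q + V)) • (P.Gzu * P.Gyv) := by
    have e : Efun H M N * Q + Ffun H M V = H * N * (M * Q - U) := by
      unfold Efun Ffun
      linear_combination H * hs.bezout
    rw [e]
    unfold Amat Bmat
    rw [smul_smul, ← add_smul, smul_smul]
    congr 1
    field_simp
  rw [phi, e1, e2, normOne_smul_gram,
    normTwoSq_congr (matOnCirc_add_smul_mul_ae P.Gzv _ P.Gzu P.Gyv)]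

end Standing

/-! ### The closed loop in terms of the Youla parameter -/

/-- The loop closed with the controller `K = (M Q - U) / (N Q + V)`: pointwise values of the
sensitivity and of the other rational closed loop functions. -/
lemma Standing.loop_ae (hs : Standing P H M N U V) {Q : RatFunc ℝ} (hQ : MemRH Q)
    {C D : ℝ → ℂ} (hCD : ∀ᵐ ω ∂circMeasure, D ω * C ω = onCirc (youla M N U V Q) ω) :
    ∀ᵐ ω ∂circMeasure,
      (1 - D ω * C ω * onCirc P.Gyu ω)⁻¹ = onCirc (M * (N * Q + V)) ω ∧
      onCirc (M * (N * Q + V)) ω ≠ 0 ∧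
      D ω * C ω * onCirc (M * (N * Q + V)) ω = onCirc (M * (M * Q - U)) ω ∧
      onCirc P.Gyu ω * onCirc (M * (N * Q + V)) ω = onCirc (N * (N * Q + V)) ω ∧
      D ω * C ω * onCirc (N * (N * Q + V)) ω = onCirc (N * (M * Q - U)) ω := by
  have hb := (hs.den_intDegree hQ).1
  have hyo : youla M N U V Q * (N * Q + V) = M * Q - U := div_mul_cancel₀ _ hb
  have h3 := congrArg onCirc hyo
  have h4 := congrArg onCirc hs.Gyu_mul
  have h5 := congrArg onCirc (eq_add_of_sub_eq (hs.bezout_youla Q))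
  filter_upwards [hCD, onCirc_mul_ae (youla M N U V Q) (N * Q + V), onCirc_mul_ae P.Gyu M,
    ae_onCirc_ne_zero hb, ae_onCirc_ne_zero hs.M_ne] with ω h6 h7 h8 hb0 hm0
  have ra := (hs.num_mem hQ).regAt ω
  have rb := (hs.den_mem hQ).regAt ω
  have rM := hs.hM.regAt ω
  have rN := hs.hN.regAt ω
  replace h3 := congrFun h3 ω
  replace h4 := congrFun h4 ω
  replace h5 := congrFun h5 ω
  rw [h7] at h3
  rw [h8] at h4
  have h1 : onCirc (1 : RatFunc ℝ) ω = 1 := (regAt_one (pt ω)).2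
  rw [onCirc_add (regAt_one _).1 (rN.mul ra).1, h1, onCirc_mul rM rb, onCirc_mul rN ra] at h5
  rw [onCirc_mul rM rb, onCirc_mul rM ra, onCirc_mul rN rb, onCirc_mul rN ra, h6]
  refine ⟨?_, mul_ne_zero hm0 hb0, ?_, ?_, ?_⟩
  · refine (eq_inv_of_mul_eq_one_right ?_).symm
    rw [← h4] at h5
    rw [← h3] at h5
    linear_combination h5
  · rw [← h3]; ring
  · rw [← h4]; ring
  · rw [← h3]; ring

section Values

variable (hs : Standing P H M N U V) {Q : RatFunc ℝ} (hQ : MemRH Q) {C D : ℝ → ℂ}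
  (hCD : ∀ᵐ ω ∂circMeasure, D ω * C ω = onCirc (youla M N U V Q) ω)

include hs hQ hCD

lemma Standing.J_eq :
    J P H C D = normTwoSq (fun ω => matOnCirc P.Gzv ω +
        onCirc (M * (M * Q - U)) ω • (matOnCirc P.Gzu ω * matOnCirc P.Gyv ω)) +
      ∫⁻ ω, ENNReal.ofReal (‖D ω * onCirc H ω * onCirc (M * (N * Q + V)) ω‖ ^ 2 * P.zuSq ω)
        ∂circMeasure := by
  have h := hs.loop_ae hQ hCD
  rw [J, ← normTwoSq_smul_Gzu]
  congr 1
  · refine normTwoSq_congr ?_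
    filter_upwards [h] with ω ⟨h1, _, h2, _⟩
    rw [div_eq_mul_inv, h1, h2]
  · refine normTwoSq_congr ?_
    filter_upwards [h] with ω ⟨h1, _⟩
    rw [div_eq_mul_inv, h1]

lemma Standing.snrConstraint_iff (σ : ℝ) :
    SNRConstraint P H σ C D ↔
      ∫⁻ ω, ENNReal.ofReal (‖C ω * onCirc (M * (N * Q + V)) ω‖ ^ 2 * P.yvSq ω) ∂circMeasure +
        effort H M N V Q ≤ ENNReal.ofReal (σ ^ 2) := by
  have h := hs.loop_ae hQ hCD
  rw [SNRConstraint, hs.effort_eq, ← normTwoSq_scal, ← normTwoSq_smul_Gyv]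
  have e1 : normTwoSq (fun ω => (C ω / (1 - D ω * C ω * onCirc P.Gyu ω)) • matOnCirc P.Gyv ω) =
      normTwoSq (fun ω => (C ω * onCirc (M * (N * Q + V)) ω) • matOnCirc P.Gyv ω) := by
    refine normTwoSq_congr ?_
    filter_upwards [h] with ω ⟨h1, _⟩
    rw [div_eq_mul_inv, h1]
  have e2 : normTwoSq (scal fun ω => D ω * C ω * onCirc H ω * onCirc P.Gyu ω /
      (1 - D ω * C ω * onCirc P.Gyu ω)) =
      normTwoSq (scal fun ω => onCirc (H * N * (M * Q - U)) ω) := by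
    refine normTwoSq_congr ?_
    filter_upwards [h] with ω ⟨h1, _, _, h3, h4⟩
    have : D ω * C ω * onCirc H ω * onCirc P.Gyu ω / (1 - D ω * C ω * onCirc P.Gyu ω) =
        onCirc (H * N * (M * Q - U)) ω := by
      rw [mul_assoc H, onCirc_mul (hs.hH.regAt ω)
        ((hs.hN.regAt ω).mul ((hs.num_mem hQ).regAt ω)).1, ← h4, ← h3, ← h1]
      ring
    simp only [scal, this]
  rw [e1, e2]

/-- The product of the two integrands in the Cauchy–Schwarz inequality. -/
lemma Standing.mul_integrands :
    ∀ᵐ ω ∂circMeasure,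
      (‖D ω * onCirc H ω * onCirc (M * (N * Q + V)) ω‖ * Real.sqrt (P.zuSq ω)) *
        (‖C ω * onCirc (M * (N * Q + V)) ω‖ * Real.sqrt (P.yvSq ω)) =
      ‖onCirc (H * M ^ 2 * (M * Q - U) * (N * Q + V)) ω‖ *
        (Real.sqrt (P.zuSq ω) * Real.sqrt (P.yvSq ω)) := by
  filter_upwards [hs.loop_ae hQ hCD] with ω ⟨_, _, h2, _⟩
  have e : onCirc (H * M ^ 2 * (M * Q - U) * (N * Q + V)) ω =
      D ω * onCirc H ω * onCirc (M * (N * Q + V)) ω * (C ω * onCirc (M * (N * Q + V)) ω) := by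
    have ra := (hs.hM.regAt ω).mul ((hs.num_mem hQ).regAt ω)
    have rb := (hs.hM.regAt ω).mul ((hs.den_mem hQ).regAt ω)
    have : H * M ^ 2 * (M * Q - U) * (N * Q + V) =
        H * ((M * (M * Q - U)) * (M * (N * Q + V))) := by ring
    rw [this, onCirc_mul (hs.hH.regAt ω) (ra.1.mul rb.1).1, onCirc_mul ra.1 rb.1, ← h2]
    ring
  rw [e, norm_mul (_ * _ * _) (C ω * _)]
  ring

end Values

lemma sq_lintegral_mul_le {f g : ℝ → ℝ≥0∞} (hf : AEMeasurable f circMeasure)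
    (hg : AEMeasurable g circMeasure) :
    (∫⁻ ω, f ω * g ω ∂circMeasure) ^ 2 ≤
      (∫⁻ ω, f ω ^ 2 ∂circMeasure) * ∫⁻ ω, g ω ^ 2 ∂circMeasure := by
  have h := ENNReal.lintegral_mul_le_Lp_mul_Lq circMeasure Real.HolderConjugate.two_two hf hg
  simp only [Pi.mul_apply, ENNReal.rpow_two] at h
  calc (∫⁻ ω, f ω * g ω ∂circMeasure) ^ 2
      ≤ ((∫⁻ ω, f ω ^ 2 ∂circMeasure) ^ (1 / 2 : ℝ) *
          (∫⁻ ω, g ω ^ 2 ∂circMeasure) ^ (1 / 2 : ℝ)) ^ 2 := by gcongr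
    _ = _ := by
        rw [mul_pow, ← ENNReal.rpow_natCast, ← ENNReal.rpow_natCast, ← ENNReal.rpow_mul,
          ← ENNReal.rpow_mul]
        norm_num

variable {n nv nz : ℕ} {P : Plant n nv nz} {H M N U V : RatFunc ℝ}

/-! ### The lower bound -/

lemma ae_eq_zero_of_onCirc {p : RatFunc ℝ} (h : ∀ᵐ ω ∂circMeasure, onCirc p ω = 0) : p = 0 := by
  by_contra hp
  obtain ⟨ω, h1, h2⟩ := (h.and (ae_onCirc_ne_zero hp)).exists
  exact h2 h1

/-- The loop cannot be ill-posed: a proper `K` times the strictly proper `G_yu` is not `1`. -/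
lemma one_sub_mul_Gyu_ne_zero {K : RatFunc ℝ} (hK : IsProper K) : 1 - K * P.Gyu ≠ 0 := by
  intro h
  have h1 : DegLE (K * P.Gyu) (-1) := by simpa using (isProper_iff.1 hK).mul P.degLE_Gyu
  rw [← sub_eq_zero.1 h] at h1
  rcases h1 with h1 | h1
  · exact one_ne_zero h1
  · simp at h1

/-- Every internally stabilizing real rational `K = D C` is given by a Youla parameter. -/
lemma Standing.exists_youla (hs : Standing P H M N U V) {K : RatFunc ℝ} (hK : IsProper K)
    {C D : ℝ → ℂ} (hCD : ∀ᵐ ω ∂circMeasure, D ω * C ω = onCirc K ω)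
    (hst : InternallyStable P C D) : ∃ Q, MemRH Q ∧ youla M N U V Q = K := by
  have hT := one_sub_mul_Gyu_ne_zero (P := P) hK
  have hval : ∀ᵐ ω ∂circMeasure, ∀ p : RatFunc ℝ, RegAt (pt ω) p →
      onCirc (p * (1 - K * P.Gyu)⁻¹) ω = onCirc p ω / (1 - D ω * C ω * onCirc P.Gyu ω) := by
    filter_upwards [hCD, ae_regAt K, ae_regAt P.Gyu, ae_onCirc_ne_zero hT] with ω h1 h2 h3 h4 p hp
    have e1 : onCirc (1 - K * P.Gyu)⁻¹ ω = (onCirc (1 - K * P.Gyu) ω)⁻¹ := (RegAt.inv h4).2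
    have e2 : onCirc (1 - K * P.Gyu) ω = onCirc 1 ω - onCirc (K * P.Gyu) ω :=
      ((regAt_one _).1.sub (h2.mul h3).1).2
    have e3 : onCirc (1 : RatFunc ℝ) ω = 1 := (regAt_one _).2
    rw [onCirc_mul hp (RegAt.inv h4).1, e1, e2, e3, onCirc_mul h2 h3, h1, div_eq_mul_inv]
  have hx : MemRH (K * (1 - K * P.Gyu)⁻¹) := by
    refine memRH_of_memHardyTwo ((hst 2 0).congr ?_)
    filter_upwards [hCD, hval, ae_regAt K] with ω h1 h2 h3
    rw [h2 K h3, ← h1]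
    simp [closedLoop]
  have hy : MemRH (K * P.Gyu * (1 - K * P.Gyu)⁻¹) := by
    refine memRH_of_memHardyTwo ((hst 0 0).congr ?_)
    filter_upwards [hCD, hval, ae_regAt K, ae_regAt P.Gyu] with ω h1 h2 h3 h4
    rw [h2 _ (h3.mul h4).1, onCirc_mul h3 h4, ← h1]
    simp [closedLoop]
  have hw : MemRH (P.Gyu * (1 - K * P.Gyu)⁻¹) := by
    refine memRH_of_memHardyTwo ((hst 0 1).congr ?_)
    filter_upwards [hval, ae_regAt P.Gyu] with ω h2 h4
    rw [h2 _ h4]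
    simp [closedLoop]
  rw [← mem_ringRH] at hx hy hw
  have hUr := mem_ringRH.2 hs.hU
  have hVr := mem_ringRH.2 hs.hV
  have hT' : (1 - K * P.Gyu) * (1 - K * P.Gyu)⁻¹ = 1 := mul_inv_cancel₀ hT
  set t := (1 - K * P.Gyu)⁻¹ with ht
  -- `a = M Q - U` and `b = N Q + V` for the parameter `Q = V a + U b`
  set a := V * (K * t) + U * (K * P.Gyu * t) with ha
  set b := V * (1 + K * P.Gyu * t) + U * (P.Gyu * t) with hb
  have har : a ∈ ringRH := ringRH.add_mem (ringRH.mul_mem hVr hx) (ringRH.mul_mem hUr hy)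
  have hbr : b ∈ ringRH := ringRH.add_mem
    (ringRH.mul_mem hVr (ringRH.add_mem ringRH.one_mem hy)) (ringRH.mul_mem hUr hw)
  have hG := hs.Gyu_mul
  have hbz := hs.bezout
  have ht1 : 1 + K * P.Gyu * t = t := by linear_combination -hT'
  have hMb : M * b = t := by
    rw [hb, ht1]
    linear_combination t * hbz + U * t * hG
  have hNa : N * a = K * P.Gyu * t := by
    rw [ha]
    linear_combination (K * P.Gyu * t) * hbz - (V * K * t) * hG
  have hKb : a = K * b := by
    rw [ha, hb, ht1]; ring
  have hMQ : M * (V * a + U * b) - U = a := by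
    linear_combination a * hbz + U * hMb - U * hNa - U * ht1
  have hNQ : N * (V * a + U * b) + V = b := by
    linear_combination b * hbz + V * hNa - V * hMb + V * ht1
  refine ⟨V * a + U * b, ringRH.add_mem (ringRH.mul_mem hVr har) (ringRH.mul_mem hUr hbr), ?_⟩
  have hb0 : b ≠ 0 := by
    intro h0
    rw [h0, mul_zero] at hMb
    rw [← hMb, mul_zero] at hT'
    exact zero_ne_one hT'
  rw [youla, hMQ, hNQ, hKb, mul_div_cancel_right₀ _ hb0]

lemma ofReal_mul_sqrt_sq (x : ℂ) {y : ℝ} (hy : 0 ≤ y) :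
    ENNReal.ofReal (‖x‖ * Real.sqrt y) ^ 2 = ENNReal.ofReal (‖x‖ ^ 2 * y) := by
  rw [← ENNReal.ofReal_pow (by positivity), mul_pow, Real.sq_sqrt hy]

/-- The Cauchy–Schwarz inequality bounds the cost of a feasible pair from below by `φ`. -/
lemma Standing.exists_phi_le (hs : Standing P H M N U V) {σ : ℝ} (hσ : 0 < σ ^ 2) {C D : ℝ → ℂ}
    (h : (C, D) ∈ ThetaCD P H σ) : ∃ Q ∈ ThetaQ H M N V σ, phi P H M N V σ Q ≤ J P H C D := by
  obtain ⟨⟨K, hK, hCD⟩, hsnr, hst⟩ := h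
  simp only at hCD hsnr hst
  obtain ⟨Q, hQ, rfl⟩ := hs.exists_youla hK hCD hst
  have hloop := hs.loop_ae hQ hCD
  have hJ := hs.J_eq hQ hCD
  rw [hs.snrConstraint_iff hQ hCD] at hsnr
  set e := effort H M N V Q with he
  set mb := onCirc (M * (N * Q + V)) with hmb
  have hCm : AEMeasurable (fun ω => C ω * mb ω) circMeasure := by
    refine (hst 1 0).aemeasurable.congr ?_
    filter_upwards [hloop] with ω ⟨h1, _⟩
    simp [closedLoop, div_eq_mul_inv, h1, hmb]
  have hDm : AEMeasurable (fun ω => D ω * onCirc H ω * mb ω) circMeasure := by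
    refine ((hst 2 2).aemeasurable.mul (measurable_onCirc H).aemeasurable).congr ?_
    filter_upwards [hloop] with ω ⟨h1, _⟩
    simp only [closedLoop, Pi.mul_apply]
    simp [div_eq_mul_inv, h1, hmb]
    ring
  set f : ℝ → ℝ≥0∞ := fun ω => ENNReal.ofReal (‖D ω * onCirc H ω * mb ω‖ * Real.sqrt (P.zuSq ω))
    with hf
  set g : ℝ → ℝ≥0∞ := fun ω => ENNReal.ofReal (‖C ω * mb ω‖ * Real.sqrt (P.yvSq ω)) with hg
  have hfm : AEMeasurable f circMeasure :=
    (hDm.norm.mul (measurable_zuSq P).sqrt.aemeasurable).ennreal_ofReal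
  have hgm : AEMeasurable g circMeasure :=
    (hCm.norm.mul (measurable_yvSq P).sqrt.aemeasurable).ennreal_ofReal
  have hf2 : ∫⁻ ω, ENNReal.ofReal (‖D ω * onCirc H ω * mb ω‖ ^ 2 * P.zuSq ω) ∂circMeasure =
      ∫⁻ ω, f ω ^ 2 ∂circMeasure :=
    lintegral_congr fun ω => (ofReal_mul_sqrt_sq _ (P.zuSq_nonneg ω)).symm
  have hg2 : ∫⁻ ω, ENNReal.ofReal (‖C ω * mb ω‖ ^ 2 * P.yvSq ω) ∂circMeasure =
      ∫⁻ ω, g ω ^ 2 ∂circMeasure :=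
    lintegral_congr fun ω => (ofReal_mul_sqrt_sq _ (P.yvSq_nonneg ω)).symm
  have hfg : ∫⁻ ω, ENNReal.ofReal (‖onCirc (H * M ^ 2 * (M * Q - U) * (N * Q + V)) ω‖ *
      (Real.sqrt (P.zuSq ω) * Real.sqrt (P.yvSq ω))) ∂circMeasure =
      ∫⁻ ω, f ω * g ω ∂circMeasure := by
    refine lintegral_congr_ae ?_
    filter_upwards [hs.mul_integrands hQ hCD] with ω hω
    rw [← hω, ENNReal.ofReal_mul (by positivity)]
  rw [hf2] at hJ
  rw [hg2] at hsnr
  have hcs := sq_lintegral_mul_le hfm hgm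
  have hlt : e < ENNReal.ofReal (σ ^ 2) := by
    by_cases hg0 : ∫⁻ ω, g ω ^ 2 ∂circMeasure = 0
    · -- no transmission: `C = 0`, hence `K = 0` and no effort is spent
      rw [lintegral_eq_zero_iff' (hgm.pow_const 2)] at hg0
      obtain ⟨b, B, hb, hB, hbB⟩ := exists_bounds_of_gram P.yvSq_nonneg P.onCirc_gramYv
        hs.yv_zeros hs.yv_poles
      have hK0 : youla M N U V Q = 0 := by
        refine ae_eq_zero_of_onCirc ?_
        filter_upwards [hg0, hbB, hloop, hCD] with ω h1 h2 ⟨_, h3, _⟩ h4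
        have h5 : g ω = 0 := by simpa using h1
        rw [hg] at h5
        have h6 : ‖C ω * mb ω‖ * Real.sqrt (P.yvSq ω) = 0 :=
          le_antisymm (ENNReal.ofReal_eq_zero.1 h5) (by positivity)
        have h7 : Real.sqrt (P.yvSq ω) ≠ 0 := (Real.sqrt_pos.2 (by linarith)).ne'
        have h8 : C ω = 0 := by
          rcases mul_eq_zero.1 h6 with h | h
          · exact (mul_eq_zero.1 (norm_eq_zero.1 h)).resolve_right h3
          · exact absurd h h7
        rw [← h4, h8, mul_zero]
      have ha0 : M * Q - U = 0 := by
        rw [youla, div_eq_zero_iff] at hK0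
        exact hK0.resolve_right (hs.den_intDegree hQ).1
      have : e = 0 := by
        rw [he, hs.effort_eq, ha0, mul_zero]
        simp [onCirc, (regAt_zero _).2]
      rw [this]
      exact ENNReal.ofReal_pos.2 hσ
    · have het : e ≠ ∞ := ne_top_of_le_ne_top ENNReal.ofReal_ne_top (le_add_self.trans hsnr)
      refine lt_of_lt_of_le ?_ hsnr
      rw [add_comm]
      exact ENNReal.lt_add_right het hg0
  refine ⟨Q, ⟨hQ, hlt⟩, ?_⟩
  rw [hJ, hs.phi_eq, hfg]
  refine add_le_add le_rfl (ENNReal.div_le_of_le_mul (hcs.trans ?_))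
  gcongr
  exact ENNReal.le_sub_of_add_le_right (hlt.trans ENNReal.ofReal_lt_top).ne hsnr

variable {n nv nz : ℕ} {P : Plant n nv nz} {H M N U V : RatFunc ℝ}

/-! ### Encoder/decoder pairs obtained by spectral factorization -/

lemma Standing.H_ne (hs : Standing P H M N U V) : H ≠ 0 := ne_zero_of_noZerosOnCircle hs.H_zeros

lemma Standing.zu_bounds (hs : Standing P H M N U V) : ∃ b B : ℝ, 0 < b ∧ 0 < B ∧
    ∀ᵐ ω ∂circMeasure, b ≤ P.zuSq ω ∧ P.zuSq ω ≤ B :=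
  exists_bounds_of_gram P.zuSq_nonneg P.onCirc_gramZu hs.zu_zeros hs.zu_poles

lemma Standing.yv_bounds (hs : Standing P H M N U V) : ∃ b B : ℝ, 0 < b ∧ 0 < B ∧
    ∀ᵐ ω ∂circMeasure, b ≤ P.yvSq ω ∧ P.yvSq ω ≤ B :=
  exists_bounds_of_gram P.yvSq_nonneg P.onCirc_gramYv hs.yv_zeros hs.yv_poles

/-- The `L¹` norm in the second term of `φ`. -/
def crossNorm (P : Plant n nv nz) (p : RatFunc ℝ) : ℝ≥0∞ :=
  ∫⁻ ω, ENNReal.ofReal (‖onCirc p ω‖ * (Real.sqrt (P.zuSq ω) * Real.sqrt (P.yvSq ω))) ∂circMeasure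

lemma Standing.crossNorm_lt_top (hs : Standing P H M N U V) {p : RatFunc ℝ} (hp : MemRH p) :
    crossNorm P p < ∞ := by
  obtain ⟨_, B, -, hB, h1⟩ := hs.zu_bounds
  obtain ⟨_, B', -, hB', h2⟩ := hs.yv_bounds
  obtain ⟨E, hE, h3⟩ := exists_norm_onCirc_le hp.noPolesOnCircle
  calc crossNorm P p ≤ ∫⁻ _, ENNReal.ofReal (E * (Real.sqrt B * Real.sqrt B')) ∂circMeasure := by
        refine lintegral_mono_ae ?_
        filter_upwards [h1, h2] with ω h4 h5
        refine ENNReal.ofReal_le_ofReal ?_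
        have h6 := h3 ω
        have h7 := h4.2
        have h8 := h5.2
        gcongr
    _ < ∞ := by simp

lemma Standing.crossNorm_ne_zero (hs : Standing P H M N U V) {p : RatFunc ℝ} (hp : p ≠ 0) :
    crossNorm P p ≠ 0 := by
  obtain ⟨b, _, hb, -, h1⟩ := hs.zu_bounds
  obtain ⟨b', _, hb', -, h2⟩ := hs.yv_bounds
  have hm : Measurable fun ω => ENNReal.ofReal
      (‖onCirc p ω‖ * (Real.sqrt (P.zuSq ω) * Real.sqrt (P.yvSq ω))) :=
    ((measurable_onCirc p).norm.mul
      ((measurable_zuSq P).sqrt.mul (measurable_yvSq P).sqrt)).ennreal_ofReal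
  intro h
  rw [crossNorm, lintegral_eq_zero_iff hm] at h
  obtain ⟨ω, h3, h4, h5, h6⟩ := (h.and (h1.and (h2.and (ae_onCirc_ne_zero hp)))).exists
  have h7 : 0 < P.zuSq ω := by linarith [h4.1]
  have h8 : 0 < P.yvSq ω := by linarith [h5.1]
  have h9 := norm_pos_iff.2 h6
  have : 0 < ‖onCirc p ω‖ * (Real.sqrt (P.zuSq ω) * Real.sqrt (P.yvSq ω)) := by positivity
  exact absurd (ENNReal.ofReal_eq_zero.1 h3) (not_le.2 this)

lemma gram_re_zu (ω : ℝ) :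
    (((matOnCirc P.Gzu ω).conjTranspose * matOnCirc P.Gzu ω) 0 0).re = P.zuSq ω := by
  simp only [Matrix.mul_apply, Matrix.conjTranspose_apply, matOnCirc, Matrix.map_apply,
    Plant.zuSq, Complex.re_sum]
  refine Finset.sum_congr rfl fun i _ => ?_
  rw [RCLike.star_def, Complex.conj_mul']
  norm_cast

lemma gram_re_yv (ω : ℝ) :
    ((matOnCirc P.Gyv ω * (matOnCirc P.Gyv ω).conjTranspose) 0 0).re = P.yvSq ω := by
  simp only [Matrix.mul_apply, Matrix.conjTranspose_apply, matOnCirc, Matrix.map_apply,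
    Plant.yvSq, Complex.re_sum]
  refine Finset.sum_congr rfl fun i _ => ?_
  rw [RCLike.star_def, Complex.mul_conj']
  norm_cast

/-- The cross term `H M² (M Q - U) (N Q + V)` of the cost, whose norm against the plant appears in
`φ`. -/
def crossTerm (H M N U V Q : RatFunc ℝ) : RatFunc ℝ := H * M ^ 2 * (M * Q - U) * (N * Q + V)

lemma Standing.crossTerm_mem (hs : Standing P H M N U V) {Q : RatFunc ℝ} (hQ : MemRH Q) :
    MemRH (crossTerm H M N U V Q) :=
  mem_ringRH.1 (ringRH.mul_mem (ringRH.mul_mem (ringRH.mul_mem hs.hH (ringRH.pow_mem hs.hM 2))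
    (hs.num_mem hQ)) (hs.den_mem hQ))

lemma Standing.crossTerm_ne_zero (hs : Standing P H M N U V) {Q : RatFunc ℝ} (hQ : MemRH Q)
    (ha : M * Q - U ≠ 0) : crossTerm H M N U V Q ≠ 0 :=
  mul_ne_zero (mul_ne_zero (mul_ne_zero hs.H_ne (pow_ne_zero 2 hs.M_ne)) ha)
    (hs.den_intDegree hQ).1

/-- The constant in the modulus of the encoder, in terms of the Youla parameter. -/
lemma Standing.gain_eq (hs : Standing P H M N U V) {Q : RatFunc ℝ} (hQ : MemRH Q) (σ : ℝ) :
    gain P H σ (youla M N U V Q) =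
      (σ ^ 2 - (effort H M N V Q).toReal) / (crossNorm P (crossTerm H M N U V Q)).toReal := by
  have hb := (hs.den_intDegree hQ).1
  have hM := hs.M_ne
  have hbz := hs.bezout_youla Q
  rw [hs.effort_eq, crossNorm, ← normOne_smul_gram, ← normTwoSq_scal, gain, crossTerm, youla,
    hs.fact]
  generalize M * Q - U = a at hbz ⊢
  generalize N * Q + V = b at hb hbz ⊢
  have hT : 1 - a / b * (N * M⁻¹) = (M * b)⁻¹ := by
    field_simp
    linear_combination hbz
  have e1 : a / b * H * (N * M⁻¹) / (M * b)⁻¹ = H * N * a := by field_simp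
  have e2 : a / b * H / (M * b)⁻¹ ^ 2 = H * M ^ 2 * a * b := by field_simp
  rw [hT, e1, e2]

/-- The data of an encoder/decoder pair with the optimal modulus of the encoder. -/
structure OptimalPair (P : Plant n nv nz) (H K : RatFunc ℝ) (γ : ℝ) (C D : ℝ → ℂ) : Prop where
  gain_pos : 0 < γ
  C_ne : ∀ᵐ ω ∂circMeasure, C ω ≠ 0
  modulus : ∀ᵐ ω ∂circMeasure, ‖C ω‖ ^ 2 =
    γ * Real.sqrt (P.zuSq ω / P.yvSq ω) * (‖onCirc K ω‖ * ‖onCirc H ω‖)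
  D_eq : ∀ᵐ ω ∂circMeasure, D ω = onCirc K ω * (C ω)⁻¹

/-- The logarithm of the prescribed modulus of the encoder, written as a combination of functions
that are known to have an outer extension. -/
def logModulus (P : Plant n nv nz) (H K : RatFunc ℝ) (γ : ℝ) (ω : ℝ) : ℝ :=
  (1 / 2) * (Real.log γ + ((1 / 2) * (Real.log (P.zuSq ω) + (-1) * Real.log (P.yvSq ω)) +
    (Real.log ‖onCirc K ω‖ + Real.log ‖onCirc H ω‖)))

lemma Standing.hasOuterExtension_logModulus (hs : Standing P H M N U V) {K : RatFunc ℝ}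
    (hK : K ≠ 0) (γ : ℝ) : HasOuterExtension (logModulus P H K γ) := by
  have h1 := hasOuterExtension_log_of_gram P.zuSq_nonneg P.onCirc_gramZu
    (ne_zero_of_noZerosOnCircle hs.zu_zeros)
  have h2 := hasOuterExtension_log_of_gram P.yvSq_nonneg P.onCirc_gramYv
    (ne_zero_of_noZerosOnCircle hs.yv_zeros)
  exact ((HasOuterExtension.const (Real.log γ)).add (((h1.add (h2.const_mul (-1))).const_mul
    (1 / 2)).add ((hasOuterExtension_log_onCirc hK).add
      (hasOuterExtension_log_onCirc hs.H_ne)))).const_mul (1 / 2)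

lemma Standing.two_mul_logModulus (hs : Standing P H M N U V) {K : RatFunc ℝ} (hK : K ≠ 0)
    {γ : ℝ} (hγ : 0 < γ) : ∀ᵐ ω ∂circMeasure,
      0 < γ * Real.sqrt (P.zuSq ω / P.yvSq ω) * (‖onCirc K ω‖ * ‖onCirc H ω‖) ∧
      2 * logModulus P H K γ ω =
        Real.log (γ * Real.sqrt (P.zuSq ω / P.yvSq ω) * (‖onCirc K ω‖ * ‖onCirc H ω‖)) := by
  obtain ⟨b, _, hb, -, h1⟩ := hs.zu_bounds
  obtain ⟨b', _, hb', -, h2⟩ := hs.yv_bounds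
  filter_upwards [h1, h2, ae_onCirc_ne_zero hK, ae_onCirc_ne_zero hs.H_ne] with ω h3 h4 h5 h6
  have h7 : 0 < P.zuSq ω := by linarith [h3.1]
  have h8 : 0 < P.yvSq ω := by linarith [h4.1]
  have h9 := norm_pos_iff.2 h5
  have h10 := norm_pos_iff.2 h6
  refine ⟨by positivity, ?_⟩
  rw [Real.log_mul (by positivity) (by positivity), Real.log_mul (by positivity) (by positivity),
    Real.log_mul (by positivity) (by positivity), Real.log_sqrt (by positivity),
    Real.log_div (by positivity) (by positivity), logModulus]
  ring

lemma Standing.ratio_bounds (hs : Standing P H M N U V) : ∃ b B : ℝ, 0 < b ∧ 0 < B ∧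
    ∀ᵐ ω ∂circMeasure, b ≤ Real.sqrt (P.zuSq ω / P.yvSq ω) ∧
      Real.sqrt (P.zuSq ω / P.yvSq ω) ≤ B := by
  obtain ⟨b, B, hb, hB, h1⟩ := hs.zu_bounds
  obtain ⟨b', B', hb', hB', h2⟩ := hs.yv_bounds
  refine ⟨Real.sqrt (b / B'), Real.sqrt (B / b'), by positivity, by positivity, ?_⟩
  filter_upwards [h1, h2] with ω ⟨h3, h4⟩ ⟨h5, h6⟩
  have : 0 < P.yvSq ω := by linarith
  have : 0 < P.zuSq ω := by linarith
  constructor <;> exact Real.sqrt_le_sqrt (by gcongr)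

/-- Existence of the outer encoder with the prescribed modulus. -/
lemma Standing.exists_outer (hs : Standing P H M N U V) {K : RatFunc ℝ} (hK : K ≠ 0)
    (hKp : NoPolesOnCircle K) {γ : ℝ} (hγ : 0 < γ) :
    ∃ C : ℝ → ℂ, IsOuterHardyTwo C ∧ ∀ᵐ ω ∂circMeasure, ‖C ω‖ ^ 2 =
      γ * Real.sqrt (P.zuSq ω / P.yvSq ω) * (‖onCirc K ω‖ * ‖onCirc H ω‖) := by
  obtain ⟨_, B, -, hB, h1⟩ := hs.ratio_bounds
  obtain ⟨B₁, hB₁, h2⟩ := exists_norm_onCirc_le hKp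
  obtain ⟨B₂, hB₂, h3⟩ := exists_norm_onCirc_le hs.hH.noPolesOnCircle
  have h4 := hs.two_mul_logModulus hK hγ
  obtain ⟨C, hC, hCn⟩ := exists_isOuterHardyTwo (hs.hasOuterExtension_logModulus hK γ)
    (B := Real.log (γ * B * (B₁ * B₂)) / 2) (by
      filter_upwards [h1, h4] with ω h5 ⟨h6, h7⟩
      have h8 : Real.log (γ * Real.sqrt (P.zuSq ω / P.yvSq ω) *
          (‖onCirc K ω‖ * ‖onCirc H ω‖)) ≤ Real.log (γ * B * (B₁ * B₂)) := by
        refine Real.log_le_log h6 ?_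
        have := h2 ω
        have := h3 ω
        have := h5.2
        gcongr
      linarith)
  refine ⟨C, hC, ?_⟩
  filter_upwards [hCn, h4] with ω h5 ⟨h6, h7⟩
  rw [h5, ← Real.exp_nat_mul]
  push_cast
  rw [h7, Real.exp_log h6]

namespace OptimalPair

variable {K : RatFunc ℝ} {γ : ℝ} {C D : ℝ → ℂ}

lemma mul_eq (h : OptimalPair P H K γ C D) :
    ∀ᵐ ω ∂circMeasure, D ω * C ω = onCirc K ω := by
  filter_upwards [h.D_eq, h.C_ne] with ω h1 h2
  rw [h1, inv_mul_cancel_right₀ h2]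

lemma hasOuterExtension_log (h : OptimalPair P H K γ C D) (hs : Standing P H M N U V)
    (hK : K ≠ 0) : HasOuterExtension fun ω => Real.log ‖C ω‖ := by
  refine (hs.hasOuterExtension_logModulus hK γ).congr ?_
  filter_upwards [h.modulus, hs.two_mul_logModulus hK h.gain_pos] with ω h1 ⟨_, h2⟩
  rw [← h1, Real.log_pow] at h2
  push_cast at h2
  linarith

/-- The decoder is bounded: `|D|²` is `|K|` up to factors bounded away from zero. -/
lemma exists_bound (h : OptimalPair P H K γ C D) (hs : Standing P H M N U V)
    (hK : K ≠ 0) (hKp : NoPolesOnCircle K) :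
    ∃ B : ℝ, 0 < B ∧ ∀ᵐ ω ∂circMeasure, ‖D ω‖ ≤ B := by
  obtain ⟨b, _, hb, -, h1⟩ := hs.ratio_bounds
  obtain ⟨B₁, hB₁, h2⟩ := exists_norm_onCirc_le hKp
  obtain ⟨b₂, hb₂, h3⟩ := exists_le_norm_onCirc hs.H_zeros hs.hH.noPolesOnCircle
  have hγ := h.gain_pos
  refine ⟨Real.sqrt (B₁ / (γ * b * b₂)), by positivity, ?_⟩
  filter_upwards [h.modulus, h.D_eq, h.C_ne, h1, ae_onCirc_ne_zero hK] with ω h4 h5 h6 ⟨h7, _⟩ h8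
  refine Real.le_sqrt_of_sq_le ?_
  have hk := norm_pos_iff.2 h8
  have hh : 0 < ‖onCirc H ω‖ := lt_of_lt_of_le hb₂ (h3 ω)
  have hr : 0 < Real.sqrt (P.zuSq ω / P.yvSq ω) := lt_of_lt_of_le hb h7
  have e : ‖D ω‖ ^ 2 = ‖onCirc K ω‖ / (γ * Real.sqrt (P.zuSq ω / P.yvSq ω) * ‖onCirc H ω‖) := by
    rw [h5, norm_mul, norm_inv, mul_pow, inv_pow, h4]
    field_simp
  rw [e]
  have := h2 ω
  have := h3 ω
  gcongr

end OptimalPair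

section Loop

variable (hs : Standing P H M N U V) {Q : RatFunc ℝ} (hQ : MemRH Q) {C D : ℝ → ℂ}
  (hCD : ∀ᵐ ω ∂circMeasure, D ω * C ω = onCirc (youla M N U V Q) ω)

include hs hQ hCD

/-- With rational `D C` given by a Youla parameter, internal stability only concerns the four
closed loop functions that involve `C` or `D` alone. -/
lemma Standing.internallyStable
    (h1 : MemHardyTwo fun ω => D ω * onCirc (N * (N * Q + V)) ω)
    (h2 : MemHardyTwo fun ω => D ω * onCirc (M * (N * Q + V)) ω)
    (h3 : MemHardyTwo fun ω => C ω * onCirc (M * (N * Q + V)) ω)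
    (h4 : MemHardyTwo fun ω => C ω * onCirc (N * (N * Q + V)) ω) :
    InternallyStable P C D := by
  have hloop := hs.loop_ae hQ hCD
  have ra := mem_ringRH.2 (hs.num_mem hQ)
  have rb := mem_ringRH.2 (hs.den_mem hQ)
  have hna : MemHardyTwo (onCirc (N * (M * Q - U))) :=
    MemRH.memHardyTwo (mem_ringRH.1 (ringRH.mul_mem hs.hN ra))
  have hma : MemHardyTwo (onCirc (M * (M * Q - U))) :=
    MemRH.memHardyTwo (mem_ringRH.1 (ringRH.mul_mem hs.hM ra))
  have hnb : MemHardyTwo (onCirc (N * (N * Q + V))) :=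
    MemRH.memHardyTwo (mem_ringRH.1 (ringRH.mul_mem hs.hN rb))
  have hKG : (fun ω => onCirc (N * (M * Q - U)) ω) =ᵐ[circMeasure] fun ω =>
      D ω * C ω * onCirc P.Gyu ω / (1 - D ω * C ω * onCirc P.Gyu ω) := by
    filter_upwards [hloop] with ω ⟨e1, _, _, e4, e5⟩
    rw [div_eq_mul_inv, e1, mul_assoc, e4, e5]
  intro i j
  fin_cases i <;> fin_cases j
  · exact hna.congr hKG
  · refine hnb.congr ?_
    filter_upwards [hloop] with ω ⟨e1, _, _, e4, _⟩
    simp [closedLoop, div_eq_mul_inv, e1, e4]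
  · refine h1.congr (g := fun ω => D ω * onCirc P.Gyu ω / (1 - D ω * C ω * onCirc P.Gyu ω)) ?_
    filter_upwards [hloop] with ω ⟨e1, _, _, e4, _⟩
    rw [div_eq_mul_inv, e1, mul_assoc, e4]
  · refine h3.congr ?_
    filter_upwards [hloop] with ω ⟨e1, _, _, e4, _⟩
    simp [closedLoop, div_eq_mul_inv, e1]
  · refine h4.congr (g := fun ω => C ω * onCirc P.Gyu ω / (1 - D ω * C ω * onCirc P.Gyu ω)) ?_
    filter_upwards [hloop] with ω ⟨e1, _, _, e4, _⟩
    rw [div_eq_mul_inv, e1, mul_assoc, e4]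
  · exact hna.congr hKG
  · refine hma.congr ?_
    filter_upwards [hloop] with ω ⟨e1, _, e3, _, _⟩
    simp [closedLoop, div_eq_mul_inv, e1, e3]
  · exact hna.congr hKG
  · refine h2.congr ?_
    filter_upwards [hloop] with ω ⟨e1, _, e3, _, _⟩
    simp [closedLoop, div_eq_mul_inv, e1]

end Loop

/-- The optimal pair is feasible and attains `φ(Q)`: its encoder spends the whole power budget and
makes the Cauchy–Schwarz inequality an equality. -/
lemma OptimalPair.spec (hs : Standing P H M N U V) {σ : ℝ} {Q : RatFunc ℝ}
    (hQ : Q ∈ ThetaQ H M N V σ) (ha : M * Q - U ≠ 0) (hK : MemRL (youla M N U V Q))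
    {C D : ℝ → ℂ} (hC : IsOuterHardyTwo C)
    (h : OptimalPair P H (youla M N U V Q) (gain P H σ (youla M N U V Q)) C D) :
    (C, D) ∈ ThetaCD P H σ ∧ J P H C D = phi P H M N V σ Q := by
  obtain ⟨hQ, hlt⟩ := hQ
  have hCD := h.mul_eq
  have hK0 : youla M N U V Q ≠ 0 := div_ne_zero ha (hs.den_intDegree hQ).1
  have hloop := hs.loop_ae hQ hCD
  obtain ⟨B, hB, hDB⟩ := h.exists_bound hs hK0 hK.2
  have hlog := h.hasOuterExtension_log hs hK0
  set γ := gain P H σ (youla M N U V Q) with hγ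
  have hγ0 : 0 < γ := h.gain_pos
  set e := effort H M N V Q
  set X := crossTerm H M N U V Q with hX
  have hn0 := hs.crossNorm_ne_zero (hs.crossTerm_ne_zero hQ ha)
  have hnt := (hs.crossNorm_lt_top (hs.crossTerm_mem hQ)).ne
  rw [← hX] at hn0 hnt
  -- pointwise values of the two quadratic integrands
  obtain ⟨b₁, _, hb₁, -, hzu⟩ := hs.zu_bounds
  obtain ⟨b₂, _, hb₂, -, hyv⟩ := hs.yv_bounds
  have hC2 : ∀ᵐ ω ∂circMeasure, ‖C ω * onCirc (M * (N * Q + V)) ω‖ ^ 2 * P.yvSq ω =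
      γ * (‖onCirc X ω‖ * (Real.sqrt (P.zuSq ω) * Real.sqrt (P.yvSq ω))) := by
    filter_upwards [h.modulus, hs.mul_integrands hQ hCD, hzu, hyv, h.D_eq, h.C_ne]
      with ω h1 h2 h3 h4 h5 h6
    have hy : 0 < P.yvSq ω := by linarith [h4.1]
    have hz : 0 < P.zuSq ω := by linarith [h3.1]
    have hc := norm_pos_iff.2 h6
    rw [hX, crossTerm, ← h2, h5]
    simp only [norm_mul, norm_inv, mul_pow]
    rw [h1, Real.sqrt_div' _ hy.le]
    have h8 : Real.sqrt (P.yvSq ω) ^ 2 = P.yvSq ω := Real.sq_sqrt hy.le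
    have h9 := Real.sqrt_pos.2 hy
    field_simp
    rw [h8]
    ring
  have hD2 : ∀ᵐ ω ∂circMeasure, ‖D ω * onCirc H ω * onCirc (M * (N * Q + V)) ω‖ ^ 2 * P.zuSq ω =
      γ⁻¹ * (‖onCirc X ω‖ * (Real.sqrt (P.zuSq ω) * Real.sqrt (P.yvSq ω))) := by
    filter_upwards [hC2, hs.mul_integrands hQ hCD, hzu, hyv, h.C_ne, hloop,
      ae_onCirc_ne_zero (hs.crossTerm_ne_zero hQ ha)] with ω h1 h2 h3 h4 h5 ⟨_, h6, _⟩ h10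
    have hy : 0 < P.yvSq ω := by linarith [h4.1]
    have hz : 0 < P.zuSq ω := by linarith [h3.1]
    have hy2 : Real.sqrt (P.yvSq ω) ^ 2 = P.yvSq ω := Real.sq_sqrt hy.le
    have hz2 : Real.sqrt (P.zuSq ω) ^ 2 = P.zuSq ω := Real.sq_sqrt hz.le
    have hx := norm_pos_iff.2 h10
    have hsy := Real.sqrt_pos.2 hy
    have hsz := Real.sqrt_pos.2 hz
    rw [← crossTerm, ← hX] at h2
    rw [← hX] at hx
    set x := ‖onCirc X ω‖ * (Real.sqrt (P.zuSq ω) * Real.sqrt (P.yvSq ω)) with hxdef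
    have hx0 : 0 < x := by positivity
    set p := ‖D ω * onCirc H ω * onCirc (M * (N * Q + V)) ω‖
    set q := ‖C ω * onCirc (M * (N * Q + V)) ω‖
    have h7 : (p ^ 2 * P.zuSq ω) * (q ^ 2 * P.yvSq ω) = x * x := by
      rw [← h2, ← hy2, ← hz2, Real.sqrt_sq hsy.le, Real.sqrt_sq hsz.le]; ring
    rw [h1] at h7
    have h8 : (p ^ 2 * P.zuSq ω) * γ = x := mul_right_cancel₀ hx0.ne' (by linarith)
    rw [← h8]
    field_simp
  have hgain : γ * (crossNorm P X).toReal = σ ^ 2 - e.toReal := by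
    rw [hγ, hs.gain_eq hQ σ]
    exact div_mul_cancel₀ _ (ENNReal.toReal_pos hn0 hnt).ne'
  have het : e ≠ ∞ := (hlt.trans ENNReal.ofReal_lt_top).ne
  have hsub : ENNReal.ofReal (σ ^ 2) - e = ENNReal.ofReal γ * crossNorm P X := by
    rw [← ENNReal.ofReal_toReal het, ← ENNReal.ofReal_sub _ ENNReal.toReal_nonneg, ← hgain,
      ENNReal.ofReal_mul hγ0.le, ENNReal.ofReal_toReal hnt]
  have hγe : ENNReal.ofReal γ ≠ 0 := (ENNReal.ofReal_pos.2 hγ0).ne'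
  have hIC : ∫⁻ ω, ENNReal.ofReal (‖C ω * onCirc (M * (N * Q + V)) ω‖ ^ 2 * P.yvSq ω)
      ∂circMeasure = ENNReal.ofReal (σ ^ 2) - e := by
    rw [hsub, crossNorm, ← lintegral_const_mul' _ _ ENNReal.ofReal_ne_top]
    refine lintegral_congr_ae ?_
    filter_upwards [hC2] with ω hω
    rw [hω, ENNReal.ofReal_mul hγ0.le]
  have hID : ∫⁻ ω, ENNReal.ofReal (‖D ω * onCirc H ω * onCirc (M * (N * Q + V)) ω‖ ^ 2 *
      P.zuSq ω) ∂circMeasure = crossNorm P X ^ 2 / (ENNReal.ofReal (σ ^ 2) - e) := by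
    have h1 : ∫⁻ ω, ENNReal.ofReal (‖D ω * onCirc H ω * onCirc (M * (N * Q + V)) ω‖ ^ 2 *
        P.zuSq ω) ∂circMeasure = (ENNReal.ofReal γ)⁻¹ * crossNorm P X := by
      rw [crossNorm, ← lintegral_const_mul' _ _ (ENNReal.inv_ne_top.2 hγe),
        ← ENNReal.ofReal_inv_of_pos hγ0]
      refine lintegral_congr_ae ?_
      filter_upwards [hD2] with ω hω
      rw [hω, ENNReal.ofReal_mul (inv_pos.2 hγ0).le]
    rw [h1, hsub, sq, ENNReal.mul_div_mul_right _ _ hn0 hnt, div_eq_mul_inv, mul_comm]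
  refine ⟨⟨⟨_, hs.isProper_youla hQ, hCD⟩, ?_, ?_⟩, ?_⟩
  · rw [hs.snrConstraint_iff hQ hCD, hIC, tsub_add_cancel_of_le hlt.le]
  · have hdiv : ∀ p ∈ ringRH, ∀ q : RatFunc ℝ, (∀ᵐ ω ∂circMeasure, D ω * C ω * onCirc p ω =
        onCirc q ω) → MemRH q → MemHardyTwo fun ω => D ω * onCirc p ω := by
      intro p hp q hpq hq
      obtain ⟨E, hE, hpE⟩ := exists_norm_onCirc_le (mem_ringRH.1 hp).noPolesOnCircle
      refine (hC.memHardyTwo_div hlog hq (B := B * E) ?_).congr ?_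
      · filter_upwards [hpq, hDB] with ω h1 h2
        rw [← h1, norm_mul, norm_mul]
        calc ‖D ω‖ * ‖C ω‖ * ‖onCirc p ω‖ ≤ B * ‖C ω‖ * E := by
              have := hpE ω
              gcongr
          _ = _ := by ring
      · filter_upwards [hpq, h.C_ne] with ω h1 h2
        rw [← h1]
        field_simp
    have rb := mem_ringRH.2 (hs.den_mem hQ)
    have ra := mem_ringRH.2 (hs.num_mem hQ)
    have rM := mem_ringRH.2 hs.hM
    have rN := mem_ringRH.2 hs.hN
    refine hs.internallyStable hQ hCD ?_ ?_ ?_ ?_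
    · refine hdiv _ (ringRH.mul_mem rN rb) (N * (M * Q - U)) ?_ (ringRH.mul_mem rN ra)
      filter_upwards [hloop] with ω ⟨_, _, _, _, h5⟩ using h5
    · refine hdiv _ (ringRH.mul_mem rM rb) (M * (M * Q - U)) ?_ (ringRH.mul_mem rM ra)
      filter_upwards [hloop] with ω ⟨_, _, h3, _⟩ using h3
    · exact hC.memHardyTwo.mul_onCirc (ringRH.mul_mem rM rb)
    · exact hC.memHardyTwo.mul_onCirc (ringRH.mul_mem rN rb)
  · rw [hs.J_eq hQ hCD, hs.phi_eq, hID]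
    rfl

lemma memHardyTwo_of_ae_zero {f : ℝ → ℂ} (hf : ∀ᵐ ω ∂circMeasure, f ω = 0) : MemHardyTwo f := by
  refine (MemRH.memHardyTwo (mem_ringRH.1 ringRH.zero_mem)).congr ?_
  filter_upwards [hf] with ω h
  rw [h]
  exact (regAt_zero _).2

/-- If `M Q = U`, then not transmitting anything is feasible and has cost `φ(Q)`. -/
lemma Standing.zero_spec (hs : Standing P H M N U V) {σ : ℝ} {Q : RatFunc ℝ}
    (hQ : Q ∈ ThetaQ H M N V σ) (ha : M * Q - U = 0) {C D : ℝ → ℂ}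
    (hC : ∀ᵐ ω ∂circMeasure, C ω = 0) (hD : ∀ᵐ ω ∂circMeasure, D ω = 0) :
    (C, D) ∈ ThetaCD P H σ ∧ J P H C D = phi P H M N V σ Q := by
  obtain ⟨hQ, hlt⟩ := hQ
  have h0 : ∀ ω, onCirc 0 ω = 0 := fun ω => (regAt_zero _).2
  have hCD : ∀ᵐ ω ∂circMeasure, D ω * C ω = onCirc (youla M N U V Q) ω := by
    filter_upwards [hC] with ω h
    rw [youla, ha, zero_div, h0, h, mul_zero]
  have hIC : ∫⁻ ω, ENNReal.ofReal (‖C ω * onCirc (M * (N * Q + V)) ω‖ ^ 2 * P.yvSq ω)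
      ∂circMeasure = 0 := by
    rw [← lintegral_zero (μ := circMeasure)]
    refine lintegral_congr_ae ?_
    filter_upwards [hC] with ω h
    simp [h]
  have hID : ∫⁻ ω, ENNReal.ofReal (‖D ω * onCirc H ω * onCirc (M * (N * Q + V)) ω‖ ^ 2 *
      P.zuSq ω) ∂circMeasure = 0 := by
    rw [← lintegral_zero (μ := circMeasure)]
    refine lintegral_congr_ae ?_
    filter_upwards [hD] with ω h
    simp [h]
  refine ⟨⟨⟨_, hs.isProper_youla hQ, hCD⟩, ?_, ?_⟩, ?_⟩
  · rw [hs.snrConstraint_iff hQ hCD, hIC, zero_add]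
    exact hlt.le
  · refine hs.internallyStable hQ hCD ?_ ?_ ?_ ?_ <;> refine memHardyTwo_of_ae_zero ?_
    · filter_upwards [hD] with ω h; rw [h, zero_mul]
    · filter_upwards [hD] with ω h; rw [h, zero_mul]
    · filter_upwards [hC] with ω h; rw [h, zero_mul]
    · filter_upwards [hC] with ω h; rw [h, zero_mul]
  · rw [hs.J_eq hQ hCD, hs.phi_eq, hID, ha]
    simp [h0]

/-! ### Zeros on the circle of a one-parameter family -/

/-- If `f / g` does not coincide with its para-conjugate, then `f + δ g`, with real `δ`, has a zero
on the circle for finitely many `δ` only: at such a zero `f / g` takes the real value `-δ`, and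
there are finitely many points of the circle at which `f / g` is real. -/
lemma finite_setOf_circle_zero {f g : RatFunc ℝ} (hf : NoPolesOnCircle f)
    (hfg : ∀ z : ℂ, ‖z‖ = 1 → evalAt f z = 0 → evalAt g z ≠ 0)
    (hd : f * g⁻¹ - paraConj (f * g⁻¹) ≠ 0) :
    {δ : ℝ | ∃ z : ℂ, ‖z‖ = 1 ∧ evalAt f z + δ * evalAt g z = 0}.Finite := by
  set d := f * g⁻¹ - paraConj (f * g⁻¹) with hdd
  refine ((d.num.rootSet_finite ℂ).image fun z => -(evalAt (f * g⁻¹) z).re).subset ?_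
  rintro δ ⟨z, hz, h0⟩
  have hgz : evalAt g z ≠ 0 := by
    intro h
    rw [h, mul_zero, add_zero] at h0
    exact hfg z hz h0 h
  obtain ⟨r1, e1⟩ := RegAt.inv hgz
  obtain ⟨r2, e2⟩ := RegAt.mul (hf z hz) r1
  have e3 : evalAt (f * g⁻¹) z = ((-δ : ℝ) : ℂ) := by
    rw [e2, e1, ← div_eq_mul_inv, div_eq_iff hgz]
    push_cast
    linear_combination h0
  rw [← pt_arg hz] at r2 e3
  obtain ⟨r4, e4⟩ := onCirc_paraConj r2
  obtain ⟨r5, e5⟩ := RegAt.sub r2 r4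
  have e6 : onCirc (f * g⁻¹) z.arg = ((-δ : ℝ) : ℂ) := e3
  have e7 : evalAt (paraConj (f * g⁻¹)) (pt z.arg) = ((-δ : ℝ) : ℂ) := by
    rw [← Complex.conj_ofReal, ← e6]
    exact e4
  rw [e3, e7, sub_self, ← hdd] at e5
  rw [pt_arg hz] at r5 e5 e3
  refine ⟨z, Polynomial.mem_rootSet.2 ⟨RatFunc.num_ne_zero hd, ?_⟩, ?_⟩
  · rw [evalAt_def] at e5
    exact (div_eq_zero_iff.1 e5).resolve_right r5
  · simp only [e3, Complex.ofReal_re, neg_neg]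

/-- A nonzero rational function and its product with `X` do not both coincide with their
para-conjugates, since otherwise `z` would be real almost everywhere on the circle. -/
lemma paraConj_ne_or {h : RatFunc ℝ} (h0 : h ≠ 0) :
    h - paraConj h ≠ 0 ∨ h * RatFunc.X - paraConj (h * RatFunc.X) ≠ 0 := by
  by_contra! hc
  obtain ⟨h1, h2⟩ := hc
  rw [sub_eq_zero] at h1 h2
  obtain ⟨ω, r1, r2, hne, hp, hm⟩ := ((ae_regAt h).and ((ae_regAt (h * RatFunc.X)).and
    ((ae_onCirc_ne_zero h0).and ((ae_pt_ne 1).and (ae_pt_ne (-1)))))).exists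
  have e1 := (onCirc_paraConj r1).2
  have e2 := (onCirc_paraConj r2).2
  rw [← h1] at e1
  rw [← h2, onCirc_mul r1 (regAt_X _).1, map_mul, ← e1] at e2
  have e3 : onCirc RatFunc.X ω = pt ω := (regAt_X _).2
  rw [e3] at e2
  have e4 := mul_left_cancel₀ hne e2
  have e5 : pt ω * (starRingEnd ℂ) (pt ω) = 1 := by
    rw [Complex.mul_conj']
    simp [norm_pt]
  rw [← e4] at e5
  rcases mul_self_eq_one_iff.1 e5 with h | h
  · exact hp h
  · exact hm h

variable {n nv nz : ℕ} {P : Plant n nv nz} {H M N U V : RatFunc ℝ}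

/-- In one of the directions `1`, `X⁻¹`, all but finitely many real multiples perturb the Youla
parameter to one whose controller has no poles on the circle. -/
lemma Standing.exists_direction (hs : Standing P H M N U V) {Q : RatFunc ℝ} (hQ : MemRH Q) :
    ∃ s : RatFunc ℝ, MemRH s ∧
      {δ : ℝ | ¬ NoPolesOnCircle (youla M N U V (Q + RatFunc.C δ * s))}.Finite := by
  have hb := (hs.den_intDegree hQ).1
  have hX : (RatFunc.X : RatFunc ℝ) ≠ 0 := RatFunc.X_ne_zero
  have key : ∀ s : RatFunc ℝ, MemRH s → (∀ z : ℂ, ‖z‖ = 1 → evalAt s z ≠ 0) →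
      (N * Q + V) * (N * s)⁻¹ - paraConj ((N * Q + V) * (N * s)⁻¹) ≠ 0 →
      {δ : ℝ | ¬ NoPolesOnCircle (youla M N U V (Q + RatFunc.C δ * s))}.Finite := by
    intro s hs' hs0 hd
    have hNs : MemRH (N * s) := mem_ringRH.1 (ringRH.mul_mem hs.hN hs')
    refine (finite_setOf_circle_zero (hs.den_mem hQ).noPolesOnCircle ?_ hd).subset ?_
    · intro z hz h0 h1
      have rM := hs.hM.noPolesOnCircle z hz
      have rN := hs.hN.noPolesOnCircle z hz
      have rb := (hs.den_mem hQ).noPolesOnCircle z hz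
      have ra := (hs.num_mem hQ).noPolesOnCircle z hz
      rw [(RegAt.mul rN (hs'.noPolesOnCircle z hz)).2] at h1
      have hN0 := (mul_eq_zero.1 h1).resolve_right (hs0 z hz)
      have hbz := ((RegAt.mul rM rb).1.sub (RegAt.mul rN ra).1).2
      rw [hs.bezout_youla, (regAt_one z).2, (RegAt.mul rM rb).2, (RegAt.mul rN ra).2, h0, hN0]
        at hbz
      simp at hbz
    · intro δ hδ
      by_contra hno
      refine hδ fun z hz => ?_
      have hQ' : MemRH (Q + RatFunc.C δ * s) :=
        mem_ringRH.1 (ringRH.add_mem hQ (ringRH.mul_mem (C_mem_ringRH δ) hs'))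
      have e : N * (Q + RatFunc.C δ * s) + V = (N * Q + V) + RatFunc.C δ * (N * s) := by ring
      have r2 := RegAt.mul (regAt_C z δ).1 (hNs.noPolesOnCircle z hz)
      have r3 := RegAt.add ((hs.den_mem hQ).noPolesOnCircle z hz) r2.1
      rw [r2.2, (regAt_C z δ).2, ← e] at r3
      have h0 : evalAt (N * (Q + RatFunc.C δ * s) + V) z ≠ 0 := by
        rw [r3.2]
        exact fun h => hno ⟨z, hz, h⟩
      rw [youla, div_eq_mul_inv]
      exact (RegAt.mul ((hs.num_mem hQ').noPolesOnCircle z hz) (RegAt.inv h0).1).1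
  rcases paraConj_ne_or (h := (N * Q + V) * N⁻¹) (mul_ne_zero hb (inv_ne_zero hs.N_ne)) with h | h
  · refine ⟨1, mem_ringRH.1 ringRH.one_mem, key 1 (mem_ringRH.1 ringRH.one_mem) ?_ ?_⟩
    · intro z _
      rw [(regAt_one z).2]
      exact one_ne_zero
    · rwa [mul_one]
  · refine ⟨RatFunc.X⁻¹, mem_ringRH.1 inv_X_mem_ringRH,
      key _ (mem_ringRH.1 inv_X_mem_ringRH) ?_ ?_⟩
    · intro z hz
      have hz0 : z ≠ 0 := by
        rintro rfl
        simp at hz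
      rw [(RegAt.inv (p := RatFunc.X) (by rwa [(regAt_X z).2])).2, (regAt_X z).2]
      exact inv_ne_zero hz0
    · rwa [mul_inv, inv_inv, ← mul_assoc]

/-! ### Continuity of the cost along a line -/

lemma tendsto_lintegral_ofReal {F : ℝ → ℝ → ℝ} {B : ℝ} (hF : ∀ δ, Measurable (F δ))
    (hb : ∀ᵐ ω ∂circMeasure, ∀ δ, |δ| ≤ 1 → F δ ω ≤ B)
    (hc : ∀ ω, Continuous fun δ => F δ ω) :
    Tendsto (fun δ => ∫⁻ ω, ENNReal.ofReal (F δ ω) ∂circMeasure) (𝓝 0)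
      (𝓝 (∫⁻ ω, ENNReal.ofReal (F 0 ω) ∂circMeasure)) := by
  refine tendsto_lintegral_filter_of_dominated_convergence (fun _ => ENNReal.ofReal B)
    (Eventually.of_forall fun δ => (hF δ).ennreal_ofReal) ?_ (by simp) ?_
  · have h1 : ∀ᶠ δ : ℝ in 𝓝 0, |δ| ≤ 1 := by
      filter_upwards [Metric.closedBall_mem_nhds (0 : ℝ) one_pos] with δ hδ
      simpa using hδ
    filter_upwards [h1] with δ hδ
    filter_upwards [hb] with ω hω using ENNReal.ofReal_le_ofReal (hω δ hδ)
  · exact Eventually.of_forall fun ω =>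
      ((ENNReal.continuous_ofReal.comp (hc ω)).tendsto 0)

lemma norm_add_mul_le {x y : ℂ} {B B' δ : ℝ} (hx : ‖x‖ ≤ B) (hy : ‖y‖ ≤ B') (hδ : |δ| ≤ 1) :
    ‖x + δ * y‖ ≤ B + B' := by
  refine (norm_add_le _ _).trans (add_le_add hx ?_)
  rw [norm_mul, Complex.norm_real, Real.norm_eq_abs]
  calc |δ| * ‖y‖ ≤ 1 * ‖y‖ := by gcongr
    _ ≤ B' := by rwa [one_mul]

/-- The first term of the cost is the norm of a matrix with bounded entries on the circle, although
`G_zv` itself may have poles there: stabilizability and detectability make the closed loop around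
the whole plant stable. -/
lemma Standing.exists_closedLoop_bound (hs : Standing P H M N U V) {Q : RatFunc ℝ}
    (hQ : MemRH Q) : ∃ B : ℝ, 0 ≤ B ∧ ∀ᵐ ω ∂circMeasure, ∀ i j,
      ‖(matOnCirc P.Gzv ω +
        onCirc (M * (M * Q - U)) ω • (matOnCirc P.Gzu ω * matOnCirc P.Gyv ω)) i j‖ ≤ B := by
  have hM := hs.M_ne
  have ra := hs.num_mem hQ
  have rb := hs.den_mem hQ
  have e1 : M * (M * Q - U) * P.Gyu = N * (M * Q - U) := by
    rw [← hs.Gyu_mul]; ring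
  have e2 : P.Gyu + P.Gyu * (M * (M * Q - U)) * P.Gyu = N * (N * Q + V) := by
    have := hs.bezout_youla Q
    rw [hs.fact]
    field_simp
    linear_combination (-N) * this
  have hreg : ∀ z : ℂ, ‖z‖ = 1 → RegMatAt z (P.Gzv + (M * (M * Q - U)) • (P.Gzu * P.Gyv)) := by
    intro z hz
    refine P.regMatAt_closedLoop hs.stab hs.det hz.ge
      (RegAt.mul (hs.hM.noPolesOnCircle z hz) (ra.noPolesOnCircle z hz)).1 ?_ ?_
    · rw [e1]
      exact (RegAt.mul (hs.hN.noPolesOnCircle z hz) (ra.noPolesOnCircle z hz)).1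
    · rw [e2]
      exact (RegAt.mul (hs.hN.noPolesOnCircle z hz) (rb.noPolesOnCircle z hz)).1
  choose B hB hB' using fun i j => exists_norm_onCirc_le (fun z hz => hreg z hz i j)
  refine ⟨∑ i, ∑ j, B i j, Finset.sum_nonneg fun i _ => Finset.sum_nonneg fun j _ => (hB i j).le,
    ?_⟩
  filter_upwards [matOnCirc_add_smul_mul_ae P.Gzv (M * (M * Q - U)) P.Gzu P.Gyv] with ω hω i j
  rw [← hω]
  calc _ ≤ B i j := hB' i j ω
    _ ≤ ∑ j, B i j := Finset.single_le_sum (f := B i) (fun j _ => (hB i j).le) (Finset.mem_univ j)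
    _ ≤ _ := Finset.single_le_sum (f := fun i => ∑ j, B i j)
      (fun i _ => Finset.sum_nonneg fun j _ => (hB i j).le) (Finset.mem_univ i)

lemma normTwoSq_eq_ofReal {m k : ℕ} (X : ℝ → Matrix (Fin m) (Fin k) ℂ) :
    normTwoSq X = ∫⁻ ω, ENNReal.ofReal (∑ i, ∑ j, ‖X ω i j‖ ^ 2) ∂circMeasure := by
  refine lintegral_congr fun ω => ?_
  rw [ENNReal.ofReal_sum_of_nonneg fun i _ => Finset.sum_nonneg fun j _ => sq_nonneg _]
  refine Finset.sum_congr rfl fun i _ => ?_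
  rw [ENNReal.ofReal_sum_of_nonneg fun j _ => sq_nonneg _]
  exact Finset.sum_congr rfl fun j _ => enorm_sq _

lemma Standing.phi_lt_top (hs : Standing P H M N U V) {σ : ℝ} {Q : RatFunc ℝ}
    (hQ : Q ∈ ThetaQ H M N V σ) : phi P H M N V σ Q < ∞ := by
  obtain ⟨hQ, hlt⟩ := hQ
  obtain ⟨B, hB, h1⟩ := hs.exists_closedLoop_bound hQ
  rw [hs.phi_eq]
  refine ENNReal.add_lt_top.2 ⟨?_, ?_⟩
  · rw [normTwoSq_eq_ofReal]
    calc _ ≤ ∫⁻ _, ENNReal.ofReal (∑ _ : Fin nz, ∑ _ : Fin nv, B ^ 2) ∂circMeasure := by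
          refine lintegral_mono_ae ?_
          filter_upwards [h1] with ω h2
          refine ENNReal.ofReal_le_ofReal (Finset.sum_le_sum fun i _ => Finset.sum_le_sum
            fun j _ => pow_le_pow_left₀ (norm_nonneg _) (h2 i j) 2)
      _ < ∞ := by
          rw [lintegral_const, measure_univ, mul_one]
          exact ENNReal.ofReal_lt_top
  · exact ENNReal.div_lt_top (ENNReal.pow_ne_top (hs.crossNorm_lt_top (hs.crossTerm_mem hQ)).ne)
      (tsub_pos_of_lt hlt).ne'

/-- An affine family of stable rational functions, evaluated on the circle. -/
lemma onCirc_line {p q : RatFunc ℝ} (hp : MemRH p) (hq : MemRH q) (δ ω : ℝ) :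
    onCirc (p + RatFunc.C δ * q) ω = onCirc p ω + δ * onCirc q ω := by
  have h := RegAt.mul (regAt_C (pt ω) δ).1 (hq.regAt ω)
  rw [onCirc_add (hp.regAt ω) h.1, onCirc_mul (regAt_C (pt ω) δ).1 (hq.regAt ω)]
  congr 2
  exact (regAt_C (pt ω) δ).2

section Line

variable (hs : Standing P H M N U V) {Q s : RatFunc ℝ} (hQ : MemRH Q) (hs' : MemRH s)

include hs hQ hs'

lemma Standing.tendsto_effort :
    Tendsto (fun δ : ℝ => effort H M N V (Q + RatFunc.C δ * s)) (𝓝 0)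
      (𝓝 (effort H M N V Q)) := by
  have hp : MemRH (H * N * (M * Q - U)) :=
    mem_ringRH.1 (ringRH.mul_mem (ringRH.mul_mem hs.hH hs.hN) (hs.num_mem hQ))
  have hq : MemRH (H * N * M * s) := mem_ringRH.1
    (ringRH.mul_mem (ringRH.mul_mem (ringRH.mul_mem hs.hH hs.hN) hs.hM) hs')
  obtain ⟨B, hB, h1⟩ := exists_norm_onCirc_le hp.noPolesOnCircle
  obtain ⟨B', hB', h2⟩ := exists_norm_onCirc_le hq.noPolesOnCircle
  have e : ∀ δ : ℝ, H * N * (M * (Q + RatFunc.C δ * s) - U) =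
      H * N * (M * Q - U) + RatFunc.C δ * (H * N * M * s) := fun δ => by ring
  have h := tendsto_lintegral_ofReal (B := (B + B') ^ 2)
    (F := fun δ ω => ‖onCirc (H * N * (M * Q - U)) ω + δ * onCirc (H * N * M * s) ω‖ ^ 2)
    (fun δ => ((measurable_onCirc _).add ((measurable_onCirc _).const_mul _)).norm.pow_const 2)
    (Eventually.of_forall fun ω δ hδ => pow_le_pow_left₀ (norm_nonneg _)
      (norm_add_mul_le (h1 ω) (h2 ω) hδ) 2) (fun ω => by fun_prop)
  simp only [Complex.ofReal_zero, zero_mul, add_zero] at h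
  simpa only [hs.effort_eq, e, onCirc_line hp hq] using h

lemma Standing.tendsto_crossNorm :
    Tendsto (fun δ : ℝ => crossNorm P (crossTerm H M N U V (Q + RatFunc.C δ * s))) (𝓝 0)
      (𝓝 (crossNorm P (crossTerm H M N U V Q))) := by
  have rM := mem_ringRH.2 hs.hM
  have ra := mem_ringRH.2 (hs.num_mem hQ)
  have rb := mem_ringRH.2 (hs.den_mem hQ)
  have rk : MemRH (H * M ^ 2) := mem_ringRH.1 (ringRH.mul_mem hs.hH (ringRH.pow_mem rM 2))
  have rMs : MemRH (M * s) := mem_ringRH.1 (ringRH.mul_mem rM hs')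
  have rNs : MemRH (N * s) := mem_ringRH.1 (ringRH.mul_mem hs.hN hs')
  obtain ⟨B, hB, h1⟩ := exists_norm_onCirc_le (mem_ringRH.1 ra).noPolesOnCircle
  obtain ⟨B', hB', h2⟩ := exists_norm_onCirc_le rMs.noPolesOnCircle
  obtain ⟨E, hE, h3⟩ := exists_norm_onCirc_le (mem_ringRH.1 rb).noPolesOnCircle
  obtain ⟨E', hE', h4⟩ := exists_norm_onCirc_le rNs.noPolesOnCircle
  obtain ⟨K, hK, h5⟩ := exists_norm_onCirc_le rk.noPolesOnCircle
  obtain ⟨_, Z, -, hZ, h6⟩ := hs.zu_bounds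
  obtain ⟨_, Y, -, hY, h7⟩ := hs.yv_bounds
  have e : ∀ δ ω : ℝ, onCirc (crossTerm H M N U V (Q + RatFunc.C δ * s)) ω =
      onCirc (H * M ^ 2) ω * (onCirc (M * Q - U) ω + δ * onCirc (M * s) ω) *
        (onCirc (N * Q + V) ω + δ * onCirc (N * s) ω) := fun δ ω => by
    have e1 : M * (Q + RatFunc.C δ * s) - U = (M * Q - U) + RatFunc.C δ * (M * s) := by ring
    have e2 : N * (Q + RatFunc.C δ * s) + V = (N * Q + V) + RatFunc.C δ * (N * s) := by ring
    have hQ' : MemRH (Q + RatFunc.C δ * s) :=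
      mem_ringRH.1 (ringRH.add_mem hQ (ringRH.mul_mem (C_mem_ringRH δ) hs'))
    rw [crossTerm, onCirc_mul ((rk.regAt ω).mul ((hs.num_mem hQ').regAt ω)).1
      ((hs.den_mem hQ').regAt ω), onCirc_mul (rk.regAt ω) ((hs.num_mem hQ').regAt ω), e1, e2,
      onCirc_line ra rMs, onCirc_line rb rNs]
  have h := tendsto_lintegral_ofReal
    (B := K * (B + B') * (E + E') * (Real.sqrt Z * Real.sqrt Y))
    (F := fun δ ω => ‖onCirc (H * M ^ 2) ω * (onCirc (M * Q - U) ω + δ * onCirc (M * s) ω) *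
        (onCirc (N * Q + V) ω + δ * onCirc (N * s) ω)‖ *
        (Real.sqrt (P.zuSq ω) * Real.sqrt (P.yvSq ω)))
    (fun δ => ((((measurable_onCirc _).mul
      ((measurable_onCirc _).add ((measurable_onCirc _).const_mul _))).mul
      ((measurable_onCirc _).add ((measurable_onCirc _).const_mul _))).norm).mul
      ((measurable_zuSq P).sqrt.mul (measurable_yvSq P).sqrt))
    (by
      filter_upwards [h6, h7] with ω ⟨_, h8⟩ ⟨_, h9⟩ δ hδ
      rw [norm_mul, norm_mul]
      have := h5 ω
      have := norm_add_mul_le (h1 ω) (h2 ω) hδ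
      have := norm_add_mul_le (h3 ω) (h4 ω) hδ
      gcongr)
    (fun ω => by fun_prop)
  have e0 := e 0
  simp only [map_zero, zero_mul, add_zero, Complex.ofReal_zero] at h e0
  simpa only [crossNorm, e, e0] using h

lemma Standing.tendsto_tracking :
    Tendsto (fun δ : ℝ => normTwoSq (fun ω => matOnCirc P.Gzv ω +
        onCirc (M * (M * (Q + RatFunc.C δ * s) - U)) ω •
          (matOnCirc P.Gzu ω * matOnCirc P.Gyv ω))) (𝓝 0)
      (𝓝 (normTwoSq (fun ω => matOnCirc P.Gzv ω +
        onCirc (M * (M * Q - U)) ω • (matOnCirc P.Gzu ω * matOnCirc P.Gyv ω)))) := by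
  have hp : MemRH (M * (M * Q - U)) := mem_ringRH.1 (ringRH.mul_mem hs.hM (hs.num_mem hQ))
  have hq : MemRH (M * M * s) := mem_ringRH.1 (ringRH.mul_mem (ringRH.mul_mem hs.hM hs.hM) hs')
  obtain ⟨B, hB, h1⟩ := hs.exists_closedLoop_bound hQ
  obtain ⟨E, hE, h2⟩ := exists_norm_onCirc_le hq.noPolesOnCircle
  obtain ⟨_, Z, -, hZ, h3⟩ := hs.zu_bounds
  obtain ⟨_, Y, -, hY, h4⟩ := hs.yv_bounds
  have e : ∀ δ ω : ℝ, onCirc (M * (M * (Q + RatFunc.C δ * s) - U)) ω =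
      onCirc (M * (M * Q - U)) ω + δ * onCirc (M * M * s) ω := fun δ ω => by
    rw [← onCirc_line hp hq]
    congr 1
    ring
  have h := tendsto_lintegral_ofReal
    (B := ∑ _ : Fin nz, ∑ _ : Fin nv, (B + E * (Real.sqrt Z * Real.sqrt Y)) ^ 2)
    (F := fun δ ω => ∑ i, ∑ j, ‖(matOnCirc P.Gzv ω + (onCirc (M * (M * Q - U)) ω +
      δ * onCirc (M * M * s) ω) • (matOnCirc P.Gzu ω * matOnCirc P.Gyv ω)) i j‖ ^ 2)
    (fun δ => by
      refine Finset.measurable_sum _ fun i _ => Finset.measurable_sum _ fun j _ => ?_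
      simp only [Matrix.add_apply, Matrix.smul_apply, smul_eq_mul, Matrix.mul_apply,
        Fin.sum_univ_one, matOnCirc, Matrix.map_apply]
      exact ((measurable_onCirc _).add (((measurable_onCirc _).add
        ((measurable_onCirc _).const_mul _)).mul
          ((measurable_onCirc _).mul (measurable_onCirc _)))).norm.pow_const 2)
    (by
      filter_upwards [h1, h3, h4] with ω h5 ⟨_, h6⟩ ⟨_, h7⟩ δ hδ
      refine Finset.sum_le_sum fun i _ => Finset.sum_le_sum fun j _ =>
        pow_le_pow_left₀ (norm_nonneg _) ?_ 2
      have hz : ‖onCirc (P.Gzu i 0) ω‖ ≤ Real.sqrt Z := Real.le_sqrt_of_sq_le (le_trans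
        (Finset.single_le_sum (f := fun i => ‖onCirc (P.Gzu i 0) ω‖ ^ 2)
          (fun _ _ => sq_nonneg _) (Finset.mem_univ i)) h6)
      have hy : ‖onCirc (P.Gyv 0 j) ω‖ ≤ Real.sqrt Y := Real.le_sqrt_of_sq_le (le_trans
        (Finset.single_le_sum (f := fun j => ‖onCirc (P.Gyv 0 j) ω‖ ^ 2)
          (fun _ _ => sq_nonneg _) (Finset.mem_univ j)) h7)
      have hc : ‖onCirc (M * M * s) ω * (onCirc (P.Gzu i 0) ω * onCirc (P.Gyv 0 j) ω)‖ ≤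
          E * (Real.sqrt Z * Real.sqrt Y) := by
        rw [norm_mul, norm_mul]
        have := h2 ω
        gcongr
      refine le_of_eq_of_le (congrArg norm ?_) (norm_add_mul_le (h5 i j) hc hδ)
      simp only [Matrix.add_apply, Matrix.smul_apply, smul_eq_mul, Matrix.mul_apply,
        Fin.sum_univ_one, matOnCirc, Matrix.map_apply]
      ring)
    (fun ω => by
      refine continuous_finsetSum _ fun i _ => continuous_finsetSum _ fun j _ => ?_
      simp only [Matrix.add_apply, Matrix.smul_apply, smul_eq_mul]
      fun_prop)
  simp only [Complex.ofReal_zero, zero_mul, add_zero] at h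
  simpa only [normTwoSq_eq_ofReal, e] using h

lemma Standing.tendsto_phi {σ : ℝ} (hlt : effort H M N V Q < ENNReal.ofReal (σ ^ 2)) :
    Tendsto (fun δ : ℝ => phi P H M N V σ (Q + RatFunc.C δ * s)) (𝓝 0)
      (𝓝 (phi P H M N V σ Q)) := by
  simp only [hs.phi_eq]
  refine (hs.tendsto_tracking hQ hs').add ?_
  refine ENNReal.Tendsto.div (ENNReal.Tendsto.pow (hs.tendsto_crossNorm hQ hs'))
    (Or.inr (tsub_pos_of_lt hlt).ne') (ENNReal.Tendsto.sub tendsto_const_nhds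
      (hs.tendsto_effort hQ hs') (Or.inl ENNReal.ofReal_ne_top)) (Or.inl ?_)
  exact (tsub_le_self.trans_lt ENNReal.ofReal_lt_top).ne

end Line

/-- Arbitrarily close in cost to a feasible `Q` there is one whose controller has no poles on the
circle. -/
lemma Standing.exists_perturbation (hs : Standing P H M N U V) {σ : ℝ} {Q : RatFunc ℝ}
    (hQ : Q ∈ ThetaQ H M N V σ) {ε : ℝ} (hε : 0 < ε) :
    ∃ Q', IsPerturbation P H M N U V σ Q ε Q' := by
  obtain ⟨s, hs', hfin⟩ := hs.exists_direction hQ.1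
  have h1 := (hs.tendsto_effort hQ.1 hs').eventually_lt_const hQ.2
  have h2 := (hs.tendsto_phi hQ.1 hs' hQ.2).eventually_lt_const
    (ENNReal.lt_add_right (hs.phi_lt_top hQ).ne (ENNReal.ofReal_pos.2 hε).ne')
  have h3 : ∀ᶠ δ : ℝ in 𝓝[≠] 0,
      δ ∉ {δ : ℝ | ¬ NoPolesOnCircle (youla M N U V (Q + RatFunc.C δ * s))} :=
    nhdsNE_le_cofinite _ hfin.compl_mem_cofinite
  obtain ⟨δ, h4, h5, h6⟩ := (((h1.filter_mono nhdsWithin_le_nhds).and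
    ((h2.filter_mono nhdsWithin_le_nhds).and h3))).exists
  have hQ' : MemRH (Q + RatFunc.C δ * s) :=
    mem_ringRH.1 (ringRH.add_mem hQ.1 (ringRH.mul_mem (C_mem_ringRH δ) hs'))
  exact ⟨_, ⟨hQ', h4⟩, ⟨hs.isProper_youla hQ', not_not.1 h6⟩, h5⟩

variable {n nv nz : ℕ} {P : Plant n nv nz} {H M N U V : RatFunc ℝ}

/-! ### Factor pairs -/

lemma Standing.gain_pos (hs : Standing P H M N U V) {σ : ℝ} {Q : RatFunc ℝ}
    (hQ : Q ∈ ThetaQ H M N V σ) (ha : M * Q - U ≠ 0) : 0 < gain P H σ (youla M N U V Q) := by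
  obtain ⟨hQ, hlt⟩ := hQ
  rw [hs.gain_eq hQ]
  have hσ : 0 ≤ σ ^ 2 := sq_nonneg σ
  refine div_pos (sub_pos.2 ?_) (ENNReal.toReal_pos
    (hs.crossNorm_ne_zero (hs.crossTerm_ne_zero hQ ha))
    (hs.crossNorm_lt_top (hs.crossTerm_mem hQ)).ne)
  rw [← ENNReal.toReal_ofReal hσ]
  exact (ENNReal.toReal_lt_toReal (hlt.trans ENNReal.ofReal_lt_top).ne ENNReal.ofReal_ne_top).2 hlt

lemma Standing.exists_isFactorPair (hs : Standing P H M N U V) {σ : ℝ} {Q : RatFunc ℝ}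
    (hQ : Q ∈ ThetaQ H M N V σ) (hK : MemRL (youla M N U V Q)) :
    ∃ C D : ℝ → ℂ, IsFactorPair P H M N U V σ Q C D := by
  by_cases ha : M * Q - U = 0
  · exact ⟨0, 0, fun h => absurd ha h, fun _ =>
      ⟨Eventually.of_forall fun _ => rfl, Eventually.of_forall fun _ => rfl⟩⟩
  have hK0 : youla M N U V Q ≠ 0 := div_ne_zero ha (hs.den_intDegree hQ.1).1
  have hγ := hs.gain_pos hQ ha
  obtain ⟨C, hC, hmod⟩ := hs.exists_outer hK0 hK.2 hγ
  have h : OptimalPair P H (youla M N U V Q) (gain P H σ (youla M N U V Q)) C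
      fun ω => onCirc (youla M N U V Q) ω * (C ω)⁻¹ :=
    ⟨hγ, hC.ne_zero, hmod, Eventually.of_forall fun _ => rfl⟩
  obtain ⟨B, -, hB⟩ := h.exists_bound hs hK0 hK.2
  refine ⟨C, _, fun _ => ⟨hC, ?_, ?_, h.D_eq⟩, fun h0 => absurd h0 ha⟩
  · exact MemLp.of_bound ((measurable_onCirc _).aemeasurable.mul
      hC.memHardyTwo.aemeasurable.inv).aestronglyMeasurable B hB
  · filter_upwards [hmod] with ω hω
    rw [gram_re_zu, gram_re_yv, norm_mul, hω]

lemma Standing.isFactorPair_spec (hs : Standing P H M N U V) {σ : ℝ} {Q : RatFunc ℝ}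
    (hQ : Q ∈ ThetaQ H M N V σ) (hK : MemRL (youla M N U V Q)) {C D : ℝ → ℂ}
    (h : IsFactorPair P H M N U V σ Q C D) :
    (C, D) ∈ ThetaCD P H σ ∧ J P H C D = phi P H M N V σ Q := by
  by_cases ha : M * Q - U = 0
  · exact hs.zero_spec hQ ha (h.2 ha).1 (h.2 ha).2
  · obtain ⟨hC, -, hmod, hD⟩ := h.1 ha
    refine OptimalPair.spec hs hQ ha hK hC ⟨hs.gain_pos hQ ha, hC.ne_zero, ?_, hD⟩
    filter_upwards [hmod] with ω hω
    rwa [gram_re_zu, gram_re_yv, norm_mul] at hω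

lemma Standing.exists_pair_lt (hs : Standing P H M N U V) {σ : ℝ} {Q : RatFunc ℝ}
    (hQ : Q ∈ ThetaQ H M N V σ) {ε : ℝ} (hε : 0 < ε) :
    ∃ p ∈ ThetaCD P H σ, J P H p.1 p.2 < phi P H M N V σ Q + ENNReal.ofReal ε := by
  obtain ⟨Q', hQ', hK, hlt⟩ := hs.exists_perturbation hQ hε
  obtain ⟨C, D, h⟩ := hs.exists_isFactorPair hQ' hK
  obtain ⟨h1, h2⟩ := hs.isFactorPair_spec hQ' hK h
  exact ⟨(C, D), h1, h2.trans_lt hlt⟩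

end

end SNRControl

theorem theorem1 {n nv nz : ℕ} (P : Plant n nv nz)
    (hstab : P.IsStabilizable) (hdet : P.IsDetectable)
    (H M N U V : RatFunc ℝ) (σ : ℝ) (hσ : 0 < σ ^ 2)
    (hGyu : P.Gyu ≠ 0)
    (hM : MemRH M) (hN : MemRH N) (hU : MemRH U) (hV : MemRH V)
    (hM0 : M ≠ 0) (hfact : P.Gyu = N * M⁻¹) (hbezout : V * M + U * N = 1)
    (hH : MemRH H) (hH0 : NoZerosOnCircle H)
    (hzu : NoPolesOnCircle P.gramZu) (hzu0 : NoZerosOnCircle P.gramZu)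
    (hyv : NoPolesOnCircle P.gramYv) (hyv0 : NoZerosOnCircle P.gramYv) :
    (⨅ p ∈ ThetaCD P H σ, J P H p.1 p.2) = (⨅ Q ∈ ThetaQ H M N V σ, phi P H M N V σ Q) ∧
    ∀ Q ∈ ThetaQ H M N V σ, ∀ ε : ℝ, 0 < ε →
      (∃ Q' : RatFunc ℝ, IsPerturbation P H M N U V σ Q ε Q') ∧
      ∀ Q' : RatFunc ℝ, IsPerturbation P H M N U V σ Q ε Q' →
        (∃ C D : ℝ → ℂ, IsFactorPair P H M N U V σ Q' C D) ∧
        ∀ C D : ℝ → ℂ, IsFactorPair P H M N U V σ Q' C D →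
          (C, D) ∈ ThetaCD P H σ ∧ J P H C D < phi P H M N V σ Q + ENNReal.ofReal ε := by
  have hs : Standing P H M N U V := ⟨hstab, hdet, hGyu, hM, hN, hU, hV, hM0, hfact, hbezout, hH,
    hH0, hzu, hzu0, hyv, hyv0⟩
  refine ⟨le_antisymm ?_ ?_, fun Q hQ ε hε => ⟨hs.exists_perturbation hQ hε, ?_⟩⟩
  · refine le_iInf₂ fun Q hQ => ENNReal.le_of_forall_pos_le_add fun ε hε _ => ?_
    obtain ⟨p, hp, hlt⟩ := hs.exists_pair_lt hQ (ε := ε) (by exact_mod_cast hε)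
    rw [ENNReal.ofReal_coe_nnreal] at hlt
    exact (iInf₂_le p hp).trans hlt.le
  · refine le_iInf₂ fun p hp => ?_
    obtain ⟨Q, hQ, hle⟩ := hs.exists_phi_le hσ (C := p.1) (D := p.2) hp
    exact (iInf₂_le Q hQ).trans hle
  · rintro Q' ⟨hQ', hK, hlt⟩
    refine ⟨hs.exists_isFactorPair hQ' hK, fun C D h => ?_⟩
    obtain ⟨h1, h2⟩ := hs.isFactorPair_spec hQ' hK h
    exact ⟨h1, h2.trans_lt hlt⟩
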